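/- Conventions. Manifolds are smooth, finite-dimensional and without boundary; $S^1=\mathbb R/\mathbb Z$. In a Lie groupoid $X_1\rightrightarrows X_0$ (with $X_0,X_1$ Hausdorff and second countable, and $s,t$ surjective submersions) a product $xy$ is defined if $t(x)=s(y)$; $X_2$ and $X_3$ denote the manifolds of composable pairs and triples, $\epsilon:X_0\to X_1$ is the unit map, $\epsilon_2:X_0\to X_2$, $u\mapsto(\epsilon(u),\epsilon(u))$, and $\partial:\Omega^k(X_p)\to\Omega^k(X_{p+1})$ is the alternating sum of the pull-backs along the face maps, so $(\partial\alpha)(x,y)=\alpha(y)-\alpha(xy)+\alpha(x)$ for $p=1$. The groupoid is $s$-connected if all fibres of $s$ are connected. An element $\eta+\omega$ with $\eta\in\Omega^1(X_2)$, $\omega\in\Omega^2(X_1)$ is a de Rham 3-cocycle if $\partial\eta=0$, $d\eta+\partial\omega=0$ and $d\omega=0$; it is of integer class if its class lies in the image of $H^3(X_\bullet,\mathbb Z)\to H^3(X_\bullet,\mathbb R)\cong H^3_{DR}(X_\bullet)$. A connection on a principal $S^1$-bundle is an invariant 1-form with value $1$ on the vector field generating the $S^1$-action. An $S^1$-central extension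 of $X_1\rightrightarrows X_0$ on a principal $S^1$-bundle $\pi:R_1\to X_1$ is a Lie groupoid structure $R_1\rightrightarrows X_0$ such that $\pi$ is a morphism of groupoids over $\mathrm{id}_{X_0}$ and $(a\cdot x)(b\cdot y)=ab\cdot(xy)$ for $a,b\in S^1$. A connection $\theta$ on $R_1$ is then a pseudo-connection with pseudo-curvature $\eta+\omega$ if $\partial\theta=\pi^*\eta$ on $R_2$ and $d\theta=-\pi^*\omega$ on $R_1$. Theorem. Let $X_1\rightrightarrows X_0$ be an $s$-connected Lie groupoid and $\eta+\omega$, with $\eta\in\Omega^1(X_2)$ and $\omega\in\Omega^2(X_1)$, a de Rham 3-cocycle such that $\omega$ represents an integer cohomology class in $H^2_{DR}(X_1)$. Let $\pi:R_1\to X_1$ be a principal $S^1$-bundle with a connection $\theta\in\Omega^1(R_1)$ of curvature $-\omega$, i.e. $d\theta=-\pi^*\omega$. Assume that the bundle $\epsilon^*R_1\to X_0$ with the flat connection $\epsilon^*\theta-\pi^*\epsilon_2^*\eta$ has trivial holonomy. Then this bundle has a horizontal section, and for every horizontal section $\sigma$ there is exactly one Lie groupoid structure $R_1\rightrightarrows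 X_0$ with unit map $\sigma$ that makes $\pi:R_1\to X_1$ an $S^1$-central extension of $X_1\rightrightarrows X_0$ for which $\theta$ is a pseudo-connection with pseudo-curvature $\eta+\omega$. In particular, $\eta+\omega$ is of integer class. -/

import Mathlib

open Set Module MeasureTheory
open scoped Manifold ContDiff Topology

section Submersions

variable (E E' M M' : Type*)
  [NormedAddCommGroup E] [NormedSpace ℝ E] [NormedAddCommGroup E'] [NormedSpace ℝ E']
  [TopologicalSpace M] [ChartedSpace E M] [TopologicalSpace M'] [ChartedSpace E' M']

/-- Smooth maps between manifolds without boundary modelled on `E` and `E'`. -/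
abbrev SmoothMap := C^∞⟮𝓘(ℝ, E), M; 𝓘(ℝ, E'), M'⟯

/-- Surjective submersions: surjective smooth maps all of whose tangent maps are surjective. -/
structure SurjSubmersion where
  toMap : SmoothMap E E' M M'
  surjective : Function.Surjective toMap
  mfderiv_surjective : ∀ x, Function.Surjective (mfderiv 𝓘(ℝ, E) 𝓘(ℝ, E') toMap x)

end Submersions

section SubmersionCharts

variable {E E' M M' : Type*}
  [NormedAddCommGroup E] [NormedSpace ℝ E] [FiniteDimensional ℝ E]
  [NormedAddCommGroup E'] [NormedSpace ℝ E'] [FiniteDimensional ℝ E']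
  [TopologicalSpace M] [ChartedSpace E M] [IsManifold 𝓘(ℝ, E) ∞ M]
  [TopologicalSpace M'] [ChartedSpace E' M'] [IsManifold 𝓘(ℝ, E') ∞ M']

/-- A surjective linear map is the first component of an isomorphism onto a product. -/
theorem exists_equiv_prod_of_surjective (D : E →L[ℝ] E') (hD : Function.Surjective D) :
    ∃ (w : E →L[ℝ] EuclideanSpace ℝ (Fin (finrank ℝ E - finrank ℝ E')))
      (A : E ≃L[ℝ] E' × EuclideanSpace ℝ (Fin (finrank ℝ E - finrank ℝ E'))),
      (A : E →L[ℝ] _) = D.prod w := by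
  have hrk := LinearMap.finrank_range_add_finrank_ker (D : E →ₗ[ℝ] E')
  rw [LinearMap.range_eq_top.2 hD, finrank_top] at hrk
  obtain ⟨p, hp⟩ := LinearMap.exists_leftInverse_of_injective
    (LinearMap.ker (D : E →ₗ[ℝ] E')).subtype (by simp)
  let i : LinearMap.ker (D : E →ₗ[ℝ] E') ≃ₗ[ℝ]
      EuclideanSpace ℝ (Fin (finrank ℝ E - finrank ℝ E')) :=
    LinearEquiv.ofFinrankEq _ _ (by rw [finrank_euclideanSpace_fin]; omega)
  let w : E →ₗ[ℝ] EuclideanSpace ℝ (Fin (finrank ℝ E - finrank ℝ E')) := i.toLinearMap ∘ₗ p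
  have hinj : Function.Injective ((D : E →ₗ[ℝ] E').prod w) := by
    rw [← LinearMap.ker_eq_bot, LinearMap.ker_eq_bot']
    intro v hv
    have h1 : D v = 0 := congrArg Prod.fst hv
    have h2 : i (p v) = 0 := congrArg Prod.snd hv
    have h3 : p v = 0 := by simpa using h2
    have h4 : p v = ⟨v, h1⟩ := by
      have := LinearMap.congr_fun hp ⟨v, h1⟩
      simpa using this
    rw [h3] at h4
    exact (congrArg Subtype.val h4).symm
  let A := LinearEquiv.ofInjectiveOfFinrankEq ((D : E →ₗ[ℝ] E').prod w) hinj (by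
    rw [finrank_prod, finrank_euclideanSpace_fin]; omega)
  refine ⟨LinearMap.toContinuousLinearMap w, A.toContinuousLinearEquiv, ?_⟩
  ext v <;> rfl

/-- Local normal form of a submersion: near every point there is a chart whose first component is
the chosen chart of the base. -/
theorem SurjSubmersion.exists_chart (g : SurjSubmersion E E' M M') (b : M) :
    ∃ κ : OpenPartialHomeomorph M (E' × EuclideanSpace ℝ (Fin (finrank ℝ E - finrank ℝ E'))),
      b ∈ κ.source ∧
      (∀ y ∈ κ.source, g.toMap y ∈ (chartAt E' (g.toMap b)).source ∧
        (κ y).1 = chartAt E' (g.toMap b) (g.toMap y)) ∧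
      ContMDiffOn 𝓘(ℝ, E) 𝓘(ℝ, E' × EuclideanSpace ℝ (Fin (finrank ℝ E - finrank ℝ E'))) ∞
        κ κ.source ∧
      ContMDiffOn 𝓘(ℝ, E' × EuclideanSpace ℝ (Fin (finrank ℝ E - finrank ℝ E'))) 𝓘(ℝ, E) ∞
        κ.symm κ.target := by
  set ψ := chartAt E b with hψ
  set χ := chartAt E' (g.toMap b) with hχ
  have hb : b ∈ ψ.source := mem_chart_source E b
  let G : E → E' := fun v => χ (g.toMap (ψ.symm v))
  let O : Set E := ψ.target ∩ ψ.symm ⁻¹' (g.toMap ⁻¹' χ.source)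
  have hO : IsOpen O := ψ.isOpen_inter_preimage_symm
    (χ.open_source.preimage g.toMap.contMDiff.continuous)
  have hbO : ψ b ∈ O := ⟨ψ.map_source hb, by
    simp only [mem_preimage, ψ.left_inv hb]; exact mem_chart_source E' _⟩
  have hG : ContDiffOn ℝ ∞ G O := by
    rw [← contMDiffOn_iff_contDiffOn]
    refine (contMDiffOn_chart (I := 𝓘(ℝ, E')) (n := ∞) (x := g.toMap b)).comp
      (g.toMap.contMDiff.comp_contMDiffOn
        ((contMDiffOn_chart_symm (I := 𝓘(ℝ, E)) (n := ∞) (x := b)).mono inter_subset_left)) ?_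
    intro v hv
    exact hv.2
  have hGsurj : Function.Surjective (fderiv ℝ G (ψ b)) := by
    have h := g.mfderiv_surjective b
    have hd : MDifferentiableAt 𝓘(ℝ, E) 𝓘(ℝ, E') g.toMap b :=
      g.toMap.contMDiff.mdifferentiableAt (by simp)
    have h2 := hd.hasMFDerivAt.2
    simp only [writtenInExtChartAt, extChartAt, mfld_simps] at h2
    let D : E →L[ℝ] E' := mfderiv 𝓘(ℝ, E) 𝓘(ℝ, E') g.toMap b
    have h3 : HasFDerivWithinAt G D univ (ψ b) := h2
    rw [hasFDerivWithinAt_univ] at h3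
    rw [h3.fderiv]
    exact h
  obtain ⟨w, A, hA⟩ := exists_equiv_prod_of_surjective _ hGsurj
  let H : E → E' × EuclideanSpace ℝ (Fin (finrank ℝ E - finrank ℝ E')) := fun v => (G v, w v)
  have hH : ContDiffOn ℝ ∞ H O := hG.prodMk w.contDiff.contDiffOn
  have hHat : ContDiffAt ℝ ∞ H (ψ b) := hH.contDiffAt (hO.mem_nhds hbO)
  have hH' : HasFDerivAt H (A : E →L[ℝ] _) (ψ b) := by
    rw [hA]
    exact ((hG.contDiffAt (hO.mem_nhds hbO)).differentiableAt (by simp)).hasFDerivAt.prodMk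
      w.hasFDerivAt
  let e := hHat.toOpenPartialHomeomorph H hH' (by simp)
  have heH : (e : E → _) = H := rfl
  let O' : Set E := O ∩ (fderiv ℝ H) ⁻¹'
    (range ((↑) : (E ≃L[ℝ] E' × EuclideanSpace ℝ (Fin (finrank ℝ E - finrank ℝ E'))) →
      (E →L[ℝ] E' × EuclideanSpace ℝ (Fin (finrank ℝ E - finrank ℝ E')))))
  have hO' : IsOpen O' := (hH.continuousOn_fderiv_of_isOpen hO (by simp)).isOpen_inter_preimage hO
    (ContinuousLinearEquiv.isOpen)
  have hbO' : ψ b ∈ O' := ⟨hbO, ⟨A, hH'.fderiv.symm⟩⟩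
  let e' := e.restrOpen O' hO'
  have he's : e'.source = e.source ∩ O' := rfl
  have hsymm : ContDiffOn ℝ ∞ e'.symm e'.target := by
    intro z hz
    have hz' : e'.symm z ∈ e'.source := e'.map_target hz
    have h1 : e'.symm z ∈ O' := hz'.2
    obtain ⟨B, hB⟩ := h1.2
    have hc : ContDiffAt ℝ ∞ H (e'.symm z) := hH.contDiffAt (hO.mem_nhds h1.1)
    refine (e'.contDiffAt_symm (f₀' := B) hz ?_ hc).contDiffWithinAt
    rw [hB]
    exact (hc.differentiableAt (by simp)).hasFDerivAt
  have hbe : ψ b ∈ e.source := hHat.mem_toOpenPartialHomeomorph_source hH' (by simp)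
  refine ⟨ψ.trans e', ?_, ?_, ?_, ?_⟩
  · rw [OpenPartialHomeomorph.trans_source]
    exact ⟨hb, hbe, hbO'⟩
  · intro y hy
    rw [OpenPartialHomeomorph.trans_source] at hy
    obtain ⟨hy1, hy2, hy3⟩ := hy
    have h2 : g.toMap (ψ.symm (ψ y)) ∈ χ.source := hy3.1.2
    rw [ψ.left_inv hy1] at h2
    refine ⟨h2, ?_⟩
    change χ (g.toMap (ψ.symm (ψ y))) = _
    rw [ψ.left_inv hy1]
  · have h1 : ContMDiffOn 𝓘(ℝ, E)
        𝓘(ℝ, E' × EuclideanSpace ℝ (Fin (finrank ℝ E - finrank ℝ E'))) ∞ (H ∘ ψ)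
        (ψ.trans e').source := by
      refine (contMDiffOn_iff_contDiffOn.2 hH).comp
        ((contMDiffOn_chart (I := 𝓘(ℝ, E)) (n := ∞) (x := b)).mono ?_) ?_
      · intro y hy
        rw [OpenPartialHomeomorph.trans_source] at hy
        exact hy.1
      · intro y hy
        rw [OpenPartialHomeomorph.trans_source] at hy
        exact hy.2.2.1
    exact h1
  · have h1 : ContMDiffOn 𝓘(ℝ, E' × EuclideanSpace ℝ (Fin (finrank ℝ E - finrank ℝ E')))
        𝓘(ℝ, E) ∞ (ψ.symm ∘ e'.symm) (ψ.trans e').target := by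
      refine (contMDiffOn_chart_symm (I := 𝓘(ℝ, E)) (n := ∞) (x := b)).comp
        ((contMDiffOn_iff_contDiffOn.2 hsymm).mono ?_) ?_
      · intro z hz
        rw [OpenPartialHomeomorph.trans_target] at hz
        exact hz.1
      · intro z hz
        rw [OpenPartialHomeomorph.trans_target] at hz
        exact hz.2
    exact h1

end SubmersionCharts

section FibreProducts

/-- The model space of the fibre product of a smooth map with source modelled on `EM` and a
submersion from a manifold modelled on `EN` to one modelled on `EB`. -/
abbrev FibModel (EM EN EB : Type*) [NormedAddCommGroup EM] [NormedSpace ℝ EM]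
    [NormedAddCommGroup EN] [NormedSpace ℝ EN] [NormedAddCommGroup EB] [NormedSpace ℝ EB] :=
  EM × EuclideanSpace ℝ (Fin (finrank ℝ EN - finrank ℝ EB))

/-- The fibre product `M ×_B N = {(x, y) | f x = g y}` of a smooth map `f : M → B` and a surjective
submersion `g : N → B`. -/
@[ext]
structure FibProd {EM EN EB M N B : Type*}
    [NormedAddCommGroup EM] [NormedSpace ℝ EM] [NormedAddCommGroup EN] [NormedSpace ℝ EN]
    [NormedAddCommGroup EB] [NormedSpace ℝ EB]
    [TopologicalSpace M] [ChartedSpace EM M] [TopologicalSpace N] [ChartedSpace EN N]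
    [TopologicalSpace B] [ChartedSpace EB B]
    (f : SmoothMap EM EB M B) (g : SurjSubmersion EN EB N B) where
  left : M
  right : N
  condition : f left = g.toMap right

namespace FibProd

section Topology

variable {EM EN EB M N B : Type*}
  [NormedAddCommGroup EM] [NormedSpace ℝ EM] [NormedAddCommGroup EN] [NormedSpace ℝ EN]
  [NormedAddCommGroup EB] [NormedSpace ℝ EB]
  [TopologicalSpace M] [ChartedSpace EM M] [TopologicalSpace N] [ChartedSpace EN N]
  [TopologicalSpace B] [ChartedSpace EB B]
  {f : SmoothMap EM EB M B} {g : SurjSubmersion EN EB N B}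

/-- The fibre product carries the subspace topology of `M × N`. -/
instance : TopologicalSpace (FibProd f g) :=
  TopologicalSpace.induced (fun p => (p.left, p.right)) inferInstance

theorem isInducing_pair : Topology.IsInducing (fun p : FibProd f g => (p.left, p.right)) := ⟨rfl⟩

theorem continuous_left : Continuous (fun p : FibProd f g => p.left) :=
  continuous_fst.comp isInducing_pair.continuous

theorem continuous_right : Continuous (fun p : FibProd f g => p.right) :=
  continuous_snd.comp isInducing_pair.continuous

end Topology

variable {EM EN EB M N B : Type*}
  [NormedAddCommGroup EM] [NormedSpace ℝ EM]
  [NormedAddCommGroup EN] [NormedSpace ℝ EN] [FiniteDimensional ℝ EN]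
  [NormedAddCommGroup EB] [NormedSpace ℝ EB] [FiniteDimensional ℝ EB]
  [TopologicalSpace M] [ChartedSpace EM M] [IsManifold 𝓘(ℝ, EM) ∞ M]
  [TopologicalSpace N] [ChartedSpace EN N] [IsManifold 𝓘(ℝ, EN) ∞ N]
  [TopologicalSpace B] [ChartedSpace EB B] [IsManifold 𝓘(ℝ, EB) ∞ B]
  {f : SmoothMap EM EB M B} {g : SurjSubmersion EN EB N B}

/-- The chart of `M ×_B N` around `p = (a, b)`: the chart of `M` at `a` together with the fibre
coordinate of a submersion chart of `g` at `b`. -/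
theorem exists_chart (p : FibProd f g) :
    ∃ c : OpenPartialHomeomorph (FibProd f g) (FibModel EM EN EB),
      p ∈ c.source ∧
      (∃ κ : OpenPartialHomeomorph N (EB × EuclideanSpace ℝ (Fin (finrank ℝ EN - finrank ℝ EB))),
        ContMDiffOn 𝓘(ℝ, EN) 𝓘(ℝ, EB × EuclideanSpace ℝ (Fin (finrank ℝ EN - finrank ℝ EB))) ∞
          κ κ.source ∧
        (∀ q ∈ c.source, q.left ∈ (chartAt EM p.left).source ∧ q.right ∈ κ.source) ∧
        ∀ q, c q = (chartAt EM p.left q.left, (κ q.right).2)) ∧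
      ContMDiffOn 𝓘(ℝ, FibModel EM EN EB) 𝓘(ℝ, EM) ∞ (fun z => (c.symm z).left) c.target ∧
      ContMDiffOn 𝓘(ℝ, FibModel EM EN EB) 𝓘(ℝ, EN) ∞ (fun z => (c.symm z).right) c.target := by
  classical
  obtain ⟨κ, hbκ, hκ, hκs, hκs'⟩ := g.exists_chart p.right
  set φ := chartAt EM p.left with hφ
  set χ := chartAt EB (g.toMap p.right) with hχ
  -- the base coordinate of a point with first coordinate `u`
  let β : EM → EB := fun u => χ (f (φ.symm u))
  let O : Set EM := φ.target ∩ φ.symm ⁻¹' (f ⁻¹' χ.source)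
  have hO : IsOpen O := φ.isOpen_inter_preimage_symm
    (χ.open_source.preimage f.contMDiff.continuous)
  have hβ : ContMDiffOn 𝓘(ℝ, EM) 𝓘(ℝ, EB) ∞ β O := by
    refine (contMDiffOn_chart (I := 𝓘(ℝ, EB)) (n := ∞) (x := g.toMap p.right)).comp
      (f.contMDiff.comp_contMDiffOn
        ((contMDiffOn_chart_symm (I := 𝓘(ℝ, EM)) (n := ∞) (x := p.left)).mono inter_subset_left)) ?_
    intro v hv
    exact hv.2
  let γ : FibModel EM EN EB → EB × EuclideanSpace ℝ (Fin (finrank ℝ EN - finrank ℝ EB)) :=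
    fun z => (β z.1, z.2)
  have hγ : ContMDiffOn 𝓘(ℝ, FibModel EM EN EB)
      𝓘(ℝ, EB × EuclideanSpace ℝ (Fin (finrank ℝ EN - finrank ℝ EB))) ∞ γ (Prod.fst ⁻¹' O) := by
    rw [contMDiffOn_iff_contDiffOn] at hβ ⊢
    exact (hβ.comp contDiff_fst.contDiffOn (fun z hz => hz)).prodMk contDiff_snd.contDiffOn
  let T : Set (FibModel EM EN EB) := (Prod.fst ⁻¹' O) ∩ γ ⁻¹' κ.target
  have hT : IsOpen T := hγ.continuousOn.isOpen_inter_preimage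
    (hO.preimage continuous_fst) κ.open_target
  have hmem : ∀ z ∈ T, f (φ.symm z.1) = g.toMap (κ.symm (γ z)) := by
    intro z hz
    have h1 := hκ _ (κ.map_target hz.2)
    rw [κ.right_inv hz.2] at h1
    exact χ.injOn hz.1.2 h1.1 h1.2
  let c : OpenPartialHomeomorph (FibProd f g) (FibModel EM EN EB) :=
    { toFun := fun q => (φ q.left, (κ q.right).2)
      invFun := fun z => if h : z ∈ T then ⟨φ.symm z.1, κ.symm (γ z), hmem z h⟩ else p
      source := {q | q.left ∈ φ.source ∧ q.right ∈ κ.source}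
      target := T
      map_source' := by
        rintro q ⟨hq1, hq2⟩
        have h1 := hκ _ hq2
        have h2 : γ (φ q.left, (κ q.right).2) = κ q.right := by
          refine Prod.ext ?_ rfl
          change χ (f (φ.symm (φ q.left))) = _
          rw [φ.left_inv hq1, h1.2, q.condition]
        refine ⟨⟨φ.map_source hq1, ?_⟩, ?_⟩
        · simp only [mem_preimage, φ.left_inv hq1, q.condition]
          exact h1.1
        · simp only [mem_preimage, h2]
          exact κ.map_source hq2
      map_target' := by
        intro z hz
        rw [dif_pos hz]
        exact ⟨φ.map_target hz.1.1, κ.map_target hz.2⟩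
      left_inv' := by
        rintro q ⟨hq1, hq2⟩
        have h1 := hκ _ hq2
        have h2 : γ (φ q.left, (κ q.right).2) = κ q.right := by
          refine Prod.ext ?_ rfl
          change χ (f (φ.symm (φ q.left))) = _
          rw [φ.left_inv hq1, h1.2, q.condition]
        have hz : ((φ q.left, (κ q.right).2) : FibModel EM EN EB) ∈ T := by
          refine ⟨⟨φ.map_source hq1, ?_⟩, ?_⟩
          · simp only [mem_preimage, φ.left_inv hq1, q.condition]
            exact h1.1
          · simp only [mem_preimage, h2]
            exact κ.map_source hq2
        rw [dif_pos hz]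
        refine FibProd.ext ?_ ?_
        · exact φ.left_inv hq1
        · simp only [h2]
          exact κ.left_inv hq2
      right_inv' := by
        intro z hz
        simp only [dif_pos hz]
        refine Prod.ext (φ.right_inv hz.1.1) ?_
        simp only [κ.right_inv hz.2]
        rfl
      open_source := (φ.open_source.preimage continuous_left).inter
        (κ.open_source.preimage continuous_right)
      open_target := hT
      continuousOn_toFun := by
        refine ContinuousOn.prodMk ?_ ?_
        · exact φ.continuousOn.comp continuous_left.continuousOn
            (fun q hq => hq.1)
        · exact continuous_snd.comp_continuousOn
            (κ.continuousOn.comp continuous_right.continuousOn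
              (fun q hq => hq.2))
      continuousOn_invFun := by
        rw [isInducing_pair.continuousOn_iff]
        have h1 : ContinuousOn (fun z : FibModel EM EN EB => (φ.symm z.1, κ.symm (γ z))) T := by
          refine ContinuousOn.prodMk ?_ ?_
          · exact φ.continuousOn_symm.comp continuous_fst.continuousOn (fun z hz => hz.1.1)
          · exact κ.continuousOn_symm.comp (hγ.continuousOn.mono inter_subset_left)
              (fun z hz => hz.2)
        refine h1.congr ?_
        intro z hz
        simp only [Function.comp_apply, dif_pos hz] }
  refine ⟨c, ⟨mem_chart_source EM _, hbκ⟩, ⟨κ, hκs, fun q hq => hq, fun q => rfl⟩, ?_, ?_⟩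
  · have h1 : ContMDiffOn 𝓘(ℝ, FibModel EM EN EB) 𝓘(ℝ, EM) ∞
        (fun z : FibModel EM EN EB => φ.symm z.1) T := by
      refine (contMDiffOn_chart_symm (I := 𝓘(ℝ, EM)) (n := ∞) (x := p.left)).comp
        (contMDiffOn_iff_contDiffOn.2 contDiff_fst.contDiffOn) ?_
      intro z hz
      exact hz.1.1
    refine h1.congr ?_
    intro z hz
    change (if h : z ∈ T then (⟨φ.symm z.1, κ.symm (γ z), hmem z h⟩ : FibProd f g)
      else p).left = _
    rw [dif_pos hz]
  · have h1 : ContMDiffOn 𝓘(ℝ, FibModel EM EN EB) 𝓘(ℝ, EN) ∞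
        (fun z : FibModel EM EN EB => κ.symm (γ z)) T :=
      hκs'.comp (hγ.mono inter_subset_left) (fun z hz => hz.2)
    refine h1.congr ?_
    intro z hz
    change (if h : z ∈ T then (⟨φ.symm z.1, κ.symm (γ z), hmem z h⟩ : FibProd f g)
      else p).right = _
    rw [dif_pos hz]

noncomputable instance : ChartedSpace (FibModel EM EN EB) (FibProd f g) where
  atlas := range (fun p : FibProd f g => (exists_chart p).choose)
  chartAt p := (exists_chart p).choose
  mem_chart_source p := (exists_chart p).choose_spec.1
  chart_mem_atlas p := mem_range_self p

/-- A map into the model space of the form `chart ∘ h` is smooth if both components of `h` are. -/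
theorem contMDiffOn_chart_comp (p : FibProd f g)
    {E' H' M' : Type*} [NormedAddCommGroup E'] [NormedSpace ℝ E'] [TopologicalSpace H']
    {I' : ModelWithCorners ℝ E' H'} [TopologicalSpace M'] [ChartedSpace H' M']
    {h : M' → FibProd f g} {S : Set M'} (hS : ∀ x ∈ S, h x ∈ (exists_chart p).choose.source)
    (h1 : ContMDiffOn I' 𝓘(ℝ, EM) ∞ (fun x => (h x).left) S)
    (h2 : ContMDiffOn I' 𝓘(ℝ, EN) ∞ (fun x => (h x).right) S) :
    ContMDiffOn I' 𝓘(ℝ, FibModel EM EN EB) ∞ (fun x => (exists_chart p).choose (h x)) S := by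
  obtain ⟨κ, hκ, hsrc, hc⟩ := (exists_chart p).choose_spec.2.1
  have e1 : ContMDiffOn I' 𝓘(ℝ, EM) ∞ (fun x => chartAt EM p.left (h x).left) S :=
    (contMDiffOn_chart (I := 𝓘(ℝ, EM)) (n := ∞) (x := p.left)).comp h1
      (fun x hx => (hsrc _ (hS x hx)).1)
  have e2 : ContMDiffOn I' 𝓘(ℝ, EB × EuclideanSpace ℝ (Fin (finrank ℝ EN - finrank ℝ EB))) ∞
      (fun x => κ (h x).right) S :=
    hκ.comp h2 (fun x hx => (hsrc _ (hS x hx)).2)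
  have e3 : ContMDiffOn I' 𝓘(ℝ, EuclideanSpace ℝ (Fin (finrank ℝ EN - finrank ℝ EB))) ∞
      (fun x => (κ (h x).right).2) S :=
    (contMDiff_iff_contDiff.2 (contDiff_snd (𝕜 := ℝ) (n := ∞) (E := EB)
      (F := EuclideanSpace ℝ (Fin (finrank ℝ EN - finrank ℝ EB))))).comp_contMDiffOn e2
  refine (e1.prodMk_space e3).congr ?_
  intro x _
  exact hc _

instance : IsManifold 𝓘(ℝ, FibModel EM EN EB) ∞ (FibProd f g) := by
  apply isManifold_of_contDiffOn
  rintro _ _ ⟨p, rfl⟩ ⟨q, rfl⟩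
  simp only [modelWithCornersSelf_coe, modelWithCornersSelf_coe_symm, Function.id_comp,
    Function.comp_id, preimage_id, range_id, inter_univ]
  rw [← contMDiffOn_iff_contDiffOn]
  obtain ⟨-, -, hp1, hp2⟩ := (exists_chart p).choose_spec
  have hsub : ((exists_chart p).choose.symm.trans (exists_chart q).choose).source ⊆
      (exists_chart p).choose.target := by
    rw [OpenPartialHomeomorph.trans_source]; exact inter_subset_left
  refine contMDiffOn_chart_comp q ?_ (hp1.mono hsub) (hp2.mono hsub)
  intro z hz
  rw [OpenPartialHomeomorph.trans_source] at hz
  exact hz.2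

variable (f g) in
/-- The projection `M ×_B N → M`. -/
noncomputable def fst : SmoothMap (FibModel EM EN EB) EM (FibProd f g) M :=
  ⟨fun p => p.left, by
    intro p
    have h := ((exists_chart p).choose_spec.2.2.1).comp
      (contMDiffOn_chart (I := 𝓘(ℝ, FibModel EM EN EB)) (n := ∞) (x := p))
      (fun q hq => (exists_chart p).choose.map_source hq)
    refine (h.congr ?_).contMDiffAt ((exists_chart p).choose.open_source.mem_nhds
      (exists_chart p).choose_spec.1)
    intro q hq
    exact congrArg (fun r : FibProd f g => r.left) ((exists_chart p).choose.left_inv hq).symm⟩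

variable (f g) in
/-- The projection `M ×_B N → N`. -/
noncomputable def snd : SmoothMap (FibModel EM EN EB) EN (FibProd f g) N :=
  ⟨fun p => p.right, by
    intro p
    have h := ((exists_chart p).choose_spec.2.2.2).comp
      (contMDiffOn_chart (I := 𝓘(ℝ, FibModel EM EN EB)) (n := ∞) (x := p))
      (fun q hq => (exists_chart p).choose.map_source hq)
    refine (h.congr ?_).contMDiffAt ((exists_chart p).choose.open_source.mem_nhds
      (exists_chart p).choose_spec.1)
    intro q hq
    exact congrArg (fun r : FibProd f g => r.right) ((exists_chart p).choose.left_inv hq).symm⟩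

/-- The smooth map into the fibre product with prescribed components. -/
noncomputable def lift {E' M' : Type*} [NormedAddCommGroup E'] [NormedSpace ℝ E'] [TopologicalSpace M']
    [ChartedSpace E' M'] (a : SmoothMap E' EM M' M) (b : SmoothMap E' EN M' N)
    (h : ∀ x, f (a x) = g.toMap (b x)) : SmoothMap E' (FibModel EM EN EB) M' (FibProd f g) :=
  ⟨fun x => ⟨a x, b x, h x⟩, by
    have hcont : Continuous (fun x => (⟨a x, b x, h x⟩ : FibProd f g)) :=
      isInducing_pair.continuous_iff.2 (a.contMDiff.continuous.prodMk b.contMDiff.continuous)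
    intro x
    rw [contMDiffAt_iff_target]
    refine ⟨hcont.continuousAt, ?_⟩
    let p : FibProd f g := ⟨a x, b x, h x⟩
    have hS := ((exists_chart p).choose.open_source.preimage hcont)
    have := contMDiffOn_chart_comp p (h := fun x => (⟨a x, b x, h x⟩ : FibProd f g))
      (S := (fun x => (⟨a x, b x, h x⟩ : FibProd f g)) ⁻¹' (exists_chart p).choose.source)
      (fun _ hx => hx) a.contMDiff.contMDiffOn b.contMDiff.contMDiffOn
    exact this.contMDiffAt (hS.mem_nhds (exists_chart p).choose_spec.1)⟩

end FibProd

end FibreProducts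

section Maps

variable {E E' E'' M M' M'' : Type*}
  [NormedAddCommGroup E] [NormedSpace ℝ E] [NormedAddCommGroup E'] [NormedSpace ℝ E']
  [NormedAddCommGroup E''] [NormedSpace ℝ E'']
  [TopologicalSpace M] [ChartedSpace E M] [TopologicalSpace M'] [ChartedSpace E' M']
  [TopologicalSpace M''] [ChartedSpace E'' M'']

/-- The composite `g ∘ f` of surjective submersions. -/
noncomputable def SurjSubmersion.comp (g : SurjSubmersion E' E'' M' M'') (f : SurjSubmersion E E' M M') :
    SurjSubmersion E E'' M M'' where
  toMap := g.toMap.comp f.toMap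
  surjective := g.surjective.comp f.surjective
  mfderiv_surjective x := by
    have h : mfderiv 𝓘(ℝ, E) 𝓘(ℝ, E'') (g.toMap ∘ f.toMap) x = _ :=
      mfderiv_comp x (g.toMap.contMDiff.mdifferentiableAt (by simp))
        (f.toMap.contMDiff.mdifferentiableAt (by simp))
    change Function.Surjective (mfderiv 𝓘(ℝ, E) 𝓘(ℝ, E'') (g.toMap ∘ f.toMap) x)
    rw [h]
    exact (g.mfderiv_surjective (f.toMap x)).comp (f.mfderiv_surjective x)

end Maps

section Forms

variable {E E' M M' : Type*}
  [NormedAddCommGroup E] [NormedSpace ℝ E] [NormedAddCommGroup E'] [NormedSpace ℝ E']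
  [TopologicalSpace M] [ChartedSpace E M] [TopologicalSpace M'] [ChartedSpace E' M']

/-- The tangent map `T_x M → T_{f x} M'` of `f`. In Mathlib the tangent space at `x` is the model
space, a tangent vector being read in the preferred chart at `x`. -/
noncomputable def tangentAt (f : M → M') (x : M) : E →L[ℝ] E' :=
  mfderiv 𝓘(ℝ, E) 𝓘(ℝ, E') f x

/-- Fields of alternating `k`-linear forms on the tangent spaces of `M`, smooth or not. -/
abbrev PreForm (E M : Type*) [NormedAddCommGroup E] [NormedSpace ℝ E] (k : ℕ) :=
  M → E [⋀^Fin k]→L[ℝ] ℝ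

/-- The pull-back `f^* α`. -/
noncomputable def pullback {k : ℕ} (f : M → M') (α : PreForm E' M' k) : PreForm E M k :=
  fun x => (α (f x)).compContinuousLinearMap (tangentAt (E := E) (E' := E') f x)

/-- The expression of `α` in the preferred chart at `x`, a form on the target of that chart. -/
noncomputable def chartForm {k : ℕ} (α : PreForm E M k) (x : M) : PreForm E E k :=
  pullback (E := E) (E' := E) (chartAt E x).symm α

/-- The exterior derivative, computed at `x` in the preferred chart at `x`. -/
noncomputable def extD {k : ℕ} (α : PreForm E M k) : PreForm E M (k + 1) :=
  fun x => (extDeriv (chartForm α x) (chartAt E x x)).compContinuousLinearMap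
    (tangentAt (E := E) (E' := E) (chartAt E x) x)

/-- Differential `k`-forms on `M`: the expression in every preferred chart is smooth. -/
structure DiffForm (E M : Type*) [NormedAddCommGroup E] [NormedSpace ℝ E] [TopologicalSpace M]
    [ChartedSpace E M] (k : ℕ) where
  toFun : PreForm E M k
  smooth : ∀ x : M, ContDiffOn ℝ ∞ (chartForm toFun x) (chartAt E x).target

end Forms

section Singular

variable {E E' M M' : Type*}
  [NormedAddCommGroup E] [NormedSpace ℝ E] [NormedAddCommGroup E'] [NormedSpace ℝ E']
  [TopologicalSpace M] [ChartedSpace E M] [TopologicalSpace M'] [ChartedSpace E' M']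

/-- Smooth singular `q`-simplices: maps from the standard `q`-simplex to `M` that extend to a smooth
map on an open neighbourhood of it. -/
structure SmoothSimplex (E M : Type*) [NormedAddCommGroup E] [NormedSpace ℝ E] [TopologicalSpace M]
    [ChartedSpace E M] (q : ℕ) where
  toFun : stdSimplex ℝ (Fin (q + 1)) → M
  exists_extension : ∃ (U : Set (Fin (q + 1) → ℝ)) (F : (Fin (q + 1) → ℝ) → M),
    IsOpen U ∧ stdSimplex ℝ (Fin (q + 1)) ⊆ U ∧
    ContMDiffOn 𝓘(ℝ, Fin (q + 1) → ℝ) 𝓘(ℝ, E) ∞ F U ∧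
    ∀ t : stdSimplex ℝ (Fin (q + 1)), F t.1 = toFun t

namespace SmoothSimplex

/-- The image of a simplex under a smooth map. -/
noncomputable def map {q : ℕ} (f : SmoothMap E E' M M') (σ : SmoothSimplex E M q) : SmoothSimplex E' M' q where
  toFun := f ∘ σ.toFun
  exists_extension := by
    obtain ⟨U, F, hU, hs, hF, h⟩ := σ.exists_extension
    exact ⟨U, f ∘ F, hU, hs, f.contMDiff.comp_contMDiffOn hF, fun t => congrArg f (h t)⟩

/-- The `i`-th face of a simplex, opposite to the `i`-th vertex. -/
noncomputable def face {q : ℕ} (σ : SmoothSimplex E M (q + 1)) (i : Fin (q + 2)) :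
    SmoothSimplex E M q where
  toFun := σ.toFun ∘ stdSimplex.map i.succAbove
  exists_extension := by
    obtain ⟨U, F, hU, hs, hF, h⟩ := σ.exists_extension
    let L : (Fin (q + 1) → ℝ) →L[ℝ] (Fin (q + 2) → ℝ) :=
      LinearMap.toContinuousLinearMap (FunOnFinite.linearMap ℝ ℝ i.succAbove)
    refine ⟨L ⁻¹' U, F ∘ L, hU.preimage L.continuous, ?_,
      hF.comp L.contMDiff.contMDiffOn (fun t ht => ht), ?_⟩
    · intro t ht
      exact hs (stdSimplex.map i.succAbove ⟨t, ht⟩).2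
    · intro t
      exact h (stdSimplex.map i.succAbove t)

/-- Barycentric coordinates `(1 - ∑ t_i, t_1, …, t_q)` of a point of `ℝ^q`. -/
def bary {q : ℕ} (t : Fin q → ℝ) : Fin (q + 1) → ℝ := Fin.cons (1 - ∑ i, t i) t

/-- The standard simplex as a subset of `ℝ^q`: all `t` with `t_i ≥ 0` and `∑ t_i ≤ 1`. -/
def corner (q : ℕ) : Set (Fin q → ℝ) := {t | bary t ∈ stdSimplex ℝ (Fin (q + 1))}

open Classical in
/-- The simplex as a function of the coordinates `t_1, …, t_q`. Only the values on `corner q`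
matter; outside, the value is the first vertex. -/
noncomputable def param {q : ℕ} (σ : SmoothSimplex E M q) (t : Fin q → ℝ) : M :=
  if h : bary t ∈ stdSimplex ℝ (Fin (q + 1)) then σ.toFun ⟨bary t, h⟩
  else σ.toFun (stdSimplex.vertex 0)

/-- The integral of a `q`-form over a smooth singular `q`-simplex. -/
noncomputable def integral {q : ℕ} (α : PreForm E M q) (σ : SmoothSimplex E M q) : ℝ :=
  ∫ t in corner q, α (σ.param t) (fun i =>
    (mfderivWithin 𝓘(ℝ, Fin q → ℝ) 𝓘(ℝ, E) σ.param (corner q) t : (Fin q → ℝ) →L[ℝ] E)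
      (Pi.single i 1))

end SmoothSimplex

/-- Real smooth singular `q`-cochains. -/
abbrev Cochain (E M : Type*) [NormedAddCommGroup E] [NormedSpace ℝ E] [TopologicalSpace M]
    [ChartedSpace E M] (q : ℕ) := SmoothSimplex E M q → ℝ

/-- The singular coboundary. -/
noncomputable def Cochain.coboundary {q : ℕ} (c : Cochain E M q) : Cochain E M (q + 1) :=
  fun σ => ∑ i : Fin (q + 2), (-1 : ℝ) ^ (i : ℕ) * c (σ.face i)

/-- The pull-back of cochains along a smooth map. -/
noncomputable def Cochain.pullback {q : ℕ} (f : SmoothMap E E' M M') (c : Cochain E' M' q) : Cochain E M q :=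
  fun σ => c (σ.map f)

/-- Integer-valued cochains. -/
def Cochain.IsIntegerValued {q : ℕ} (c : Cochain E M q) : Prop := ∀ σ, ∃ n : ℤ, c σ = n

/-- A closed `(q+1)`-form `α` on `M` represents an integer cohomology class, i.e. its de Rham class
lies in the image of `H^{q+1}(M, ℤ) → H^{q+1}(M, ℝ)`: the singular cocycle `∫ α` is cohomologous to
an integer-valued cochain (which is then a cocycle as well). -/
def IsIntegralForm {q : ℕ} (α : PreForm E M (q + 1)) : Prop :=
  ∃ b : Cochain E M q,
    Cochain.IsIntegerValued (fun σ => SmoothSimplex.integral α σ - b.coboundary σ)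

end Singular

section Groupoids

variable {E₀ E₁ X₀ X₁ : Type*}
  [NormedAddCommGroup E₀] [NormedSpace ℝ E₀] [FiniteDimensional ℝ E₀]
  [NormedAddCommGroup E₁] [NormedSpace ℝ E₁] [FiniteDimensional ℝ E₁]
  [TopologicalSpace X₀] [ChartedSpace E₀ X₀] [IsManifold 𝓘(ℝ, E₀) ∞ X₀]
  [TopologicalSpace X₁] [ChartedSpace E₁ X₁] [IsManifold 𝓘(ℝ, E₁) ∞ X₁]

/-- Lie groupoid structures `X₁ ⇉ X₀` with source `s` and target `t`. A pair `(x, y)` is composable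
if `t x = s y`; the manifold `X₂` of composable pairs is `FibProd t.toMap s`. -/
@[ext]
structure LieGroupoid (s t : SurjSubmersion E₁ E₀ X₁ X₀) where
  one : SmoothMap E₀ E₁ X₀ X₁
  mul : SmoothMap (FibModel E₁ E₁ E₀) E₁ (FibProd t.toMap s) X₁
  inv : SmoothMap E₁ E₁ X₁ X₁
  s_one : ∀ u, s.toMap (one u) = u
  t_one : ∀ u, t.toMap (one u) = u
  s_mul : ∀ p, s.toMap (mul p) = s.toMap p.left
  t_mul : ∀ p, t.toMap (mul p) = t.toMap p.right
  s_inv : ∀ x, s.toMap (inv x) = t.toMap x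
  t_inv : ∀ x, t.toMap (inv x) = s.toMap x
  one_mul : ∀ x, mul ⟨one (s.toMap x), x, t_one _⟩ = x
  mul_one : ∀ x, mul ⟨x, one (t.toMap x), (s_one _).symm⟩ = x
  mul_assoc : ∀ x y z (h : t.toMap x = s.toMap y) (h' : t.toMap y = s.toMap z),
    mul ⟨mul ⟨x, y, h⟩, z, (t_mul ⟨x, y, h⟩).trans h'⟩ = mul ⟨x, mul ⟨y, z, h'⟩, h.trans (s_mul ⟨y, z, h'⟩).symm⟩
  mul_inv : ∀ x, mul ⟨x, inv x, (s_inv x).symm⟩ = one (s.toMap x)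
  inv_mul : ∀ x, mul ⟨inv x, x, t_inv x⟩ = one (t.toMap x)

namespace LieGroupoid

variable {s t : SurjSubmersion E₁ E₀ X₁ X₀}

/-- The manifold `X₂` of composable pairs `(x, y)`. -/
abbrev X₂ (_G : LieGroupoid s t) := FibProd t.toMap s

/-- The manifold `X₃` of composable triples, written as `((x, y), z)`. -/
abbrev X₃ (_G : LieGroupoid s t) :=
  FibProd (t.toMap.comp (FibProd.snd t.toMap s)) s

/-- The model space of `X₂`. -/
abbrev E₂ (_G : LieGroupoid s t) := FibModel E₁ E₁ E₀

/-- The model space of `X₃`. -/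
abbrev E₃ (G : LieGroupoid s t) := FibModel G.E₂ E₁ E₀

/-- All fibres of the source map are connected. -/
def IsSConnected (_G : LieGroupoid s t) : Prop := ∀ u : X₀, IsConnected (s.toMap ⁻¹' {u})

variable (G : LieGroupoid s t)

/-- `(x, y) ↦ x`. -/
noncomputable def pr₁ : SmoothMap G.E₂ E₁ G.X₂ X₁ := FibProd.fst t.toMap s

/-- `(x, y) ↦ y`. -/
noncomputable def pr₂ : SmoothMap G.E₂ E₁ G.X₂ X₁ := FibProd.snd t.toMap s

/-- `u ↦ (u, u)`, the identity morphism `ε₂ : X₀ → X₂`. -/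
noncomputable def one₂ : SmoothMap E₀ G.E₂ X₀ G.X₂ :=
  FibProd.lift G.one G.one (fun u => (G.t_one u).trans (G.s_one u).symm)

/-- `(x, y, z) ↦ (x, y)`. -/
noncomputable def pr₁₂ : SmoothMap G.E₃ G.E₂ G.X₃ G.X₂ := 
  FibProd.fst (t.toMap.comp (FibProd.snd t.toMap s)) s

/-- `(x, y, z) ↦ z`. -/
noncomputable def pr₃ : SmoothMap G.E₃ E₁ G.X₃ X₁ := 
  FibProd.snd (t.toMap.comp (FibProd.snd t.toMap s)) s

/-- `(x, y, z) ↦ (y, z)`. -/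
noncomputable def pr₂₃ : SmoothMap G.E₃ G.E₂ G.X₃ G.X₂ :=
  FibProd.lift (G.pr₂.comp G.pr₁₂) G.pr₃ (fun p => p.condition)

/-- `(x, y, z) ↦ (xy, z)`. -/
noncomputable def mul₁₂ : SmoothMap G.E₃ G.E₂ G.X₃ G.X₂ :=
  FibProd.lift (G.mul.comp G.pr₁₂) G.pr₃ (fun p => (G.t_mul _).trans p.condition)

/-- `(x, y, z) ↦ (x, yz)`. -/
noncomputable def mul₂₃ : SmoothMap G.E₃ G.E₂ G.X₃ G.X₂ :=
  FibProd.lift (G.pr₁.comp G.pr₁₂) (G.mul.comp G.pr₂₃)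
    (fun p => p.left.condition.trans (G.s_mul (G.pr₂₃ p)).symm)

/-- `∂ : Ω^k(X₁) → Ω^k(X₂)`, `(∂α)(x, y) = α(y) - α(xy) + α(x)`. -/
noncomputable def bdry₁ {k : ℕ} (α : PreForm E₁ X₁ k) : PreForm G.E₂ G.X₂ k :=
  pullback (E := G.E₂) (E' := E₁) G.pr₂ α - pullback (E := G.E₂) (E' := E₁) G.mul α +
    pullback (E := G.E₂) (E' := E₁) G.pr₁ α

/-- `∂ : Ω^k(X₂) → Ω^k(X₃)`, `(∂β)(x, y, z) = β(y, z) - β(xy, z) + β(x, yz) - β(x, y)`. -/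
noncomputable def bdry₂ {k : ℕ} (β : PreForm G.E₂ G.X₂ k) : PreForm G.E₃ G.X₃ k :=
  pullback (E := G.E₃) (E' := G.E₂) G.pr₂₃ β - pullback (E := G.E₃) (E' := G.E₂) G.mul₁₂ β +
    pullback (E := G.E₃) (E' := G.E₂) G.mul₂₃ β - pullback (E := G.E₃) (E' := G.E₂) G.pr₁₂ β

/-- `η + w` with `η ∈ Ω¹(X₂)` and `w ∈ Ω²(X₁)` is a cocycle of the total complex of the de Rham
double complex `Ω^•(X_•)`, whose differential on `Ω^k(X_p)` is `(-1)^p d + ∂`. -/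
def IsDeRhamCocycle (η : DiffForm G.E₂ G.X₂ 1) (w : DiffForm E₁ X₁ 2) : Prop :=
  G.bdry₂ η.toFun = 0 ∧ extD η.toFun + G.bdry₁ w.toFun = 0 ∧ extD w.toFun = 0

/-- `η + w` is of integer class: its class lies in the image of
`H³(X_•, ℤ) → H³(X_•, ℝ) ≅ H³_DR(X_•)`. Here `H^•(X_•, A)` is the cohomology of the total complex
of the double complex `C^q(X_p; A)` of smooth singular cochains, with differential
`D = (-1)^p δ + ∂` on `C^q(X_p)`, where `δ` is the singular coboundary and `∂` the alternating sum
of pull-backs along the face maps, and a de Rham cocycle is mapped to `H³(X_•, ℝ)` by integration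
over simplices. The condition is that, for some real cochains `a`, `h`, `f` of total degree two, all
components of `∫ (η + w) - D (a + h + f)`, in `C³(X₀)`, `C²(X₁)`, `C¹(X₂)` and `C⁰(X₃)`, are
integer-valued (they then form an integral cocycle). -/
def IsIntegralClass (η : DiffForm G.E₂ G.X₂ 1) (w : DiffForm E₁ X₁ 2) : Prop :=
  ∃ (a : Cochain E₀ X₀ 2) (h : Cochain E₁ X₁ 1) (f : Cochain G.E₂ G.X₂ 0),
    Cochain.IsIntegerValued (fun σ => - a.coboundary σ) ∧
    Cochain.IsIntegerValued (fun σ => SmoothSimplex.integral w.toFun σ -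
      (- h.coboundary σ + (a.pullback t.toMap σ - a.pullback s.toMap σ))) ∧
    Cochain.IsIntegerValued (fun σ => SmoothSimplex.integral η.toFun σ -
      (f.coboundary σ + (h.pullback G.pr₂ σ - h.pullback G.mul σ + h.pullback G.pr₁ σ))) ∧
    Cochain.IsIntegerValued (fun σ =>
      - (f.pullback G.pr₂₃ σ - f.pullback G.mul₁₂ σ + f.pullback G.mul₂₃ σ - f.pullback G.pr₁₂ σ))

end LieGroupoid

end Groupoids

section Bundles

/-- (Left) principal `S¹`-bundles `π : R → X`. -/
structure PrincipalCircleBundle (ER E R X : Type*)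
    [NormedAddCommGroup ER] [NormedSpace ℝ ER] [NormedAddCommGroup E] [NormedSpace ℝ E]
    [TopologicalSpace R] [ChartedSpace ER R] [TopologicalSpace X] [ChartedSpace E X]
    [MulAction Circle R] where
  proj : SurjSubmersion ER E R X
  smooth_smul : ContMDiffSMul (𝓡 1) 𝓘(ℝ, ER) ∞ Circle R
  proj_smul : ∀ (z : Circle) (r : R), proj.toMap (z • r) = proj.toMap r
  locally_trivial : ∀ x : X, ∃ e : Bundle.Trivialization Circle proj.toMap, x ∈ e.baseSet ∧
    ContMDiffOn 𝓘(ℝ, ER) (𝓘(ℝ, E).prod (𝓡 1)) ∞ e e.source ∧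
    ContMDiffOn (𝓘(ℝ, E).prod (𝓡 1)) 𝓘(ℝ, ER) ∞ e.toOpenPartialHomeomorph.symm e.target ∧
    ∀ (z : Circle), ∀ r ∈ e.source, e (z • r) = ((e r).1, z * (e r).2)

/-- The Euler vector field `ξ` generating the action of `S¹ = ℝ/ℤ`. -/
noncomputable def eulerField {ER R : Type*} [NormedAddCommGroup ER] [NormedSpace ℝ ER]
    [TopologicalSpace R] [ChartedSpace ER R] [MulAction Circle R] (r : R) : ER :=
  tangentAt (E := ℝ) (E' := ER) (fun τ : ℝ => Circle.exp (2 * Real.pi * τ) • r) 0 1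

/-- Connection one-forms on a principal `S¹`-bundle with total space `R`: invariant one-forms that
take the value one on the Euler vector field. -/
def IsConnectionForm {ER R : Type*} [NormedAddCommGroup ER] [NormedSpace ℝ ER]
    [TopologicalSpace R] [ChartedSpace ER R] [MulAction Circle R] (θ : PreForm ER R 1) : Prop :=
  (∀ r, θ r ![eulerField r] = 1) ∧
  ∀ z : Circle, pullback (E := ER) (E' := ER) (fun r : R => z • r) θ = θ

/-- Triviality of the holonomy of a connection form `A` on the total space of `p : P → B`: a
horizontal curve whose end points lie over the same point is closed. -/
def HolonomyFree {EP P B : Type*} [NormedAddCommGroup EP] [NormedSpace ℝ EP]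
    [TopologicalSpace P] [ChartedSpace EP P] (p : P → B) (A : PreForm EP P 1) : Prop :=
  ∀ c : ℝ → P, ContMDiff 𝓘(ℝ, ℝ) 𝓘(ℝ, EP) ∞ c →
    (∀ τ ∈ Icc (0 : ℝ) 1, A (c τ) ![tangentAt (E := ℝ) (E' := EP) c τ 1] = 0) →
    p (c 0) = p (c 1) → c 0 = c 1

end Bundles

section Extensions

variable {E₀ E₁ ER X₀ X₁ R₁ : Type*}
  [NormedAddCommGroup E₀] [NormedSpace ℝ E₀] [FiniteDimensional ℝ E₀]
  [NormedAddCommGroup E₁] [NormedSpace ℝ E₁] [FiniteDimensional ℝ E₁]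
  [NormedAddCommGroup ER] [NormedSpace ℝ ER] [FiniteDimensional ℝ ER]
  [TopologicalSpace X₀] [ChartedSpace E₀ X₀] [IsManifold 𝓘(ℝ, E₀) ∞ X₀]
  [TopologicalSpace X₁] [ChartedSpace E₁ X₁] [IsManifold 𝓘(ℝ, E₁) ∞ X₁]
  [TopologicalSpace R₁] [ChartedSpace ER R₁] [IsManifold 𝓘(ℝ, ER) ∞ R₁] [MulAction Circle R₁]
  {s t : SurjSubmersion E₁ E₀ X₁ X₀}

/-- Structures of an `S¹`-central extension of `X₁ ⇉ X₀` on a principal `S¹`-bundle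
`π : R₁ → X₁`: Lie groupoid structures `R₁ ⇉ X₀` (whose source and target are `s ∘ π` and `t ∘ π`)
such that `π` is a morphism of groupoids over the identity of `X₀` and
`(a • x)(b • y) = ab • (xy)`. -/
@[ext]
structure CentralExtension (G : LieGroupoid s t) (P : PrincipalCircleBundle ER E₁ R₁ X₁)
    extends LieGroupoid (s.comp P.proj) (t.comp P.proj) where
  proj_one : ∀ u, P.proj.toMap (one u) = G.one u
  proj_mul : ∀ p, P.proj.toMap (mul p) =
    G.mul ⟨P.proj.toMap p.left, P.proj.toMap p.right, p.condition⟩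
  smul_mul_smul : ∀ (a b : Circle) (p : FibProd (t.comp P.proj).toMap (s.comp P.proj))
    (h : (t.comp P.proj).toMap (a • p.left) = (s.comp P.proj).toMap (b • p.right)),
    mul ⟨a • p.left, b • p.right, h⟩ = (a * b) • mul p

/-- The map `R₂ → X₂` induced by `π`. -/
noncomputable def CentralExtension.proj₂ {G : LieGroupoid s t}
    {P : PrincipalCircleBundle ER E₁ R₁ X₁} (R : CentralExtension G P) :
    SmoothMap R.toLieGroupoid.E₂ G.E₂ R.toLieGroupoid.X₂ G.X₂ :=
  FibProd.lift (P.proj.toMap.comp R.toLieGroupoid.pr₁) (P.proj.toMap.comp R.toLieGroupoid.pr₂)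
    (fun p => p.condition)

/-- The pseudo-connection `θ` (with vanishing two-form on `X₀`) on the central extension `R` has
pseudo-curvature `η + w`, i.e. `δθ = π^*(η + w)`, that is `∂θ = π^*η` and `dθ = -π^*w`. -/
def CentralExtension.HasPseudoCurvature {G : LieGroupoid s t}
    {P : PrincipalCircleBundle ER E₁ R₁ X₁} (R : CentralExtension G P) (θ : DiffForm ER R₁ 1)
    (η : DiffForm G.E₂ G.X₂ 1) (w : DiffForm E₁ X₁ 2) : Prop :=
  R.toLieGroupoid.bdry₁ θ.toFun =
    pullback (E := R.toLieGroupoid.E₂) (E' := G.E₂) R.proj₂ η.toFun ∧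
  extD θ.toFun = - pullback (E := ER) (E' := E₁) P.proj.toMap w.toFun

/-- The bundle `ε^* R₁ → X₀`, restriction of `R₁` to the units; its points are the pairs `(u, r)`
with `ε u = π r`. -/
abbrev unitBundle (G : LieGroupoid s t) (P : PrincipalCircleBundle ER E₁ R₁ X₁) :=
  FibProd G.one P.proj

/-- The connection form `ε^* θ - π^* ε₂^* η` on `ε^* R₁`. -/
noncomputable def unitConnection (G : LieGroupoid s t) (P : PrincipalCircleBundle ER E₁ R₁ X₁)
    (θ : DiffForm ER R₁ 1) (η : DiffForm G.E₂ G.X₂ 1) :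
    PreForm (FibModel E₀ ER E₁) (unitBundle G P) 1 :=
  pullback (E := FibModel E₀ ER E₁) (E' := ER) (FibProd.snd G.one P.proj) θ.toFun -
    pullback (E := FibModel E₀ ER E₁) (E' := E₀) (FibProd.fst G.one P.proj)
      (pullback (E := E₀) (E' := G.E₂) G.one₂ η.toFun)

/-- Global sections of `ε^* R₁ → X₀` that are horizontal for `ε^* θ - π^* ε₂^* η`. -/
def IsHorizontalUnitSection (G : LieGroupoid s t) (P : PrincipalCircleBundle ER E₁ R₁ X₁)
    (θ : DiffForm ER R₁ 1) (η : DiffForm G.E₂ G.X₂ 1)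
    (σ : SmoothMap E₀ (FibModel E₀ ER E₁) X₀ (unitBundle G P)) : Prop :=
  (∀ u, (σ u).left = u) ∧
  pullback (E := E₀) (E' := FibModel E₀ ER E₁) σ (unitConnection G P θ η) = 0

end Extensions

/-! A multiplication on `R₁` compatible with `π` and `θ` is a map m from pairs in `R₁` over
composable pairs to `R₁` that covers f(x, y) = π(x)π(y) and satisfies m^*θ = α, where α = pr₁^*θ +
pr₂^*θ - π^*η (`mulForm`). It is thus a horizontal section of the pulled-back circle bundle f^*R₁
for the connection f^*θ - α. The equations dη + ∂ω = 0 and dθ = -π^*ω give dα = -f^*ω, so this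
connection is flat (`isFlatPair_mul`). The proof is therefore a study of horizontal lifts for flat
circle bundles: they exist locally by the Poincaré lemma, they exist along maps from simply
connected spaces (`IsFlatPair.exists_lift_along`), and two of them that agree at a point agree on
its path component (`IsHorizontalLift.eq_of_joined`).

Existence of m. Restricting ∂η = 0 to triples (x, 1, 1) and (1, 1, x) shows that α restricts to θ
along r ↦ (r, 1) and r ↦ (1, r) when the units are a horizontal section; so r itself is a horizontal
lift along both maps. The product xy is defined by parallel transport from (x, 1) to (x, y) with y
moving in its s-fibre, which is connected. The transport does not depend on the path: over the
square of pairs (α(τ), γ(τ')), with α running from a unit to x in a t-fibre and γ from a unit to y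
in an s-fibre, there is a lift that equals γ on one edge and α on another, so the value at the far
corner can also be computed by moving the left component, without reference to γ
(`ExtensionData.transport_eq`). Smoothness spreads from the unit pairs along the slices with fixed
left component (`ExtensionData.isGood`).

The axioms are rigidity statements. Equivariance, associativity and uniqueness each compare two
horizontal lifts of the same data that agree at unit pairs or triples, and every point is joined to
one of these. For associativity the equality of the two forms is ∂η = 0. The horizontal unit section
exists because a flat bundle without holonomy is trivialized by transport from base points
(`IsFlatPair.exists_lift_of_holonomyFree`).

For the integer class, choose a point in every fibre of `R₁`. Logarithms of parallel transport form
a cochain in C¹(X₁), and the logarithm of the circle-valued two-cocycle of m, with a sign, is a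
cochain in C⁰(X₂). That the resulting components of ∫(η + ω) minus a coboundary are integers is,
respectively, the holonomy formula on triangles, the formula for m^*θ on edges, and associativity on
points (`ExtensionData.isIntegralClass`). -/

/-! ### Pull-backs of forms and naturality of the exterior derivative in charts. -/

section FormCalculus

variable {E E' E'' M M' M'' : Type*}
  [NormedAddCommGroup E] [NormedSpace ℝ E] [NormedAddCommGroup E'] [NormedSpace ℝ E']
  [NormedAddCommGroup E''] [NormedSpace ℝ E'']
  [TopologicalSpace M] [ChartedSpace E M] [TopologicalSpace M'] [ChartedSpace E' M']
  [TopologicalSpace M''] [ChartedSpace E'' M'']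

theorem tangentAt_comp {g : M' → M''} {f : M → M'} {x : M}
    (hg : MDifferentiableAt 𝓘(ℝ, E') 𝓘(ℝ, E'') g (f x))
    (hf : MDifferentiableAt 𝓘(ℝ, E) 𝓘(ℝ, E') f x) :
    tangentAt (E := E) (E' := E'') (g ∘ f) x =
      (tangentAt (E := E') (E' := E'') g (f x)).comp (tangentAt (E := E) (E' := E') f x) :=
  mfderiv_comp x hg hf

theorem tangentAt_eq_fderiv (f : E → E') (x : E) :
    tangentAt (E := E) (E' := E') f x = fderiv ℝ f x := mfderiv_eq_fderiv

theorem pullback_comp {k : ℕ} {g : M' → M''} {f : M → M'} {x : M} (α : PreForm E'' M'' k)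
    (hg : MDifferentiableAt 𝓘(ℝ, E') 𝓘(ℝ, E'') g (f x))
    (hf : MDifferentiableAt 𝓘(ℝ, E) 𝓘(ℝ, E') f x) :
    pullback (E := E) (E' := E'') (g ∘ f) α x =
      pullback (E := E) (E' := E') f (pullback (E := E') (E' := E'') g α) x := by
  simp only [pullback, tangentAt_comp hg hf]
  rfl

theorem pullback_congr {k : ℕ} {f g : M → M'} {x : M} (α : PreForm E' M' k) (h : f =ᶠ[𝓝 x] g) :
    pullback (E := E) (E' := E') f α x = pullback (E := E) (E' := E') g α x := by
  simp only [pullback, tangentAt, h.mfderiv_eq, h.eq_of_nhds]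

theorem pullback_congr_form {k : ℕ} {f : M → M'} {x : M} {α β : PreForm E' M' k}
    (h : α (f x) = β (f x)) :
    pullback (E := E) (E' := E') f α x = pullback (E := E) (E' := E') f β x := by
  simp only [pullback, h]

theorem pullback_id {k : ℕ} (α : PreForm E M k) (x : M) :
    pullback (E := E) (E' := E) id α x = α x := by
  ext v
  simp only [pullback, tangentAt, mfderiv_id]
  rfl

theorem pullback_neg {k : ℕ} (f : M → M') (α : PreForm E' M' k) (x : M) :
    pullback (E := E) (E' := E') f (-α) x = - pullback (E := E) (E' := E') f α x := rfl

theorem mdifferentiableAt_chart [IsManifold 𝓘(ℝ, E) ∞ M] {m x : M}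
    (hx : x ∈ (chartAt E m).source) :
    MDifferentiableAt 𝓘(ℝ, E) 𝓘(ℝ, E) (chartAt E m) x :=
  ((contMDiffOn_chart (I := 𝓘(ℝ, E)) (n := ∞) (x := m)).contMDiffAt
    ((chartAt E m).open_source.mem_nhds hx)).mdifferentiableAt (by simp)

theorem contMDiffAt_chart_symm [IsManifold 𝓘(ℝ, E) ∞ M] {m : M} {v : E}
    (hv : v ∈ (chartAt E m).target) :
    ContMDiffAt 𝓘(ℝ, E) 𝓘(ℝ, E) ∞ (chartAt E m).symm v :=
  (contMDiffOn_chart_symm (I := 𝓘(ℝ, E)) (n := ∞) (x := m)).contMDiffAt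
    ((chartAt E m).open_target.mem_nhds hv)

theorem mdifferentiableAt_chart_symm [IsManifold 𝓘(ℝ, E) ∞ M] {m : M} {v : E}
    (hv : v ∈ (chartAt E m).target) :
    MDifferentiableAt 𝓘(ℝ, E) 𝓘(ℝ, E) (chartAt E m).symm v :=
  (contMDiffAt_chart_symm hv).mdifferentiableAt (by simp)

/-- A form is the pull-back of its expression in a chart. -/
theorem pullback_chart_chartForm [IsManifold 𝓘(ℝ, E) ∞ M] {k : ℕ} (α : PreForm E M k) {m x : M}
    (hx : x ∈ (chartAt E m).source) :
    pullback (E := E) (E' := E) (chartAt E m) (chartForm α m) x = α x := by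
  have hv := (chartAt E m).map_source hx
  rw [chartForm, ← pullback_comp α (mdifferentiableAt_chart_symm hv) (mdifferentiableAt_chart hx)]
  rw [pullback_congr (g := id) α, pullback_id]
  filter_upwards [(chartAt E m).open_source.mem_nhds hx] with y hy
  exact (chartAt E m).left_inv hy

variable [IsManifold 𝓘(ℝ, E') ∞ M']

/-- Local expression of the pull-back of a form to a vector space. -/
theorem pullback_eventuallyEq_chart {k : ℕ} {g : E → M'} {v : E}
    (hg : ContMDiffAt 𝓘(ℝ, E) 𝓘(ℝ, E') ∞ g v) (β : PreForm E' M' k) :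
    ContDiffAt ℝ ∞ (chartAt E' (g v) ∘ g) v ∧
    pullback (E := E) (E' := E') g β =ᶠ[𝓝 v]
      fun x => (chartForm β (g v) (chartAt E' (g v) (g x))).compContinuousLinearMap
        (fderiv ℝ (chartAt E' (g v) ∘ g) x) := by
  set χ := chartAt E' (g v)
  have hsrc : ∀ᶠ x in 𝓝 v, g x ∈ χ.source :=
    hg.continuousAt.preimage_mem_nhds (χ.open_source.mem_nhds (mem_chart_source E' (g v)))
  have hsm : ∀ᶠ x in 𝓝 v, ContMDiffAt 𝓘(ℝ, E) 𝓘(ℝ, E') 1 g x :=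
    (contMDiffAt_iff_contMDiffAt_nhds (by simp)).1 (hg.of_le (m := 1) (by simp))
  refine ⟨?_, ?_⟩
  · rw [← contMDiffAt_iff_contDiffAt]
    exact ((contMDiffOn_chart (I := 𝓘(ℝ, E')) (n := ∞) (x := g v)).contMDiffAt
      (χ.open_source.mem_nhds (mem_chart_source E' (g v)))).comp v hg
  · filter_upwards [hsrc, hsm] with x hx hx'
    have h1 := pullback_comp (x := x) (f := g) (g := χ) (chartForm β (g v))
      (mdifferentiableAt_chart hx) (hx'.mdifferentiableAt (by simp))
    rw [← pullback_congr_form (f := g) (x := x) (pullback_chart_chartForm β hx), ← h1]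
    simp only [pullback, tangentAt_eq_fderiv]
    rfl

/-- The exterior derivative commutes with pull-backs along maps from a vector space. -/
theorem extDeriv_pullback_eq {k : ℕ} {g : E → M'} {v : E}
    (hg : ContMDiffAt 𝓘(ℝ, E) 𝓘(ℝ, E') ∞ g v) (β : DiffForm E' M' k) :
    extDeriv (pullback (E := E) (E' := E') g β.toFun) v =
      pullback (E := E) (E' := E') g (extD β.toFun) v := by
  obtain ⟨h1, h2⟩ := pullback_eventuallyEq_chart hg β.toFun
  have hd : DifferentiableAt ℝ (chartForm β.toFun (g v)) (chartAt E' (g v) (g v)) :=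
    ((β.smooth (g v)).contDiffAt ((chartAt E' (g v)).open_target.mem_nhds
      ((chartAt E' (g v)).map_source (mem_chart_source E' (g v))))).differentiableAt (by simp)
  -- In the chart at `g v` only naturality between vector spaces is needed.
  have h3 := extDeriv_pullback (f := chartAt E' (g v) ∘ g) (x := v) hd h1
    (by rw [minSmoothness_of_isRCLikeNormedField]; exact ENat.LEInfty.out)
  rw [h2.extDeriv_eq]
  refine h3.trans ?_
  have h4 := tangentAt_comp (x := v) (f := g) (g := chartAt E' (g v))
    (mdifferentiableAt_chart (mem_chart_source E' (g v))) (hg.mdifferentiableAt (by simp))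
  simp only [pullback, extD]
  rw [← tangentAt_eq_fderiv, h4]
  rfl

theorem differentiableAt_pullback {k : ℕ} {g : E → M'} {v : E}
    (hg : ContMDiffAt 𝓘(ℝ, E) 𝓘(ℝ, E') ∞ g v) (β : DiffForm E' M' k) :
    DifferentiableAt ℝ (pullback (E := E) (E' := E') g β.toFun) v := by
  obtain ⟨h1, h2⟩ := pullback_eventuallyEq_chart hg β.toFun
  refine DifferentiableAt.congr_of_eventuallyEq ?_ h2
  have hd : DifferentiableAt ℝ (chartForm β.toFun (g v)) (chartAt E' (g v) (g v)) :=
    ((β.smooth (g v)).contDiffAt ((chartAt E' (g v)).open_target.mem_nhds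
      ((chartAt E' (g v)).map_source (mem_chart_source E' (g v))))).differentiableAt (by simp)
  refine DifferentiableAt.continuousAlternatingMapCompContinuousLinearMap
    (hd.comp v (h1.differentiableAt (by simp))) ?_
  exact (h1.fderiv_right (m := ∞) (by simp)).differentiableAt (by simp)

/-- The identification of one-forms on a vector space with linear forms. -/
noncomputable def oneFormEquiv (E : Type*) [NormedAddCommGroup E] [NormedSpace ℝ E] :
    (E [⋀^Fin 1]→L[ℝ] ℝ) ≃L[ℝ] (E →L[ℝ] ℝ) :=
  (ContinuousAlternatingMap.ofSubsingletonLIE (𝕜 := ℝ) (E := E) (F := ℝ) (0 : Fin 1)).symm.toContinuousLinearEquiv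

theorem oneFormEquiv_apply (A : E [⋀^Fin 1]→L[ℝ] ℝ) (x : E) : oneFormEquiv E A x = A ![x] := by
  have h : A = ContinuousAlternatingMap.ofSubsingletonLIE (𝕜 := ℝ) (0 : Fin 1) (oneFormEquiv E A) :=
    ((ContinuousAlternatingMap.ofSubsingletonLIE (𝕜 := ℝ) (E := E) (F := ℝ)
      (0 : Fin 1)).apply_symm_apply A).symm
  conv_rhs => rw [h]
  rfl

theorem contDiffAt_pullback_one {g : E → M'} {v : E}
    (hg : ContMDiffAt 𝓘(ℝ, E) 𝓘(ℝ, E') ∞ g v) (β : DiffForm E' M' 1) :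
    ContDiffAt ℝ ∞ (pullback (E := E) (E' := E') g β.toFun) v := by
  obtain ⟨h1, h2⟩ := pullback_eventuallyEq_chart hg β.toFun
  refine ContDiffAt.congr_of_eventuallyEq ?_ h2
  have hd : ContDiffAt ℝ ∞ (chartForm β.toFun (g v)) (chartAt E' (g v) (g v)) :=
    ((β.smooth (g v)).contDiffAt ((chartAt E' (g v)).open_target.mem_nhds
      ((chartAt E' (g v)).map_source (mem_chart_source E' (g v)))))
  -- Read as linear forms, the pull-back is a composition of continuous linear maps depending
  -- smoothly on the point.
  rw [← (oneFormEquiv E).comp_contDiffAt_iff]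
  have h3 : ContDiffAt ℝ ∞ (fun x => (oneFormEquiv E' (chartForm β.toFun (g v)
      (chartAt E' (g v) (g x)))).comp (fderiv ℝ (chartAt E' (g v) ∘ g) x)) v := by
    refine ContDiffAt.clm_comp ?_ (h1.fderiv_right (m := ∞) (by simp))
    exact (oneFormEquiv E').contDiff.contDiffAt.comp v (hd.comp v h1)
  refine h3.congr_of_eventuallyEq (.of_forall fun x => ?_)
  ext y
  simp only [Function.comp_apply, ContinuousLinearMap.comp_apply, oneFormEquiv_apply,
    ContinuousAlternatingMap.compContinuousLinearMap_apply]
  congr 1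
  ext i
  fin_cases i
  rfl
end FormCalculus

/-! ### The Poincaré lemma for one-forms on convex sets. -/

section Primitives

variable {E : Type*} [NormedAddCommGroup E] [NormedSpace ℝ E]

theorem extDeriv_one_apply (A : E → E [⋀^Fin 1]→L[ℝ] ℝ) (a x y : E) :
    extDeriv A a ![x, y] = fderiv ℝ A a x ![y] - fderiv ℝ A a y ![x] := by
  have e2 : Fin.removeNth (1 : Fin 2) ![x, y] = ![x] := by ext i; fin_cases i; rfl
  simp [extDeriv, ContinuousAlternatingMap.alternatizeUncurryFin_apply, Fin.sum_univ_two, e2,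
    sub_eq_add_neg]

/-- A smooth closed one-form on an open convex set has a smooth primitive. -/
theorem exists_primitive_of_extDeriv_eq_zero {s : Set E} (hs : Convex ℝ s) (hso : IsOpen s)
    {A : E → E [⋀^Fin 1]→L[ℝ] ℝ} (hA : ContDiffOn ℝ ∞ A s) (hd : ∀ v ∈ s, extDeriv A v = 0) :
    ∃ H : E → ℝ, ContDiffOn ℝ ∞ H s ∧ ∀ v ∈ s, HasFDerivAt H (oneFormEquiv E (A v)) v := by
  have hB : ContDiffOn ℝ ∞ (fun v => oneFormEquiv E (A v)) s :=
    (oneFormEquiv E).contDiff.comp_contDiffOn hA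
  -- Closedness of `A` is the symmetry of the derivative of the corresponding linear form.
  obtain ⟨H, hH⟩ := hs.exists_forall_hasFDerivAt_of_fderiv_symmetric hso
    (hB.differentiableOn (by simp)) (by
      intro a ha x y
      have hAd : DifferentiableAt ℝ A a := (hA.contDiffAt (hso.mem_nhds ha)).differentiableAt
        (by simp)
      have h1 : fderiv ℝ (fun v => oneFormEquiv E (A v)) a =
          (oneFormEquiv E : _ →L[ℝ] _).comp (fderiv ℝ A a) :=
        ((oneFormEquiv E).hasFDerivAt.comp a hAd.hasFDerivAt).fderiv
      have h2 := congrArg (fun B => B ![x, y]) (hd a ha)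
      simp only [extDeriv_one_apply] at h2
      rw [h1]
      simp only [ContinuousLinearMap.comp_apply, ContinuousLinearEquiv.coe_coe, oneFormEquiv_apply]
      exact sub_eq_zero.1 h2)
  refine ⟨H, ?_, hH⟩
  -- The derivative of `H` is the given smooth form, so `H` inherits smoothness of every order.
  rw [show (∞ : WithTop ℕ∞) = ∞ + 1 from rfl, contDiffOn_succ_iff_fderiv_of_isOpen hso]
  exact ⟨fun v hv => (hH v hv).differentiableAt.differentiableWithinAt, by simp,
    hB.congr fun v hv => (hH v hv).fderiv⟩

end Primitives

/-! ### Quotients of points in a fibre, local sections and local logarithms. -/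

namespace PrincipalCircleBundle

variable {ER E R X : Type*}
  [NormedAddCommGroup ER] [NormedSpace ℝ ER] [NormedAddCommGroup E] [NormedSpace ℝ E]
  [TopologicalSpace R] [ChartedSpace ER R] [TopologicalSpace X] [ChartedSpace E X]
  [MulAction Circle R]

/-- A trivialization turns the action into multiplication in the circle, which is free. -/
theorem smul_right_injective (P : PrincipalCircleBundle ER E R X) (r : R) : Function.Injective (fun z : Circle => z • r) := by
  intro z z' h
  obtain ⟨e, he, -, -, hz⟩ := P.locally_trivial (P.proj.toMap r)
  have hr : r ∈ e.source := e.mem_source.2 he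
  have h' := congrArg (fun q => (e q).2) h
  simp only [hz _ r hr] at h'
  exact mul_right_cancel h'

variable (P : PrincipalCircleBundle ER E R X)

theorem exists_smul_eq {r r' : R} (h : P.proj.toMap r = P.proj.toMap r') :
    ∃ z : Circle, r' = z • r := by
  obtain ⟨e, he, -, -, hz⟩ := P.locally_trivial (P.proj.toMap r)
  have hr : r ∈ e.source := e.mem_source.2 he
  have hr' : r' ∈ e.source := e.mem_source.2 (h ▸ he)
  refine ⟨(e r').2 / (e r).2, ?_⟩
  have hs : ((e r').2 / (e r).2) • r ∈ e.source := e.mem_source.2 (by rwa [P.proj_smul])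
  apply e.toOpenPartialHomeomorph.injOn hr' hs
  change e r' = e _
  rw [hz _ r hr]
  refine Prod.ext ?_ (by simp)
  rw [e.coe_fst hr', e.coe_fst hr, h]

open Classical in
/-- The quotient `r' / r` of two points of the same fibre. -/
noncomputable def div (r' r : R) : Circle :=
  if h : P.proj.toMap r = P.proj.toMap r' then (P.exists_smul_eq h).choose else 1

theorem div_smul {r r' : R} (h : P.proj.toMap r' = P.proj.toMap r) : P.div r' r • r = r' := by
  rw [div, dif_pos h.symm]
  exact (P.exists_smul_eq h.symm).choose_spec.symm

theorem div_eq {r r' : R} {z : Circle} (h : r' = z • r) : P.div r' r = z := by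
  apply P.smul_right_injective r
  have : P.proj.toMap r' = P.proj.toMap r := by rw [h, P.proj_smul]
  exact (P.div_smul this).trans h

theorem div_self (r : R) : P.div r r = 1 := P.div_eq (one_smul _ _).symm

/-- Smooth local sections through a given point. -/
theorem exists_local_section (r : R) :
    ∃ (U : Set X) (ρ : X → R), IsOpen U ∧ P.proj.toMap r ∈ U ∧
      ContMDiffOn 𝓘(ℝ, E) 𝓘(ℝ, ER) ∞ ρ U ∧ (∀ x ∈ U, P.proj.toMap (ρ x) = x) ∧
      ρ (P.proj.toMap r) = r := by
  obtain ⟨e, he, -, hs, -⟩ := P.locally_trivial (P.proj.toMap r)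
  have hr : r ∈ e.source := e.mem_source.2 he
  refine ⟨e.baseSet, fun x => e.toOpenPartialHomeomorph.symm (x, (e r).2), e.open_baseSet, he,
    ?_, ?_, ?_⟩
  · refine hs.comp (contMDiffOn_id.prodMk contMDiffOn_const) ?_
    intro x hx
    exact e.mem_target.2 hx
  · intro x hx
    exact e.proj_symm_apply (e.mem_target.2 hx)
  · have : (P.proj.toMap r, (e r).2) = e r := Prod.ext (e.coe_fst hr).symm rfl
    simp only [this]
    exact e.left_inv hr

variable {E' M : Type*} [NormedAddCommGroup E'] [NormedSpace ℝ E'] [TopologicalSpace M]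
  [ChartedSpace E' M]

/-- In a trivialization the quotient is the quotient of the circle coordinates. -/
theorem contMDiffAt_div {φ ψ : M → R} {m : M} (hφ : ContMDiffAt 𝓘(ℝ, E') 𝓘(ℝ, ER) ∞ φ m)
    (hψ : ContMDiffAt 𝓘(ℝ, E') 𝓘(ℝ, ER) ∞ ψ m)
    (h : ∀ᶠ x in 𝓝 m, P.proj.toMap (φ x) = P.proj.toMap (ψ x)) :
    ContMDiffAt 𝓘(ℝ, E') (𝓡 1) ∞ (fun x => P.div (φ x) (ψ x)) m := by
  obtain ⟨e, he, hs, -, hz⟩ := P.locally_trivial (P.proj.toMap (φ m))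
  have key : ∀ f : M → R, ContMDiffAt 𝓘(ℝ, E') 𝓘(ℝ, ER) ∞ f m →
      P.proj.toMap (f m) = P.proj.toMap (φ m) →
      ContMDiffAt 𝓘(ℝ, E') (𝓡 1) ∞ (fun x => (e (f x)).2) m := by
    intro f hf hfm
    have h1 : ContMDiffAt 𝓘(ℝ, ER) (𝓘(ℝ, E).prod (𝓡 1)) ∞ e (f m) :=
      hs.contMDiffAt (e.open_source.mem_nhds (e.mem_source.2 (hfm ▸ he)))
    exact (contMDiffAt_snd (I := 𝓘(ℝ, E)) (J := 𝓡 1) (p := e (f m))).comp m (h1.comp m hf)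
  have h1 := key φ hφ rfl
  have h2 := key ψ hψ h.self_of_nhds.symm
  refine (h1.mul h2.inv).congr_of_eventuallyEq ?_
  have hsrc : ∀ᶠ x in 𝓝 m, φ x ∈ e.source :=
    hφ.continuousAt.preimage_mem_nhds (e.open_source.mem_nhds (e.mem_source.2 he))
  filter_upwards [h, hsrc] with x hx hxs
  have hxs' : ψ x ∈ e.source := e.mem_source.2 (hx ▸ e.mem_source.1 hxs)
  have := hz (P.div (φ x) (ψ x)) _ hxs'
  rw [P.div_smul hx] at this
  simp [this]

end PrincipalCircleBundle

section RealLifts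

variable {E' M : Type*} [NormedAddCommGroup E'] [NormedSpace ℝ E'] [TopologicalSpace M]
  [ChartedSpace E' M]

/-- Smooth circle-valued functions have local logarithms. -/
theorem exists_local_log {z : M → Circle} {m : M} (hz : ContMDiffAt 𝓘(ℝ, E') (𝓡 1) ∞ z m) :
    ∃ h : M → ℝ, ContMDiffAt 𝓘(ℝ, E') 𝓘(ℝ, ℝ) ∞ h m ∧
      ∀ x, z x = Circle.exp (2 * Real.pi * h x) := by
  have := finrank_real_complex_fact'
  -- Division by `z m` moves the value at `m` to 1, where the principal logarithm is smooth; the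
  -- argument of `z m` is added back as a constant.
  let q : M → Circle := fun x => z x * (z m)⁻¹
  have hq : ContMDiffAt 𝓘(ℝ, E') (𝓡 1) ∞ q m := hz.mul contMDiffAt_const
  have hc : ContMDiffAt 𝓘(ℝ, E') 𝓘(ℝ, ℂ) ∞ (fun x => (q x : ℂ)) m :=
    (contMDiff_coe_sphere (E := ℂ) (n := 1) (m := ∞)).contMDiffAt.comp m hq
  have hl : ContMDiffAt 𝓘(ℝ, ℂ) 𝓘(ℝ, ℝ) ∞ (fun w : ℂ => (Complex.log w).im) (q m : ℂ) := by
    rw [contMDiffAt_iff_contDiffAt]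
    have h1 : ContDiffAt ℝ ∞ Complex.log (q m : ℂ) := by
      have : ContDiffAt ℂ ∞ Complex.log (q m : ℂ) := Complex.contDiffAt_log (by simp [q])
      exact this.restrict_scalars ℝ
    exact Complex.imCLM.contDiff.contDiffAt.comp _ h1
  refine ⟨fun x => (Complex.log (q x : ℂ)).im / (2 * Real.pi) + (Complex.arg (z m : ℂ)) /
    (2 * Real.pi), ?_, ?_⟩
  · have h2 := hl.comp m hc
    have h3 : ContMDiffAt 𝓘(ℝ, ℝ) 𝓘(ℝ, ℝ) ∞ (fun y : ℝ => y / (2 * Real.pi) +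
        (Complex.arg (z m : ℂ)) / (2 * Real.pi)) ((Complex.log (q m : ℂ)).im) := by
      rw [contMDiffAt_iff_contDiffAt]; fun_prop
    exact h3.comp m h2
  · intro x
    have hpi : (2 * Real.pi) ≠ 0 := by positivity
    rw [mul_add, mul_div_cancel₀ _ hpi, mul_div_cancel₀ _ hpi, Circle.exp_add, Complex.log_im,
      Circle.exp_arg, Circle.exp_arg]
    simp [q]

end RealLifts

/-! ### Gauge transformations and local horizontal lifts. -/

section HorizontalLifts

variable {ER E R X : Type*}
  [NormedAddCommGroup ER] [NormedSpace ℝ ER] [NormedAddCommGroup E] [NormedSpace ℝ E]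
  [TopologicalSpace R] [ChartedSpace ER R] [TopologicalSpace X] [ChartedSpace E X]
  [MulAction Circle R]
  {E' M : Type*} [NormedAddCommGroup E'] [NormedSpace ℝ E'] [TopologicalSpace M]
  [ChartedSpace E' M]

namespace PrincipalCircleBundle

theorem contMDiffAt_smul (P : PrincipalCircleBundle ER E R X)
    {z : M → Circle} {φ : M → R} {m : M}
    (hz : ContMDiffAt 𝓘(ℝ, E') (𝓡 1) ∞ z m) (hφ : ContMDiffAt 𝓘(ℝ, E') 𝓘(ℝ, ER) ∞ φ m) :
    ContMDiffAt 𝓘(ℝ, E') 𝓘(ℝ, ER) ∞ (fun x => z x • φ x) m :=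
  (P.smooth_smul.contMDiff_smul.contMDiffAt (x := (z m, φ m))).comp m (hz.prodMk hφ)

theorem contMDiff_exp_smul (P : PrincipalCircleBundle ER E R X) :
    ContMDiff (𝓘(ℝ, ℝ).prod 𝓘(ℝ, ER)) 𝓘(ℝ, ER) ∞
    (fun p : ℝ × R => Circle.exp (2 * Real.pi * p.1) • p.2) := by
  refine P.smooth_smul.contMDiff_smul.comp (ContMDiff.prodMk ?_ contMDiff_snd)
  refine contMDiff_circleExp.comp ?_
  have : ContMDiff 𝓘(ℝ, ℝ) 𝓘(ℝ, ℝ) ∞ (fun x : ℝ => 2 * Real.pi * x) := by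
    rw [contMDiff_iff_contDiff]; fun_prop
  exact this.comp contMDiff_fst

theorem contMDiffAt_exp_smul (P : PrincipalCircleBundle ER E R X)
    {h : M → ℝ} {φ : M → R} {m : M}
    (hh : ContMDiffAt 𝓘(ℝ, E') 𝓘(ℝ, ℝ) ∞ h m) (hφ : ContMDiffAt 𝓘(ℝ, E') 𝓘(ℝ, ER) ∞ φ m) :
    ContMDiffAt 𝓘(ℝ, E') 𝓘(ℝ, ER) ∞ (fun x => Circle.exp (2 * Real.pi * h x) • φ x) m :=
  (P.contMDiff_exp_smul.contMDiffAt (x := (h m, φ m))).comp m (hh.prodMk hφ)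

/-- Product rule for the action map `ℝ × R → R`: the real direction contributes a multiple of the
Euler field, the bundle direction the differential of a translation. -/
theorem tangentAt_exp_smul (P : PrincipalCircleBundle ER E R X)
    {h : M → ℝ} {φ : M → R} {m : M}
    (hh : MDifferentiableAt 𝓘(ℝ, E') 𝓘(ℝ, ℝ) h m)
    (hφ : MDifferentiableAt 𝓘(ℝ, E') 𝓘(ℝ, ER) φ m) (v : E') :
    tangentAt (E := E') (E' := ER) (fun x => Circle.exp (2 * Real.pi * h x) • φ x) m v =
      tangentAt (E := E') (E' := ℝ) h m v •
        eulerField (ER := ER) (Circle.exp (2 * Real.pi * h m) • φ m) +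
      tangentAt (E := ER) (E' := ER) (fun r : R => Circle.exp (2 * Real.pi * h m) • r) (φ m)
        (tangentAt (E := E') (E' := ER) φ m v) := by
  set A : ℝ × R → R := fun p => Circle.exp (2 * Real.pi * p.1) • p.2 with hA
  have hAd : ∀ p, MDifferentiableAt (𝓘(ℝ, ℝ).prod 𝓘(ℝ, ER)) 𝓘(ℝ, ER) A p := fun p =>
    P.contMDiff_exp_smul.mdifferentiableAt (by simp)
  have h1 : mfderiv 𝓘(ℝ, E') 𝓘(ℝ, ER) (A ∘ fun x => (h x, φ x)) m v =
      mfderiv (𝓘(ℝ, ℝ).prod 𝓘(ℝ, ER)) 𝓘(ℝ, ER) A (h m, φ m)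
        ((mfderiv 𝓘(ℝ, E') 𝓘(ℝ, ℝ) h m v, mfderiv 𝓘(ℝ, E') 𝓘(ℝ, ER) φ m v)) := by
    rw [mfderiv_comp m (hAd _) (hh.prodMk hφ), hh.mfderiv_prod hφ]
    rfl
  refine h1.trans ((mfderiv_prod_eq_add_apply (hAd (h m, φ m))).trans ?_)
  congr 1
  -- the derivative of the action in the direction of the circle
  have h2 : (fun τ : ℝ => A (τ, φ m)) =
      (fun τ : ℝ => Circle.exp (2 * Real.pi * τ) • (Circle.exp (2 * Real.pi * h m) • φ m)) ∘
        (fun τ : ℝ => τ - h m) := by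
    funext τ
    simp only [hA, Function.comp_apply, smul_smul, ← Circle.exp_add]
    congr 2
    ring
  have h3 : MDifferentiableAt 𝓘(ℝ, ℝ) 𝓘(ℝ, ER)
      (fun τ : ℝ => Circle.exp (2 * Real.pi * τ) • (Circle.exp (2 * Real.pi * h m) • φ m))
      (h m - h m) :=
    ((P.contMDiff_exp_smul.comp (contMDiff_id.prodMk contMDiff_const)).mdifferentiableAt
      (by simp) : _)
  have h4 : mfderiv 𝓘(ℝ, ℝ) 𝓘(ℝ, ER) (fun τ : ℝ => A (τ, φ m)) (h m) =
      (mfderiv 𝓘(ℝ, ℝ) 𝓘(ℝ, ER)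
        (fun τ : ℝ => Circle.exp (2 * Real.pi * τ) • (Circle.exp (2 * Real.pi * h m) • φ m))
        (h m - h m)).comp (mfderiv 𝓘(ℝ, ℝ) 𝓘(ℝ, ℝ) (fun τ : ℝ => τ - h m) (h m)) := by
    rw [h2]
    refine mfderiv_comp (h m) h3 ?_
    exact (by fun_prop : DifferentiableAt ℝ (fun τ : ℝ => τ - h m) (h m)).mdifferentiableAt
  have h5 : mfderiv 𝓘(ℝ, ℝ) 𝓘(ℝ, ℝ) (fun τ : ℝ => τ - h m) (h m) =
      ContinuousLinearMap.id ℝ ℝ := by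
    refine mfderiv_eq_fderiv.trans ?_
    rw [fderiv_sub_const]
    exact fderiv_id
  simp only [tangentAt, eulerField]
  rw [h4, h5]
  have h6 : ∀ (L : ℝ →L[ℝ] ER) (c : ℝ), L c = c • L 1 := fun L c => by
    rw [← map_smul, smul_eq_mul, mul_one]
  have h7 : ∀ (τ₀ : ℝ), τ₀ = 0 → ∀ c : ℝ, (mfderiv 𝓘(ℝ, ℝ) 𝓘(ℝ, ER)
        (fun τ : ℝ => Circle.exp (2 * Real.pi * τ) • (Circle.exp (2 * Real.pi * h m) • φ m))
        τ₀ : ℝ →L[ℝ] ER) c = c • (mfderiv 𝓘(ℝ, ℝ) 𝓘(ℝ, ER)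
        (fun τ : ℝ => Circle.exp (2 * Real.pi * τ) • (Circle.exp (2 * Real.pi * h m) • φ m))
        0 : ℝ →L[ℝ] ER) 1 := by
    rintro _ rfl c
    exact h6 _ c
  exact h7 _ (sub_self _) _

variable {θ : PreForm ER R 1}

theorem form_apply_add_smul (A : ER [⋀^Fin 1]→L[ℝ] ℝ) (c : ℝ) (x y : ER) :
    A ![c • x + y] = c * A ![x] + A ![y] := by
  simp only [← oneFormEquiv_apply, map_add, map_smul, smul_eq_mul]

/-- The connection form along a section changed by a gauge transformation. -/
theorem pullback_exp_smul (P : PrincipalCircleBundle ER E R X)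
    (hθ : IsConnectionForm θ) {h : M → ℝ} {φ : M → R} {m : M}
    (hh : MDifferentiableAt 𝓘(ℝ, E') 𝓘(ℝ, ℝ) h m)
    (hφ : MDifferentiableAt 𝓘(ℝ, E') 𝓘(ℝ, ER) φ m) (v : E') :
    pullback (E := E') (E' := ER) (fun x => Circle.exp (2 * Real.pi * h x) • φ x) θ m ![v] =
      tangentAt (E := E') (E' := ℝ) h m v + pullback (E := E') (E' := ER) φ θ m ![v] := by
  have e : ∀ (f : M → R), pullback (E := E') (E' := ER) f θ m ![v] =
      θ (f m) ![tangentAt (E := E') (E' := ER) f m v] := by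
    intro f
    simp only [pullback, ContinuousAlternatingMap.compContinuousLinearMap_apply]
    congr 1
    ext i; fin_cases i; rfl
  rw [e, e, P.tangentAt_exp_smul hh hφ, form_apply_add_smul, hθ.1, mul_one]
  congr 1
  have h2 := congrArg (fun B => B ![tangentAt (E := E') (E' := ER) φ m v])
    (congrFun (hθ.2 (Circle.exp (2 * Real.pi * h m))) (φ m))
  rw [← h2]
  simp only [pullback, ContinuousAlternatingMap.compContinuousLinearMap_apply]
  congr 1
  ext i; fin_cases i; rfl

/-- A constant factor is a gauge transformation with constant logarithm, whose derivative vanishes.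
-/
theorem pullback_const_smul (P : PrincipalCircleBundle ER E R X)
    (hθ : IsConnectionForm θ) (z : Circle) {φ : M → R} {m : M}
    (hφ : MDifferentiableAt 𝓘(ℝ, E') 𝓘(ℝ, ER) φ m) :
    pullback (E := E') (E' := ER) (fun x => z • φ x) θ m = pullback (E := E') (E' := ER) φ θ m := by
  have hz : z = Circle.exp (2 * Real.pi * (Complex.arg z / (2 * Real.pi))) := by
    rw [mul_div_cancel₀ _ (by positivity), Circle.exp_arg]
  ext v
  have hv : v = ![v 0] := by ext i; fin_cases i; rfl
  rw [hv, hz, P.pullback_exp_smul hθ (h := fun _ => Complex.arg z / (2 * Real.pi))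
    mdifferentiableAt_const hφ]
  simp only [tangentAt, mfderiv_const]
  exact zero_add _

end PrincipalCircleBundle

variable (P : PrincipalCircleBundle ER E R X)

/-- Smooth lifts `φ` of `f : M → X` to a circle bundle over the open set `U` such that the
connection form restricts to `α` along `φ`. -/
structure IsHorizontalLift (θ : PreForm ER R 1) (f : M → X) (α : PreForm E' M 1) (φ : M → R)
    (U : Set M) : Prop where
  isOpen : IsOpen U
  smooth : ContMDiffOn 𝓘(ℝ, E') 𝓘(ℝ, ER) ∞ φ U
  proj : ∀ m ∈ U, P.proj.toMap (φ m) = f m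
  form : ∀ m ∈ U, pullback (E := E') (E' := ER) φ θ m = α m

/-- The condition `dα = - f^* w`, which makes the connection `f^* θ - α` on the bundle `f^* R` flat
if `θ` has curvature `-w`. -/
def IsFlatPair (w : PreForm E X 2) (f : M → X) (α : PreForm E' M 1) : Prop :=
  ∀ m : M, ContDiffOn ℝ ∞ (chartForm α m) (chartAt E' m).target ∧
    ∀ v ∈ (chartAt E' m).target, extDeriv (chartForm α m) v =
      - pullback (E := E') (E' := E) (f ∘ (chartAt E' m).symm) w v

variable {P} {θ : DiffForm ER R 1} {f : M → X} {α : PreForm E' M 1} {φ ψ : M → R} {U V : Set M}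

theorem IsHorizontalLift.mono (hφ : IsHorizontalLift P θ.toFun f α φ U) (hV : IsOpen V)
    (h : V ⊆ U) : IsHorizontalLift P θ.toFun f α φ V :=
  ⟨hV, hφ.smooth.mono h, fun m hm => hφ.proj m (h hm), fun m hm => hφ.form m (h hm)⟩

theorem IsHorizontalLift.contMDiffAt (hφ : IsHorizontalLift P θ.toFun f α φ U) {m : M}
    (hm : m ∈ U) : ContMDiffAt 𝓘(ℝ, E') 𝓘(ℝ, ER) ∞ φ m :=
  hφ.smooth.contMDiffAt (hφ.isOpen.mem_nhds hm)

theorem IsHorizontalLift.const_smul (hφ : IsHorizontalLift P θ.toFun f α φ U)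
    (hθ : IsConnectionForm θ.toFun) (z : Circle) :
    IsHorizontalLift P θ.toFun f α (fun m => z • φ m) U := by
  refine ⟨hφ.isOpen, fun m hm => ?_, fun m hm => ?_, fun m hm => ?_⟩
  · exact (P.contMDiffAt_smul contMDiffAt_const (hφ.contMDiffAt hm)).contMDiffWithinAt
  · rw [P.proj_smul, hφ.proj m hm]
  · rw [P.pullback_const_smul hθ z ((hφ.contMDiffAt hm).mdifferentiableAt (by simp)), hφ.form m hm]

variable [IsManifold 𝓘(ℝ, E') ∞ M]

/-- In a chart the function has zero derivative on a ball, which is convex. -/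
theorem eventually_eq_of_tangentAt_eq_zero {h : M → ℝ} {m : M}
    (hh : ∀ᶠ x in 𝓝 m, MDifferentiableAt 𝓘(ℝ, E') 𝓘(ℝ, ℝ) h x ∧
      tangentAt (E := E') (E' := ℝ) h x = 0) : ∀ᶠ x in 𝓝 m, h x = h m := by
  set χ := chartAt E' m
  have hm : m ∈ χ.source := mem_chart_source E' m
  have h1 : ∀ᶠ v in 𝓝 (χ m), v ∈ χ.target ∧ MDifferentiableAt 𝓘(ℝ, E') 𝓘(ℝ, ℝ) h (χ.symm v) ∧
      tangentAt (E := E') (E' := ℝ) h (χ.symm v) = 0 := by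
    refine (χ.open_target.eventually_mem (χ.map_source hm)).and ?_
    have := χ.symm.continuousAt (x := χ m) (χ.map_source hm)
    rw [ContinuousAt, χ.left_inv hm] at this
    exact this.eventually hh
  obtain ⟨ε, hε, hb⟩ := Metric.eventually_nhds_iff_ball.1 h1
  have h2 : ∀ v ∈ Metric.ball (χ m) ε, HasFDerivAt (h ∘ χ.symm) (0 : E' →L[ℝ] ℝ) v := by
    intro v hv
    obtain ⟨hv1, hv2, hv3⟩ := hb v hv
    have hd := hv2.comp v (mdifferentiableAt_chart_symm hv1)
    have h4 := tangentAt_comp hv2 (mdifferentiableAt_chart_symm hv1)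
    rw [hv3, ContinuousLinearMap.zero_comp, tangentAt_eq_fderiv] at h4
    rw [← h4]
    exact (mdifferentiableAt_iff_differentiableAt.1 hd).hasFDerivAt
  have h3 : ∀ v ∈ Metric.ball (χ m) ε, (h ∘ χ.symm) v = (h ∘ χ.symm) (χ m) := by
    intro v hv
    refine (convex_ball (χ m) ε).is_const_of_fderivWithin_eq_zero (𝕜 := ℝ)
      (fun x hx => (h2 x hx).differentiableAt.differentiableWithinAt) (fun x hx => ?_) hv
      (Metric.mem_ball_self hε)
    rw [fderivWithin_of_isOpen Metric.isOpen_ball hx, (h2 x hx).fderiv]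
  have h5 : ∀ᶠ x in 𝓝 m, χ x ∈ Metric.ball (χ m) ε :=
    (χ.continuousAt hm).preimage_mem_nhds (Metric.ball_mem_nhds _ hε)
  filter_upwards [h5, χ.open_source.mem_nhds hm] with x hx hx'
  have := h3 _ hx
  simpa only [Function.comp_apply, χ.left_inv hx', χ.left_inv hm] using this

/-- Two horizontal lifts differ by a locally constant factor. -/
theorem IsHorizontalLift.eventually_div_eq (hθ : IsConnectionForm θ.toFun)
    (hφ : IsHorizontalLift P θ.toFun f α φ U) (hψ : IsHorizontalLift P θ.toFun f α ψ V) {m : M}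
    (hU : m ∈ U) (hV : m ∈ V) : ∀ᶠ x in 𝓝 m, φ x = P.div (φ m) (ψ m) • ψ x := by
  have hUV : ∀ᶠ x in 𝓝 m, x ∈ U ∧ x ∈ V :=
    (hφ.isOpen.eventually_mem hU).and (hψ.isOpen.eventually_mem hV)
  have hp : ∀ x, x ∈ U ∧ x ∈ V → P.proj.toMap (φ x) = P.proj.toMap (ψ x) := fun x hx => by
    rw [hφ.proj x hx.1, hψ.proj x hx.2]
  -- Writing the quotient as the exponential of `h` and comparing the connection forms along `φ` and
  -- `ψ` gives dh = 0.
  obtain ⟨h, hh, hz⟩ := exists_local_log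
    (P.contMDiffAt_div (hφ.contMDiffAt hU) (hψ.contMDiffAt hV) (hUV.mono hp))
  have hh1 : ∀ᶠ x in 𝓝 m, ContMDiffAt 𝓘(ℝ, E') 𝓘(ℝ, ℝ) 1 h x := by
    have : IsManifold 𝓘(ℝ, E') 1 M := IsManifold.of_le (n := ∞) ENat.LEInfty.out
    exact (contMDiffAt_iff_contMDiffAt_nhds (by simp)).1 (hh.of_le (m := 1) ENat.LEInfty.out)
  have hconst : ∀ᶠ x in 𝓝 m, h x = h m := by
    refine eventually_eq_of_tangentAt_eq_zero (E' := E') ?_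
    filter_upwards [hh1, hUV.eventually_nhds] with x hx hUx
    have hx' := hx.mdifferentiableAt (by simp)
    refine ⟨hx', ?_⟩
    ext v
    have hxU := hUx.self_of_nhds
    have h1 := P.pullback_exp_smul hθ hx' ((hψ.contMDiffAt hxU.2).mdifferentiableAt (by simp)) v
    have h2 : pullback (E := E') (E' := ER) (fun x => Circle.exp (2 * Real.pi * h x) • ψ x)
        θ.toFun x = pullback (E := E') (E' := ER) φ θ.toFun x := by
      refine pullback_congr _ ?_
      filter_upwards [hUx] with y hy
      rw [← hz y, P.div_smul (hp y hy)]
    rw [h2, hφ.form x hxU.1, hψ.form x hxU.2] at h1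
    simpa using h1
  filter_upwards [hconst, hUV] with x hx hxU
  rw [hz m, ← hx, ← hz x, P.div_smul (hp x hxU)]

/-- Local existence of horizontal lifts. -/
theorem IsFlatPair.exists_local_lift [IsManifold 𝓘(ℝ, ER) ∞ R] (hθ : IsConnectionForm θ.toFun)
    {w : PreForm E X 2}
    (hcurv : extD θ.toFun = - pullback (E := ER) (E' := E) P.proj.toMap w)
    (hf : ContMDiff 𝓘(ℝ, E') 𝓘(ℝ, E) ∞ f) (hα : IsFlatPair w f α) (m : M) {r : R}
    (hr : P.proj.toMap r = f m) :
    ∃ (U : Set M) (φ : M → R), m ∈ U ∧ IsHorizontalLift P θ.toFun f α φ U ∧ φ m = r := by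
  obtain ⟨W, ρ, hW, hrW, hρ, hρp, hρr⟩ := P.exists_local_section r
  set χ := chartAt E' m with hχ
  have hm : m ∈ χ.source := mem_chart_source E' m
  have hO : IsOpen (χ.target ∩ χ.symm ⁻¹' (f ⁻¹' W)) :=
    χ.isOpen_inter_preimage_symm (hW.preimage hf.continuous)
  have hmO : χ m ∈ χ.target ∩ χ.symm ⁻¹' (f ⁻¹' W) :=
    ⟨χ.map_source hm, by simpa only [mem_preimage, χ.left_inv hm, ← hr] using hrW⟩
  obtain ⟨ε, hε, hb⟩ := Metric.isOpen_iff.1 hO _ hmO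
  set B := Metric.ball (χ m) ε
  have hfχ : ∀ v ∈ B, ContMDiffAt 𝓘(ℝ, E') 𝓘(ℝ, E) ∞ (f ∘ χ.symm) v := fun v hv =>
    hf.contMDiffAt.comp v (contMDiffAt_chart_symm (hb hv).1)
  have hρf : ∀ x, f x ∈ W → ContMDiffAt 𝓘(ℝ, E') 𝓘(ℝ, ER) ∞ (ρ ∘ f) x := fun x hx =>
    (hρ.contMDiffAt (hW.mem_nhds hx)).comp x hf.contMDiffAt
  have hg : ∀ v ∈ B, ContMDiffAt 𝓘(ℝ, E') 𝓘(ℝ, ER) ∞ ((ρ ∘ f) ∘ χ.symm) v := fun v hv =>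
    (hρf _ (hb hv).2).comp v (contMDiffAt_chart_symm (hb hv).1)
  -- `A` measures how far the section `ρ ∘ f` is from being horizontal. Multiplying the section by
  -- the exponential of a function `H` makes it horizontal exactly when dH = A, and the flatness
  -- condition says that `A` is closed.
  set A : E' → E' [⋀^Fin 1]→L[ℝ] ℝ := fun v => chartForm α m v -
    pullback (E := E') (E' := ER) ((ρ ∘ f) ∘ χ.symm) θ.toFun v with hA
  have hAs : ContDiffOn ℝ ∞ A B := by
    refine ((hα m).1.mono fun v hv => (hb hv).1).sub fun v hv => ?_
    exact (contDiffAt_pullback_one (hg v hv) θ).contDiffWithinAt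
  have hAd : ∀ v ∈ B, extDeriv A v = 0 := by
    intro v hv
    have h1 : extDeriv A v = extDeriv (chartForm α m) v -
        extDeriv (pullback (E := E') (E' := ER) ((ρ ∘ f) ∘ χ.symm) θ.toFun) v := by
      have h2 : A = chartForm α m +
          (-1 : ℝ) • pullback (E := E') (E' := ER) ((ρ ∘ f) ∘ χ.symm) θ.toFun := by
        funext v
        exact (sub_eq_add_neg (chartForm α m v) _).trans
          (congrArg (chartForm α m v + ·) (neg_one_smul ℝ _).symm)
      rw [h2, extDeriv_add, extDeriv_smul, neg_one_smul, sub_eq_add_neg]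
      · exact ((hα m).1.contDiffAt (χ.open_target.mem_nhds (hb hv).1)).differentiableAt (by simp)
      · exact (differentiableAt_pullback (hg v hv) θ).const_smul _
    rw [h1, (hα m).2 v (hb hv).1, extDeriv_pullback_eq (hg v hv), hcurv, pullback_neg,
      ← pullback_comp w (P.proj.toMap.contMDiff.mdifferentiableAt (by simp))
        ((hg v hv).mdifferentiableAt (by simp))]
    rw [sub_neg_eq_add, neg_add_eq_zero]
    refine pullback_congr _ ?_
    filter_upwards [Metric.isOpen_ball.mem_nhds hv] with y hy
    exact (hρp _ (hb hy).2).symm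
  obtain ⟨H, hH, hHd⟩ := exists_primitive_of_extDeriv_eq_zero (convex_ball (χ m) ε)
    Metric.isOpen_ball hAs hAd
  -- The constant makes the gauge factor equal to 1 at `m`, so that the lift passes through `r`.
  set h : M → ℝ := fun x => H (χ x) - H (χ m)
  have hU : IsOpen (χ.source ∩ χ ⁻¹' B) := χ.isOpen_inter_preimage Metric.isOpen_ball
  have hxW : ∀ x ∈ χ.source ∩ χ ⁻¹' B, f x ∈ W := by
    intro x hx
    have := (hb hx.2).2
    simpa only [mem_preimage, χ.left_inv hx.1] using this
  have hχx : ∀ x ∈ χ.source ∩ χ ⁻¹' B, ContMDiffAt 𝓘(ℝ, E') 𝓘(ℝ, E') ∞ χ x := fun x hx =>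
    (contMDiffOn_chart (I := 𝓘(ℝ, E')) (n := ∞) (x := m)).contMDiffAt
      (χ.open_source.mem_nhds hx.1)
  have hhx : ∀ x ∈ χ.source ∩ χ ⁻¹' B, ContMDiffAt 𝓘(ℝ, E') 𝓘(ℝ, ℝ) ∞ h x := by
    intro x hx
    have h1 : ContDiffAt ℝ ∞ (fun v => H v - H (χ m)) (χ x) :=
      (hH.contDiffAt (Metric.isOpen_ball.mem_nhds hx.2)).sub contDiffAt_const
    exact (contMDiffAt_iff_contDiffAt.2 h1).comp x (hχx x hx)
  refine ⟨χ.source ∩ χ ⁻¹' B, fun x => Circle.exp (2 * Real.pi * h x) • (ρ ∘ f) x,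
    ⟨hm, Metric.mem_ball_self hε⟩, ⟨hU, fun x hx => ?_, fun x hx => ?_, fun x hx => ?_⟩, ?_⟩
  · exact (P.contMDiffAt_exp_smul (hhx x hx) (hρf x (hxW x hx))).contMDiffWithinAt
  · rw [P.proj_smul]
    exact hρp _ (hxW x hx)
  · ext v
    have hv : v = ![v 0] := by ext i; fin_cases i; rfl
    rw [hv, P.pullback_exp_smul hθ ((hhx x hx).mdifferentiableAt (by simp))
      ((hρf x (hxW x hx)).mdifferentiableAt (by simp))]
    have h1 : tangentAt (E := E') (E' := ℝ) h x (v 0) =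
        A (χ x) ![tangentAt (E := E') (E' := E') χ x (v 0)] := by
      have h2 : HasFDerivAt (fun v => H v - H (χ m)) (oneFormEquiv E' (A (χ x))) (χ x) :=
        (hHd _ hx.2).sub_const _
      have h3 := tangentAt_comp (x := x) (f := χ) (g := fun v => H v - H (χ m))
        h2.differentiableAt.mdifferentiableAt ((hχx x hx).mdifferentiableAt (by simp))
      rw [tangentAt_eq_fderiv, h2.fderiv] at h3
      rw [← oneFormEquiv_apply]
      exact congrArg (fun L => L (v 0)) h3
    have h4 : pullback (E := E') (E' := ER) (ρ ∘ f) θ.toFun x ![v 0] =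
        pullback (E := E') (E' := ER) ((ρ ∘ f) ∘ χ.symm) θ.toFun (χ x)
          ![tangentAt (E := E') (E' := E') χ x (v 0)] := by
      have h5 : pullback (E := E') (E' := ER) (ρ ∘ f) θ.toFun x =
          pullback (E := E') (E' := ER) (((ρ ∘ f) ∘ χ.symm) ∘ χ) θ.toFun x := by
        refine pullback_congr _ ?_
        filter_upwards [χ.open_source.mem_nhds hx.1] with y hy
        simp only [Function.comp_apply, χ.left_inv hy]
      rw [h5, pullback_comp θ.toFun ((hg _ hx.2).mdifferentiableAt (by simp))
        ((hχx x hx).mdifferentiableAt (by simp))]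
      simp only [pullback, ContinuousAlternatingMap.compContinuousLinearMap_apply]
      congr 1
      ext i; fin_cases i; rfl
    rw [h1, h4, hA, ContinuousAlternatingMap.sub_apply, sub_add_cancel,
      ← pullback_chart_chartForm α hx.1]
    simp only [pullback, ContinuousAlternatingMap.compContinuousLinearMap_apply]
    congr 1
    ext i; fin_cases i; rfl
  · simp only [h, sub_self, mul_zero, Circle.exp_zero, one_smul, Function.comp_apply, ← hr, hρr]

end HorizontalLifts

/-! ### Flat circle bundles as coverings, and lifts along simply connected spaces. -/

/-- The circle with the discrete topology. -/
def DiscreteCircle := Circle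

instance : TopologicalSpace DiscreteCircle := ⊥

instance : DiscreteTopology DiscreteCircle := ⟨rfl⟩

section Monodromy

variable {ER E R X : Type*}
  [NormedAddCommGroup ER] [NormedSpace ℝ ER] [NormedAddCommGroup E] [NormedSpace ℝ E]
  [TopologicalSpace R] [ChartedSpace ER R] [TopologicalSpace X] [ChartedSpace E X]
  [MulAction Circle R] (P : PrincipalCircleBundle ER E R X)
  {E' M : Type*} [NormedAddCommGroup E'] [NormedSpace ℝ E'] [TopologicalSpace M]
  [ChartedSpace E' M]

/-- Maps `Ψ : A → R` that are locally the composite of `H : A → M` and a horizontal lift. -/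
def IsHorizontalAlong (θ : PreForm ER R 1) (f : M → X) (α : PreForm E' M 1)
    {A : Type*} [TopologicalSpace A] (H : A → M) (Ψ : A → R) : Prop :=
  ∀ a, ∃ (U : Set M) (φ : M → R), H a ∈ U ∧ IsHorizontalLift P θ f α φ U ∧
    ∀ᶠ a' in 𝓝 a, Ψ a' = φ (H a')

variable {P} {θ : DiffForm ER R 1} {f : M → X} {α : PreForm E' M 1}
  {A : Type*} [TopologicalSpace A] {H : A → M}

theorem IsHorizontalAlong.proj {Ψ : A → R} (h : IsHorizontalAlong P θ.toFun f α H Ψ) (a : A) :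
    P.proj.toMap (Ψ a) = f (H a) := by
  obtain ⟨U, φ, ha, hφ, hΨ⟩ := h a
  rw [hΨ.self_of_nhds, hφ.proj _ ha]

theorem IsHorizontalAlong.comp {Ψ : A → R} (h : IsHorizontalAlong P θ.toFun f α H Ψ)
    {A' : Type*} [TopologicalSpace A'] {k : A' → A} (hk : Continuous k) :
    IsHorizontalAlong P θ.toFun f α (H ∘ k) (Ψ ∘ k) := by
  intro a
  obtain ⟨U, φ, ha, hφ, hΨ⟩ := h (k a)
  exact ⟨U, φ, ha, hφ, hk.continuousAt.eventually hΨ⟩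

theorem IsHorizontalAlong.isHorizontalLift {Ψ : M → R}
    (h : IsHorizontalAlong P θ.toFun f α id Ψ) : IsHorizontalLift P θ.toFun f α Ψ univ := by
  refine ⟨isOpen_univ, fun m _ => ?_, fun m _ => h.proj m, fun m _ => ?_⟩
  · obtain ⟨U, φ, ha, hφ, hΨ⟩ := h m
    exact ((hφ.contMDiffAt ha).congr_of_eventuallyEq hΨ).contMDiffWithinAt
  · obtain ⟨U, φ, ha, hφ, hΨ⟩ := h m
    rw [pullback_congr _ hΨ]
    exact hφ.form m ha

theorem IsHorizontalLift.isHorizontalAlong {φ : M → R}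
    (h : IsHorizontalLift P θ.toFun f α φ univ) (H : A → M) :
    IsHorizontalAlong P θ.toFun f α H (φ ∘ H) :=
  fun _ => ⟨univ, φ, mem_univ _, h, Filter.Eventually.of_forall fun _ => rfl⟩

variable [IsManifold 𝓘(ℝ, E') ∞ M]

theorem IsHorizontalAlong.eventually_eq {Ψ Ψ' : A → R} (hθ : IsConnectionForm θ.toFun)
    (hH : Continuous H) (h : IsHorizontalAlong P θ.toFun f α H Ψ)
    (h' : IsHorizontalAlong P θ.toFun f α H Ψ') (a : A) :
    ∀ᶠ x in 𝓝 a, Ψ x = P.div (Ψ a) (Ψ' a) • Ψ' x := by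
  obtain ⟨U, φ, ha, hφ, hΨ⟩ := h a
  obtain ⟨U', φ', ha', hφ', hΨ'⟩ := h' a
  filter_upwards [hΨ, hΨ', hH.continuousAt.eventually (hφ.eventually_div_eq hθ hφ' ha ha')]
    with x h1 h2 h3
  rw [h1, h3, h2, hΨ.self_of_nhds, hΨ'.self_of_nhds]

/-- Uniqueness of horizontal lifts along connected spaces. -/
theorem IsHorizontalAlong.unique [PreconnectedSpace A] {Ψ Ψ' : A → R}
    (hθ : IsConnectionForm θ.toFun)
    (hH : Continuous H) (h : IsHorizontalAlong P θ.toFun f α H Ψ)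
    (h' : IsHorizontalAlong P θ.toFun f α H Ψ') {a₀ : A} (h₀ : Ψ a₀ = Ψ' a₀) : Ψ = Ψ' := by
  have hc : IsLocallyConstant (fun a => P.div (Ψ a) (Ψ' a)) := by
    rw [IsLocallyConstant.iff_eventually_eq]
    intro a
    filter_upwards [h.eventually_eq hθ hH h' a] with x hx
    exact P.div_eq hx
  funext a
  have h1 := hc.apply_eq_of_preconnectedSpace a a₀
  simp only [h₀, P.div_self] at h1
  have h2 := P.div_smul ((h.proj a).trans (h'.proj a).symm)
  rw [← h2, h1, one_smul]

/-- Existence of horizontal lifts along simply connected spaces. -/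
theorem IsFlatPair.exists_lift_along [IsManifold 𝓘(ℝ, ER) ∞ R] (hθ : IsConnectionForm θ.toFun)
    {w : PreForm E X 2}
    (hcurv : extD θ.toFun = - pullback (E := ER) (E' := E) P.proj.toMap w)
    (hf : ContMDiff 𝓘(ℝ, E') 𝓘(ℝ, E) ∞ f) (hα : IsFlatPair w f α)
    [SimplyConnectedSpace A] [LocallyPathConnectedSpace A] (hH : Continuous H) (a₀ : A) {r₀ : R}
    (hr₀ : P.proj.toMap r₀ = f (H a₀)) :
    ∃ Ψ : A → R, Ψ a₀ = r₀ ∧ IsHorizontalAlong P θ.toFun f α H Ψ := by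
  have hloc : ∀ m : M, ∃ (U : Set M) (φ : M → R), m ∈ U ∧
      IsHorizontalLift P θ.toFun f α φ U := fun m => by
    obtain ⟨r, hr⟩ := P.proj.surjective (f m)
    obtain ⟨U, φ, hm, hφ, -⟩ := hα.exists_local_lift hθ hcurv hf m hr
    exact ⟨U, φ, hm, hφ⟩
  choose U φ hmU hφ using hloc
  have hp : ∀ i j x, x ∈ U i ∩ U j → P.proj.toMap (φ i x) = P.proj.toMap (φ j x) :=
    fun i j x hx => by rw [(hφ i).proj x hx.1, (hφ j).proj x hx.2]
  -- The local horizontal lifts trivialize the pulled-back bundle with locally constant transition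
  -- functions. With the discrete topology on the circle it is therefore a covering of `M`, whose
  -- sheets are the horizontal lifts.
  let Z : FiberBundleCore M M DiscreteCircle :=
    { baseSet := U
      isOpen_baseSet := fun i => (hφ i).isOpen
      indexAt := id
      mem_baseSet_at := hmU
      coordChange := fun i j x z => @id Circle z * P.div (φ i x) (φ j x)
      coordChange_self := by
        intro i x _ z
        rw [P.div_self]
        exact mul_one (M := Circle) z
      continuousOn_coordChange := by
        rintro i j ⟨x, z⟩ ⟨hx, -⟩
        refine ContinuousAt.continuousWithinAt ?_
        refine (continuousAt_const (X := M × DiscreteCircle) (Y := DiscreteCircle)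
          (y := @id Circle z * P.div (φ i x) (φ j x))).congr ?_
        have h1 : ∀ᶠ p : M × DiscreteCircle in 𝓝 (x, z), p.2 = z :=
          continuous_snd.continuousAt.eventually (p := fun y => y = z)
            ((isOpen_discrete {z}).mem_nhds rfl)
        have h2 : ∀ᶠ p : M × DiscreteCircle in 𝓝 (x, z),
            φ i p.1 = P.div (φ i x) (φ j x) • φ j p.1 :=
          (continuous_fst.continuousAt (x := (x, z))).eventually
            ((hφ i).eventually_div_eq hθ (hφ j) hx.1 hx.2)
        filter_upwards [h1, h2] with p hp1 hp2
        change @id Circle z * _ = @id Circle p.2 * P.div (φ i p.1) (φ j p.1)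
        rw [hp1, P.div_eq hp2]
      coordChange_comp := by
        intro i j k x hx z
        change @id Circle z * P.div (φ i x) (φ j x) * P.div (φ j x) (φ k x) =
          @id Circle z * P.div (φ i x) (φ k x)
        rw [mul_assoc]
        congr 1
        symm
        apply P.div_eq
        rw [mul_smul, P.div_smul (hp j k x ⟨hx.1.2, hx.2⟩), P.div_smul (hp i j x hx.1)] }
  have hcov : IsCoveringMap
      (Bundle.TotalSpace.proj : Bundle.TotalSpace DiscreteCircle Z.Fiber → M) :=
    FiberBundle.isCoveringMap
  obtain ⟨L, ⟨hL₀, hL⟩, -⟩ := hcov.existsUnique_continuousMap_lifts ⟨H, hH⟩ a₀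
    ⟨H a₀, P.div r₀ (φ (H a₀) (H a₀))⟩ rfl
  have hLp : ∀ a, (L a).proj = H a := fun a => congrFun hL a
  -- The tautological map of the covering to `R`; in the chart of index `i` it is the circle
  -- coordinate times `φ i`.
  let ev : Bundle.TotalSpace DiscreteCircle Z.Fiber → R := fun q =>
    @id Circle q.snd • φ q.proj q.proj
  have hval : ∀ q : Bundle.TotalSpace DiscreteCircle Z.Fiber, ∀ i, q.proj ∈ U i →
      ev q = @id Circle (Z.localTriv i q).2 • φ i q.proj := by
    rintro ⟨x, z⟩ i hx
    change @id Circle z • φ x x = (@id Circle z * P.div (φ x x) (φ i x)) • φ i x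
    rw [mul_smul, P.div_smul (hp x i x ⟨hmU x, hx⟩)]
  refine ⟨fun a => ev (L a), ?_, fun a => ?_⟩
  · refine (congrArg ev hL₀).trans ?_
    exact P.div_smul (hr₀.trans ((hφ _).proj _ (hmU _)).symm)
  · have hsrc : L a ∈ (Z.localTriv (H a)).source :=
      (Z.mem_localTriv_source (H a) (L a)).2 (by rw [hLp]; exact hmU _)
    have hc : ContinuousAt (fun a' => (Z.localTriv (H a) (L a')).2) a :=
      continuous_snd.continuousAt.comp (((Z.localTriv (H a)).continuousAt hsrc).comp
        L.continuous.continuousAt)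
    -- Continuity into a discrete fibre: near `a` the lifted map stays on one sheet.
    have hev : ∀ᶠ a' in 𝓝 a, (Z.localTriv (H a) (L a')).2 = (Z.localTriv (H a) (L a)).2 :=
      hc.eventually (p := fun y => y = (Z.localTriv (H a) (L a)).2)
        ((isOpen_discrete {(Z.localTriv (H a) (L a)).2}).mem_nhds rfl)
    refine ⟨U (H a), _, hmU _,
      (hφ (H a)).const_smul hθ (@id Circle (Z.localTriv (H a) (L a)).2), ?_⟩
    filter_upwards [hev, hH.continuousAt.eventually ((hφ (H a)).isOpen.eventually_mem (hmU _))]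
      with a' h1 h2
    have h3 := hval (L a') (H a) (by rw [hLp]; exact h2)
    rw [h1, hLp] at h3
    exact h3

/-- Existence of global horizontal lifts over simply connected manifolds. -/
theorem IsFlatPair.exists_lift [IsManifold 𝓘(ℝ, ER) ∞ R] (hθ : IsConnectionForm θ.toFun)
    {w : PreForm E X 2}
    (hcurv : extD θ.toFun = - pullback (E := ER) (E' := E) P.proj.toMap w)
    (hf : ContMDiff 𝓘(ℝ, E') 𝓘(ℝ, E) ∞ f) (hα : IsFlatPair w f α)
    [SimplyConnectedSpace M] [LocallyPathConnectedSpace M] :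
    ∃ φ : M → R, IsHorizontalLift P θ.toFun f α φ univ := by
  have hne : Nonempty M := inferInstance
  obtain ⟨m⟩ := hne
  obtain ⟨r, hr⟩ := P.proj.surjective (f m)
  obtain ⟨Ψ, -, h⟩ := hα.exists_lift_along hθ hcurv hf continuous_id m hr
  exact ⟨Ψ, h.isHorizontalLift⟩

end Monodromy

/-! ### Flat bundles without holonomy have global horizontal sections. -/

section Holonomy

variable {ER E R X : Type*}
  [NormedAddCommGroup ER] [NormedSpace ℝ ER] [NormedAddCommGroup E] [NormedSpace ℝ E]
  [TopologicalSpace R] [ChartedSpace ER R] [TopologicalSpace X] [ChartedSpace E X]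
  [MulAction Circle R] (P : PrincipalCircleBundle ER E R X)
  {E' M : Type*} [NormedAddCommGroup E'] [NormedSpace ℝ E'] [TopologicalSpace M]
  [ChartedSpace E' M]

/-- Composites of horizontal lifts with smooth maps. -/
theorem IsHorizontalLift.comp {P : PrincipalCircleBundle ER E R X} {θ : PreForm ER R 1} {f : M → X}
    {α : PreForm E' M 1} {φ : M → R} {U : Set M} (hφ : IsHorizontalLift P θ f α φ U)
    {F N : Type*} [NormedAddCommGroup F] [NormedSpace ℝ F] [TopologicalSpace N] [ChartedSpace F N]
    {g : N → M} {V : Set N} (hV : IsOpen V) (hg : ContMDiffOn 𝓘(ℝ, F) 𝓘(ℝ, E') ∞ g V)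
    (hVU : MapsTo g V U) :
    IsHorizontalLift P θ (f ∘ g) (pullback (E := F) (E' := E') g α) (φ ∘ g) V := by
  refine ⟨hV, hφ.smooth.comp hg hVU, fun n hn => hφ.proj _ (hVU hn), fun n hn => ?_⟩
  have h1 : MDifferentiableAt 𝓘(ℝ, E') 𝓘(ℝ, ER) φ (g n) :=
    (hφ.smooth.contMDiffAt (hφ.isOpen.mem_nhds (hVU hn))).mdifferentiableAt (by simp)
  rw [pullback_comp θ h1 ((hg.contMDiffAt (hV.mem_nhds hn)).mdifferentiableAt (by simp))]
  exact pullback_congr_form (hφ.form _ (hVU hn))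

/-- Two points of the bundle `f^* R` are joined by a horizontal curve that is constant near both
ends. -/
def JoinedHorizontally (θ : PreForm ER R 1) (f : M → X) (α : PreForm E' M 1) (p q : M × R) : Prop :=
  ∃ (γ : ℝ → M) (c : ℝ → R) (a b : ℝ), ContMDiff 𝓘(ℝ, ℝ) 𝓘(ℝ, E') ∞ γ ∧
    IsHorizontalLift P θ (f ∘ γ) (pullback (E := ℝ) (E' := E') γ α) c univ ∧
    (∀ τ ≤ a, γ τ = p.1 ∧ c τ = p.2) ∧ ∀ τ ≥ b, γ τ = q.1 ∧ c τ = q.2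

variable {P} {θ : DiffForm ER R 1} {f : M → X} {α : PreForm E' M 1} {p q r : M × R}

/-- Serves to reverse, shift and rescale horizontal curves. -/
theorem IsHorizontalLift.comp_affine {γ : ℝ → M} {c : ℝ → R}
    (hc : IsHorizontalLift P θ.toFun (f ∘ γ) (pullback (E := ℝ) (E' := E') γ α) c univ)
    (hγ : ContMDiff 𝓘(ℝ, ℝ) 𝓘(ℝ, E') ∞ γ) (k l : ℝ) :
    ContMDiff 𝓘(ℝ, ℝ) 𝓘(ℝ, E') ∞ (γ ∘ fun τ => k * τ + l) ∧
      IsHorizontalLift P θ.toFun (f ∘ (γ ∘ fun τ => k * τ + l))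
        (pullback (E := ℝ) (E' := E') (γ ∘ fun τ => k * τ + l) α) (c ∘ fun τ => k * τ + l) univ := by
  have hk : ContMDiff 𝓘(ℝ, ℝ) 𝓘(ℝ, ℝ) ∞ (fun τ : ℝ => k * τ + l) := by
    rw [contMDiff_iff_contDiff]; fun_prop
  refine ⟨hγ.comp hk, ?_⟩
  have h := hc.comp isOpen_univ hk.contMDiffOn (mapsTo_univ _ _)
  refine ⟨h.isOpen, h.smooth, h.proj, fun τ hτ => ?_⟩
  rw [h.form τ hτ, pullback_comp α (hγ.mdifferentiableAt (by simp)) (hk.mdifferentiableAt (by simp))]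

theorem JoinedHorizontally.symm (h : JoinedHorizontally P θ.toFun f α p q) :
    JoinedHorizontally P θ.toFun f α q p := by
  obtain ⟨γ, c, a, b, hγ, hc, ha, hb⟩ := h
  obtain ⟨h1, h2⟩ := hc.comp_affine hγ (-1) 0
  exact ⟨_, _, -b, -a, h1, h2, fun τ hτ => hb _ (by linarith), fun τ hτ => ha _ (by linarith)⟩

theorem JoinedHorizontally.const_smul (hθ : IsConnectionForm θ.toFun)
    (h : JoinedHorizontally P θ.toFun f α p q) (z : Circle) :
    JoinedHorizontally P θ.toFun f α (p.1, z • p.2) (q.1, z • q.2) := by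
  obtain ⟨γ, c, a, b, hγ, hc, ha, hb⟩ := h
  exact ⟨γ, _, a, b, hγ, hc.const_smul hθ z,
    fun τ hτ => ⟨(ha τ hτ).1, congrArg (z • ·) (ha τ hτ).2⟩,
    fun τ hτ => ⟨(hb τ hτ).1, congrArg (z • ·) (hb τ hτ).2⟩⟩

/-- Curves that are constant near their ends can be concatenated smoothly without matching
derivatives. -/
theorem JoinedHorizontally.trans (h : JoinedHorizontally P θ.toFun f α p q)
    (h' : JoinedHorizontally P θ.toFun f α q r) : JoinedHorizontally P θ.toFun f α p r := by
  obtain ⟨γ, c, a, b, hγ, hc, ha, hb⟩ := h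
  obtain ⟨γ', c', a', b', hγ', hc', ha', hb'⟩ := h'
  -- The shift sends `b + 1` to `a'`: the second curve rests until time `b + 1`, while the first
  -- rests from time `b` on.
  obtain ⟨h1, h2⟩ := hc'.comp_affine hγ' 1 (a' - (b + 1))
  set γ₂ := γ' ∘ fun τ => 1 * τ + (a' - (b + 1))
  set c₂ := c' ∘ fun τ => 1 * τ + (a' - (b + 1))
  have hq : ∀ τ ≤ b + 1, γ₂ τ = q.1 ∧ c₂ τ = q.2 := fun τ hτ => ha' _ (by linarith)
  -- both curves are constant on `[b, b + 1]`
  let g : ℝ → M := fun τ => if τ < b + 1 then γ τ else γ₂ τ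
  let d : ℝ → R := fun τ => if τ < b + 1 then c τ else c₂ τ
  have hlt : ∀ τ < b + 1, g =ᶠ[𝓝 τ] γ ∧ d =ᶠ[𝓝 τ] c := by
    intro τ hτ
    refine ⟨?_, ?_⟩ <;> filter_upwards [isOpen_Iio.mem_nhds hτ] with x hx
    · exact if_pos hx
    · exact if_pos hx
  have hgt : ∀ τ > b, g =ᶠ[𝓝 τ] γ₂ ∧ d =ᶠ[𝓝 τ] c₂ := by
    intro τ hτ
    refine ⟨?_, ?_⟩ <;> filter_upwards [isOpen_Ioi.mem_nhds hτ] with x hx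
    · by_cases hx' : x < b + 1
      · exact (if_pos hx').trans ((hb x (le_of_lt hx)).1.trans (hq x hx'.le).1.symm)
      · exact if_neg hx'
    · by_cases hx' : x < b + 1
      · exact (if_pos hx').trans ((hb x (le_of_lt hx)).2.trans (hq x hx'.le).2.symm)
      · exact if_neg hx'
  have hcases : ∀ τ : ℝ, (g =ᶠ[𝓝 τ] γ ∧ d =ᶠ[𝓝 τ] c) ∨ (g =ᶠ[𝓝 τ] γ₂ ∧ d =ᶠ[𝓝 τ] c₂) := by
    intro τ
    rcases lt_or_ge τ (b + 1) with h | h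
    · exact Or.inl (hlt τ h)
    · exact Or.inr (hgt τ (by linarith))
  refine ⟨g, d, min a b, max (b + 1) (b' - (a' - (b + 1))), ?_, ⟨isOpen_univ, ?_, ?_, ?_⟩, ?_, ?_⟩
  · intro τ
    rcases hcases τ with h | h
    · exact hγ.contMDiffAt.congr_of_eventuallyEq h.1
    · exact h1.contMDiffAt.congr_of_eventuallyEq h.1
  · intro τ _
    rcases hcases τ with h | h
    · exact ((hc.contMDiffAt (mem_univ τ)).congr_of_eventuallyEq h.2).contMDiffWithinAt
    · exact ((h2.contMDiffAt (mem_univ τ)).congr_of_eventuallyEq h.2).contMDiffWithinAt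
  · intro τ _
    rcases hcases τ with h | h
    · rw [h.2.eq_of_nhds, Function.comp_apply, h.1.eq_of_nhds]; exact hc.proj τ (mem_univ _)
    · rw [h.2.eq_of_nhds, Function.comp_apply, h.1.eq_of_nhds]; exact h2.proj τ (mem_univ _)
  · intro τ _
    rcases hcases τ with h | h
    · rw [pullback_congr _ h.2, pullback_congr _ h.1]; exact hc.form τ (mem_univ _)
    · rw [pullback_congr _ h.2, pullback_congr _ h.1]; exact h2.form τ (mem_univ _)
  · intro τ hτ
    have h1 : τ < b + 1 := by linarith [hτ.trans (min_le_right a b)]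
    rw [(hlt τ h1).1.eq_of_nhds, (hlt τ h1).2.eq_of_nhds]
    exact ha τ (hτ.trans (min_le_left a b))
  · intro τ hτ
    have h1 : τ > b := by linarith [(le_max_left _ _).trans hτ]
    rw [(hgt τ h1).1.eq_of_nhds, (hgt τ h1).2.eq_of_nhds]
    exact hb' _ (by linarith [(le_max_right (b + 1) (b' - (a' - (b + 1)))).trans hτ])

variable [IsManifold 𝓘(ℝ, E') ∞ M]

/-- The connecting curve is a segment in the chart, run through with `Real.smoothTransition` so that
it is constant outside [0, 1]. -/
theorem IsHorizontalLift.eventually_joined {φ : M → R} {U : Set M}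
    (hφ : IsHorizontalLift P θ.toFun f α φ U) {m : M} (hm : m ∈ U) :
    ∀ᶠ x in 𝓝 m, JoinedHorizontally P θ.toFun f α (m, φ m) (x, φ x) := by
  set χ := chartAt E' m
  have hms : m ∈ χ.source := mem_chart_source E' m
  have hO : IsOpen (χ.target ∩ χ.symm ⁻¹' U) := χ.isOpen_inter_preimage_symm hφ.isOpen
  obtain ⟨ε, hε, hb⟩ := Metric.isOpen_iff.1 hO (χ m)
    ⟨χ.map_source hms, by simpa only [mem_preimage, χ.left_inv hms] using hm⟩
  have h5 : ∀ᶠ x in 𝓝 m, χ x ∈ Metric.ball (χ m) ε :=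
    (χ.continuousAt hms).preimage_mem_nhds (Metric.ball_mem_nhds _ hε)
  filter_upwards [h5, χ.open_source.mem_nhds hms] with x hx hxs
  let l : ℝ → E' := fun τ => χ m + Real.smoothTransition τ • (χ x - χ m)
  have hl : ContDiff ℝ ∞ l :=
    contDiff_const.add (Real.smoothTransition.contDiff.smul contDiff_const)
  have hlb : ∀ τ, l τ ∈ Metric.ball (χ m) ε := fun τ =>
    (convex_ball (χ m) ε).add_smul_sub_mem (Metric.mem_ball_self hε) hx
      ⟨Real.smoothTransition.nonneg τ, Real.smoothTransition.le_one τ⟩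
  have hγ : ContMDiff 𝓘(ℝ, ℝ) 𝓘(ℝ, E') ∞ (χ.symm ∘ l) := fun τ =>
    (contMDiffAt_chart_symm (hb (hlb τ)).1).comp τ hl.contMDiff.contMDiffAt
  refine ⟨χ.symm ∘ l, φ ∘ (χ.symm ∘ l), 0, 1, hγ,
    hφ.comp isOpen_univ hγ.contMDiffOn fun τ _ => (hb (hlb τ)).2, fun τ hτ => ?_, fun τ hτ => ?_⟩
  · simp [l, Real.smoothTransition.zero_of_nonpos hτ, χ.left_inv hms]
  · simp [l, Real.smoothTransition.one_of_one_le hτ, χ.left_inv hxs]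

/-- A flat bundle without holonomy has a global horizontal section. -/
theorem IsFlatPair.exists_lift_of_holonomyFree [IsManifold 𝓘(ℝ, ER) ∞ R]
    (hθ : IsConnectionForm θ.toFun) {w : PreForm E X 2}
    (hcurv : extD θ.toFun = - pullback (E := ER) (E' := E) P.proj.toMap w)
    (hf : ContMDiff 𝓘(ℝ, E') 𝓘(ℝ, E) ∞ f) (hα : IsFlatPair w f α)
    (hhol : ∀ (γ : ℝ → M) (c : ℝ → R), ContMDiff 𝓘(ℝ, ℝ) 𝓘(ℝ, E') ∞ γ →
      IsHorizontalLift P θ.toFun (f ∘ γ) (pullback (E := ℝ) (E' := E') γ α) c univ →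
      γ 0 = γ 1 → c 0 = c 1) :
    ∃ φ : M → R, IsHorizontalLift P θ.toFun f α φ univ := by
  -- The affine change of parameter sends 0 and 1 to `a` and `b`, where the curve has reached its
  -- ends.
  have hhol' : ∀ m r r', JoinedHorizontally P θ.toFun f α (m, r) (m, r') → r = r' := by
    rintro m r r' ⟨γ, c, a, b, hγ, hc, ha, hb⟩
    obtain ⟨h1, h2⟩ := hc.comp_affine hγ (b - a) a
    have h3 := hhol _ _ h1 h2 (by
      simp [(ha a le_rfl).1, (hb b le_rfl).1])
    simpa [(ha a le_rfl).2, (hb b le_rfl).2] using h3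
  have hproj : ∀ p q : M × R, JoinedHorizontally P θ.toFun f α p q →
      P.proj.toMap p.2 = f p.1 ∧ P.proj.toMap q.2 = f q.1 := by
    rintro p q ⟨γ, c, a, b, hγ, hc, ha, hb⟩
    refine ⟨?_, ?_⟩
    · rw [← (ha a le_rfl).1, ← (ha a le_rfl).2]; exact hc.proj a (mem_univ _)
    · rw [← (hb b le_rfl).1, ← (hb b le_rfl).2]; exact hc.proj b (mem_univ _)
  have hloc : ∀ m r, P.proj.toMap r = f m → ∃ (U : Set M) (φ : M → R), m ∈ U ∧
      IsHorizontalLift P θ.toFun f α φ U ∧ φ m = r := fun m r hr =>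
    hα.exists_local_lift hθ hcurv hf m hr
  have hrefl : ∀ m r, P.proj.toMap r = f m →
      JoinedHorizontally P θ.toFun f α (m, r) (m, r) := by
    intro m r hr
    obtain ⟨U, φ, hm, hφ, rfl⟩ := hloc m r hr
    exact (hφ.eventually_joined hm).self_of_nhds
  -- The classes play the role of path components. In each class a base point and a point of the
  -- bundle over it are fixed, and the section is obtained by transport from there.
  let S : Setoid M :=
    { r := fun m m' => ∃ r r', JoinedHorizontally P θ.toFun f α (m, r) (m', r')
      iseqv :=
        { refl := fun m => by
            obtain ⟨r, hr⟩ := P.proj.surjective (f m)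
            exact ⟨r, r, hrefl m r hr⟩
          symm := fun ⟨r, r', h⟩ => ⟨r', r, h.symm⟩
          trans := by
            rintro m m' m'' ⟨r, r', h⟩ ⟨q, q', h'⟩
            obtain ⟨z, hz⟩ := P.exists_smul_eq
              ((hproj _ _ h').1.trans (hproj _ _ h).2.symm : P.proj.toMap q = P.proj.toMap r')
            have := h'.const_smul hθ z
            rw [← hz] at this
            exact ⟨r, z • q', h.trans this⟩ } }
  choose ρ hρ using fun m : M => P.proj.surjective (f m)
  let rep : M → M := fun m => (Quotient.mk S m).out
  have hex : ∀ m, ∃ r, JoinedHorizontally P θ.toFun f α (rep m, ρ (rep m)) (m, r) := by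
    intro m
    obtain ⟨r, r', h⟩ : ∃ r r', JoinedHorizontally P θ.toFun f α (rep m, r) (m, r') :=
      Quotient.mk_out (s := S) m
    obtain ⟨z, hz⟩ := P.exists_smul_eq
      ((hproj _ _ h).1.trans (hρ (rep m)).symm : P.proj.toMap r = P.proj.toMap (ρ (rep m)))
    have := h.const_smul hθ z
    rw [← hz] at this
    exact ⟨_, this⟩
  choose φ hφ using hex
  -- Near `m` the section agrees with the local lift `ψ` through `φ m`: both values at `x` are
  -- reached horizontally from the same point, so they coincide in the absence of holonomy.
  refine ⟨φ, IsHorizontalAlong.isHorizontalLift fun m => ?_⟩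
  obtain ⟨U, ψ, hm, hψ, hψm⟩ := hloc m (φ m) (hproj _ _ (hφ m)).2
  refine ⟨U, ψ, hm, hψ, ?_⟩
  filter_upwards [hψ.eventually_joined hm] with x hx
  have hrep : rep x = rep m := by
    have : (Quotient.mk S x) = Quotient.mk S m := Quotient.sound (s := S) ⟨_, _, hx.symm⟩
    simp only [rep, this]
  have h1 := hφ x
  rw [hrep] at h1
  rw [hψm] at hx
  exact hhol' x _ _ (h1.symm.trans ((hφ m).trans hx))

end Holonomy

/-! ### Exterior derivatives of one-forms on manifolds. -/

section ExteriorDerivatives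

variable {E E' E'' M M' M'' : Type*}
  [NormedAddCommGroup E] [NormedSpace ℝ E] [NormedAddCommGroup E'] [NormedSpace ℝ E']
  [NormedAddCommGroup E''] [NormedSpace ℝ E'']
  [TopologicalSpace M] [ChartedSpace E M] [TopologicalSpace M'] [ChartedSpace E' M']
  [TopologicalSpace M''] [ChartedSpace E'' M'']

theorem pullback_smoothMap_comp {k : ℕ} (g : SmoothMap E' E'' M' M'') (f : SmoothMap E E' M M')
    (α : PreForm E'' M'' k) :
    pullback (E := E) (E' := E'') (g.comp f) α =
      pullback (E := E) (E' := E') f (pullback (E := E') (E' := E'') g α) :=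
  funext fun _ => pullback_comp α (g.contMDiff.mdifferentiableAt (by simp))
    (f.contMDiff.mdifferentiableAt (by simp))

/-- The one-form `α` is smooth with exterior derivative `β`. -/
def HasExtD (α : PreForm E M 1) (β : PreForm E M 2) : Prop :=
  ∀ m : M, ContDiffOn ℝ ∞ (chartForm α m) (chartAt E m).target ∧
    ∀ v ∈ (chartAt E m).target, extDeriv (chartForm α m) v = chartForm β m v

theorem HasExtD.differentiableAt {α : PreForm E M 1} {β : PreForm E M 2} (h : HasExtD α β) {m : M}
    {v : E} (hv : v ∈ (chartAt E m).target) : DifferentiableAt ℝ (chartForm α m) v :=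
  ((h m).1.contDiffAt ((chartAt E m).open_target.mem_nhds hv)).differentiableAt (by simp)

theorem HasExtD.add {α α' : PreForm E M 1} {β β' : PreForm E M 2} (h : HasExtD α β)
    (h' : HasExtD α' β') : HasExtD (α + α') (β + β') := fun m =>
  ⟨(h m).1.add (h' m).1, fun v hv => by
    have := extDeriv_add (h.differentiableAt hv) (h'.differentiableAt hv)
    rw [(h m).2 v hv, (h' m).2 v hv] at this
    exact this⟩

theorem HasExtD.neg {α : PreForm E M 1} {β : PreForm E M 2} (h : HasExtD α β) :
    HasExtD (-α) (-β) := fun m =>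
  ⟨(h m).1.neg, fun v hv => by
    have h1 : chartForm (-α) m = (-1 : ℝ) • chartForm α m := by
      funext v
      exact (neg_one_smul ℝ (chartForm α m v)).symm
    rw [h1, extDeriv_smul, (h m).2 v hv, neg_one_smul]
    rfl⟩

theorem HasExtD.sub {α α' : PreForm E M 1} {β β' : PreForm E M 2} (h : HasExtD α β)
    (h' : HasExtD α' β') : HasExtD (α - α') (β - β') := by
  rw [sub_eq_add_neg, sub_eq_add_neg]
  exact h.add h'.neg

theorem HasExtD.pullback [IsManifold 𝓘(ℝ, E) ∞ M] [IsManifold 𝓘(ℝ, E') ∞ M']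
    (g : SmoothMap E E' M M') (α : DiffForm E' M' 1) :
    HasExtD (_root_.pullback (E := E) (E' := E') g α.toFun)
      (_root_.pullback (E := E) (E' := E') g (extD α.toFun)) := by
  intro m
  have h1 : ∀ v ∈ (chartAt E m).target,
      ContMDiffAt 𝓘(ℝ, E) 𝓘(ℝ, E') ∞ (g ∘ (chartAt E m).symm) v := fun v hv =>
    g.contMDiff.contMDiffAt.comp v (contMDiffAt_chart_symm hv)
  have h2 : ∀ {k : ℕ} (β : PreForm E' M' k), ∀ v ∈ (chartAt E m).target,
      chartForm (_root_.pullback (E := E) (E' := E') g β) m v =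
        _root_.pullback (E := E) (E' := E') (g ∘ (chartAt E m).symm) β v := fun β v hv =>
    (pullback_comp β (g.contMDiff.mdifferentiableAt (by simp))
      (mdifferentiableAt_chart_symm hv)).symm
  refine ⟨fun v hv => ?_, fun v hv => ?_⟩
  · exact ((contDiffAt_pullback_one (h1 v hv) α).congr_of_eventuallyEq
      (Filter.eventuallyEq_of_mem ((chartAt E m).open_target.mem_nhds hv)
        (h2 α.toFun))).contDiffWithinAt
  · rw [h2 _ v hv, ← extDeriv_pullback_eq (h1 v hv)]
    exact (Filter.eventuallyEq_of_mem ((chartAt E m).open_target.mem_nhds hv)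
        (h2 α.toFun)).extDeriv_eq

/-- Turns the global equation dα = -f^*w into the chartwise flatness condition. -/
theorem HasExtD.isFlatPair [IsManifold 𝓘(ℝ, E) ∞ M] {α : PreForm E M 1} {w : PreForm E' M' 2}
    {f : SmoothMap E E' M M'} (h : HasExtD α (- _root_.pullback (E := E) (E' := E') f w)) :
    IsFlatPair w f α := fun m =>
  ⟨(h m).1, fun v hv => by
    rw [(h m).2 v hv, pullback_comp w (f.contMDiff.mdifferentiableAt (by simp))
      (mdifferentiableAt_chart_symm hv)]
    rfl⟩

end ExteriorDerivatives

/-! ### The cocycle on degenerate simplices, and the horizontal unit section. -/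

section GroupoidForms

variable {E₀ E₁ ER X₀ X₁ R₁ : Type*}
  [NormedAddCommGroup E₀] [NormedSpace ℝ E₀] [FiniteDimensional ℝ E₀]
  [NormedAddCommGroup E₁] [NormedSpace ℝ E₁] [FiniteDimensional ℝ E₁]
  [NormedAddCommGroup ER] [NormedSpace ℝ ER] [FiniteDimensional ℝ ER]
  [TopologicalSpace X₀] [ChartedSpace E₀ X₀] [IsManifold 𝓘(ℝ, E₀) ∞ X₀]
  [TopologicalSpace X₁] [ChartedSpace E₁ X₁] [IsManifold 𝓘(ℝ, E₁) ∞ X₁]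
  [TopologicalSpace R₁] [ChartedSpace ER R₁] [IsManifold 𝓘(ℝ, ER) ∞ R₁] [MulAction Circle R₁]
  {s t : SurjSubmersion E₁ E₀ X₁ X₀}

namespace LieGroupoid

variable (G : LieGroupoid s t)

/-- `x ↦ (x, 1)`. -/
noncomputable def rightUnit : SmoothMap E₁ G.E₂ X₁ G.X₂ :=
  FibProd.lift (ContMDiffMap.id) (G.one.comp t.toMap) (fun x => (G.s_one (t.toMap x)).symm)

/-- `x ↦ (1, x)`. -/
noncomputable def leftUnit : SmoothMap E₁ G.E₂ X₁ G.X₂ :=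
  FibProd.lift (G.one.comp s.toMap) (ContMDiffMap.id) (fun x => (G.t_one (s.toMap x)))

/-- `x ↦ (x, 1, 1)`. -/
noncomputable def rightUnits : SmoothMap E₁ G.E₃ X₁ G.X₃ :=
  FibProd.lift G.rightUnit (G.one.comp t.toMap)
    (fun x => (G.t_one (t.toMap x)).trans (G.s_one (t.toMap x)).symm)

/-- `x ↦ (1, 1, x)`. -/
noncomputable def leftUnits : SmoothMap E₁ G.E₃ X₁ G.X₃ :=
  FibProd.lift (G.one₂.comp s.toMap) (ContMDiffMap.id) (fun x => (G.t_one (s.toMap x)))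

theorem one_mul_one (u : X₀) (h : t.toMap (G.one u) = s.toMap (G.one u)) :
    G.mul ⟨G.one u, G.one u, h⟩ = G.one u := by
  have h1 := G.mul_one (G.one u)
  have h2 : (⟨G.one u, G.one u, h⟩ : FibProd t.toMap s) =
      ⟨G.one u, G.one (t.toMap (G.one u)), (G.s_one _).symm⟩ :=
    FibProd.ext rfl (by simp only [G.t_one])
  rw [h2, h1]

variable {G} {k : ℕ} {η : PreForm G.E₂ G.X₂ k}

/-- On a triple (x, 1, 1) three faces are (x, 1) and the remaining one is (1, 1) at t(x). In the
alternating sum two of the three equal terms cancel. -/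
theorem pullback_rightUnit (h : G.bdry₂ η = 0) :
    pullback (E := E₁) (E' := G.E₂) G.rightUnit η =
      pullback (E := E₁) (E' := E₀) t.toMap (pullback (E := E₀) (E' := G.E₂) G.one₂ η) := by
  have e1 : G.pr₂₃.comp G.rightUnits = G.one₂.comp t.toMap := rfl
  have e2 : G.mul₁₂.comp G.rightUnits = G.rightUnit :=
    ContMDiffMap.ext fun x => FibProd.ext (G.mul_one x) rfl
  have e3 : G.mul₂₃.comp G.rightUnits = G.rightUnit :=
    ContMDiffMap.ext fun x => FibProd.ext rfl (G.one_mul_one _ _)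
  have e4 : G.pr₁₂.comp G.rightUnits = G.rightUnit := rfl
  have h1 : pullback (E := E₁) (E' := G.E₃) G.rightUnits (G.bdry₂ η) = 0 := by rw [h]; rfl
  have h2 : pullback (E := E₁) (E' := G.E₃) G.rightUnits (G.bdry₂ η) =
      pullback (E := E₁) (E' := G.E₂) (G.pr₂₃.comp G.rightUnits) η -
      pullback (E := E₁) (E' := G.E₂) (G.mul₁₂.comp G.rightUnits) η +
      pullback (E := E₁) (E' := G.E₂) (G.mul₂₃.comp G.rightUnits) η -
      pullback (E := E₁) (E' := G.E₂) (G.pr₁₂.comp G.rightUnits) η := by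
    simp only [pullback_smoothMap_comp]
    rfl
  rw [h1, e1, e2, e3, e4, pullback_smoothMap_comp, sub_add_cancel, eq_comm, sub_eq_zero] at h2
  exact h2.symm

/-- The mirror image, with the triples (1, 1, x). -/
theorem pullback_leftUnit (h : G.bdry₂ η = 0) :
    pullback (E := E₁) (E' := G.E₂) G.leftUnit η =
      pullback (E := E₁) (E' := E₀) s.toMap (pullback (E := E₀) (E' := G.E₂) G.one₂ η) := by
  have e1 : G.pr₂₃.comp G.leftUnits = G.leftUnit := rfl
  have e2 : G.mul₁₂.comp G.leftUnits = G.leftUnit :=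
    ContMDiffMap.ext fun x => FibProd.ext (G.one_mul_one _ _) rfl
  have e3 : G.mul₂₃.comp G.leftUnits = G.leftUnit :=
    ContMDiffMap.ext fun x => FibProd.ext rfl (G.one_mul x)
  have e4 : G.pr₁₂.comp G.leftUnits = G.one₂.comp s.toMap := rfl
  have h1 : pullback (E := E₁) (E' := G.E₃) G.leftUnits (G.bdry₂ η) = 0 := by rw [h]; rfl
  have h2 : pullback (E := E₁) (E' := G.E₃) G.leftUnits (G.bdry₂ η) =
      pullback (E := E₁) (E' := G.E₂) (G.pr₂₃.comp G.leftUnits) η -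
      pullback (E := E₁) (E' := G.E₂) (G.mul₁₂.comp G.leftUnits) η +
      pullback (E := E₁) (E' := G.E₂) (G.mul₂₃.comp G.leftUnits) η -
      pullback (E := E₁) (E' := G.E₂) (G.pr₁₂.comp G.leftUnits) η := by
    simp only [pullback_smoothMap_comp]
    rfl
  rw [h1, e1, e2, e3, e4, pullback_smoothMap_comp, sub_self, zero_add, eq_comm, sub_eq_zero] at h2
  exact h2

end LieGroupoid

variable {G : LieGroupoid s t} {P : PrincipalCircleBundle ER E₁ R₁ X₁} {θ : DiffForm ER R₁ 1}
  {η : DiffForm G.E₂ G.X₂ 1} {w : DiffForm E₁ X₁ 2}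

/-- Along `G.one₂` all three faces are the unit map, so ∂w restricts to w - w + w. This is the
flatness of the connection on the unit bundle. -/
theorem isFlatPair_unit (hηw : G.IsDeRhamCocycle η w) :
    IsFlatPair w.toFun G.one (pullback (E := E₀) (E' := G.E₂) G.one₂ η.toFun) := by
  have h := HasExtD.pullback G.one₂ η
  have h1 : extD η.toFun = - G.bdry₁ w.toFun := eq_neg_of_add_eq_zero_left hηw.2.1
  have e : G.mul.comp G.one₂ = G.one := ContMDiffMap.ext fun u => G.one_mul_one _ _
  have h2 : pullback (E := E₀) (E' := G.E₂) G.one₂ (extD η.toFun) =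
      - pullback (E := E₀) (E' := E₁) G.one w.toFun := by
    have h3 : pullback (E := E₀) (E' := G.E₂) G.one₂ (extD η.toFun) =
      - (pullback (E := E₀) (E' := E₁) (G.pr₂.comp G.one₂) w.toFun -
        pullback (E := E₀) (E' := E₁) (G.mul.comp G.one₂) w.toFun +
        pullback (E := E₀) (E' := E₁) (G.pr₁.comp G.one₂) w.toFun) := by
      rw [h1]
      simp only [pullback_smoothMap_comp]
      rfl
    rw [h3, e]
    change - (pullback (E := E₀) (E' := E₁) G.one w.toFun - pullback (E := E₀) (E' := E₁) G.one w.toFun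
      + pullback (E := E₀) (E' := E₁) G.one w.toFun) = _
    rw [sub_self, zero_add]
  rw [h2] at h
  exact h.isFlatPair

theorem pullback_unitConnection {F N : Type*} [NormedAddCommGroup F] [NormedSpace ℝ F]
    [TopologicalSpace N] [ChartedSpace F N]
    (c : SmoothMap F (FibModel E₀ ER E₁) N (unitBundle G P)) :
    pullback (E := F) (E' := FibModel E₀ ER E₁) c (unitConnection G P θ η) =
      pullback (E := F) (E' := ER) (fun n => (c n).right) θ.toFun -
        pullback (E := F) (E' := E₀) (fun n => (c n).left)
          (pullback (E := E₀) (E' := G.E₂) G.one₂ η.toFun) := by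
  have h1 := pullback_smoothMap_comp (FibProd.snd G.one P.proj) c θ.toFun
  have h2 := pullback_smoothMap_comp (FibProd.fst G.one P.proj) c
    (pullback (E := E₀) (E' := G.E₂) G.one₂ η.toFun)
  exact (congrArg₂ (· - ·) h1 h2).symm

theorem IsHorizontalUnitSection.isHorizontalLift
    {σ : SmoothMap E₀ (FibModel E₀ ER E₁) X₀ (unitBundle G P)}
    (hσ : IsHorizontalUnitSection G P θ η σ) :
    IsHorizontalLift P θ.toFun G.one (pullback (E := E₀) (E' := G.E₂) G.one₂ η.toFun)
      (fun u => (σ u).right) univ := by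
  refine ⟨isOpen_univ, ?_, fun u _ => ?_, fun u _ => ?_⟩
  · exact ((FibProd.snd G.one P.proj).comp σ).contMDiff.contMDiffOn
  · rw [← (σ u).condition, hσ.1]
  · have h := congrFun (pullback_unitConnection (θ := θ) (η := η) σ) u
    rw [hσ.2] at h
    have h1 : (fun n => (σ n).left) = id := funext hσ.1
    rw [h1] at h
    have h2 := sub_eq_zero.1 h.symm
    exact h2.trans (pullback_id _ u)

/-- A horizontal curve in the unit bundle is a curve in the base together with a horizontal lift of
it, so `HolonomyFree` supplies the hypothesis of `IsFlatPair.exists_lift_of_holonomyFree`. -/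
theorem exists_isHorizontalUnitSection (hηw : G.IsDeRhamCocycle η w)
    (hθ : IsConnectionForm θ.toFun)
    (hcurv : extD θ.toFun = - pullback (E := ER) (E' := E₁) P.proj.toMap w.toFun)
    (hhol : HolonomyFree (FibProd.fst G.one P.proj) (unitConnection G P θ η)) :
    ∃ σ, IsHorizontalUnitSection G P θ η σ := by
  obtain ⟨φ, hφ⟩ := (isFlatPair_unit hηw).exists_lift_of_holonomyFree hθ hcurv G.one.contMDiff (by
    intro γ c hγ hc h01
    let C : SmoothMap ℝ (FibModel E₀ ER E₁) ℝ (unitBundle G P) :=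
      FibProd.lift ⟨γ, hγ⟩ ⟨c, contMDiffOn_univ.1 hc.smooth⟩ (fun τ => (hc.proj τ (mem_univ _)).symm)
    have h1 := hhol C C.contMDiff (fun τ _ => by
      have h2 := congrFun (pullback_unitConnection (θ := θ) (η := η) C) τ
      have h3 : pullback (E := ℝ) (E' := FibModel E₀ ER E₁) C (unitConnection G P θ η) τ = 0 := by
        rw [h2]
        exact sub_eq_zero.2 (hc.form τ (mem_univ _))
      have h4 := congrArg (fun B => B ![(1 : ℝ)]) h3
      simp only [pullback, ContinuousAlternatingMap.compContinuousLinearMap_apply] at h4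
      refine Eq.trans ?_ h4
      congr 1
      funext i; fin_cases i; rfl) h01
    exact congrArg FibProd.right h1)
  refine ⟨FibProd.lift ContMDiffMap.id ⟨φ, contMDiffOn_univ.1 hφ.smooth⟩
    (fun u => (hφ.proj u (mem_univ _)).symm), fun u => rfl, ?_⟩
  rw [pullback_unitConnection]
  funext u
  refine sub_eq_zero.2 ((hφ.form u (mem_univ _)).trans (pullback_id _ u).symm)

end GroupoidForms

/-! ### Path connectedness of fibres and of their preimages in the circle bundle. -/

section FibresOfSubmersions

variable {E E' M M' : Type*}
  [NormedAddCommGroup E] [NormedSpace ℝ E] [FiniteDimensional ℝ E]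
  [NormedAddCommGroup E'] [NormedSpace ℝ E'] [FiniteDimensional ℝ E']
  [TopologicalSpace M] [ChartedSpace E M] [IsManifold 𝓘(ℝ, E) ∞ M]
  [TopologicalSpace M'] [ChartedSpace E' M'] [IsManifold 𝓘(ℝ, E') ∞ M']

/-- The fibres of a submersion are locally path connected. -/
theorem SurjSubmersion.eventually_joinedIn (g : SurjSubmersion E E' M M') (y : M) :
    ∀ᶠ x in 𝓝 y, g.toMap x = g.toMap y → JoinedIn (g.toMap ⁻¹' {g.toMap y}) y x := by
  obtain ⟨κ, hy, hκ, -, -⟩ := g.exists_chart y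
  obtain ⟨ε, hε, hb⟩ := Metric.isOpen_iff.1 κ.open_target (κ y) (κ.map_source hy)
  have h5 : ∀ᶠ x in 𝓝 y, κ x ∈ Metric.ball (κ y) ε :=
    (κ.continuousAt hy).preimage_mem_nhds (Metric.ball_mem_nhds _ hε)
  filter_upwards [h5, κ.open_source.mem_nhds hy] with x hx hxs hgx
  have hmem : ∀ τ ∈ Icc (0 : ℝ) 1, κ y + τ • (κ x - κ y) ∈ Metric.ball (κ y) ε := fun τ hτ =>
    (convex_ball (κ y) ε).add_smul_sub_mem (Metric.mem_ball_self hε) hx hτ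
  -- In a submersion chart a fibre is a slice with fixed first component, and a segment between two
  -- of its points stays in the slice.
  refine JoinedIn.ofLine (f := fun τ => κ.symm (κ y + τ • (κ x - κ y))) ?_ ?_ ?_ ?_
  · exact κ.continuousOn_symm.comp (by fun_prop) fun τ hτ => hb (hmem τ hτ)
  · simp [κ.left_inv hy]
  · simp [κ.left_inv hxs]
  · rintro _ ⟨τ, hτ, rfl⟩
    have ht := hb (hmem τ hτ)
    have h1 := hκ _ (κ.map_target ht)
    rw [κ.right_inv ht] at h1
    have h2 : (κ x).1 = (κ y).1 := by rw [(hκ x hxs).2, (hκ y hy).2, hgx]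
    have h3 : (κ y + τ • (κ x - κ y)).1 = (κ y).1 := by simp [h2]
    rw [h3, (hκ y hy).2] at h1
    exact ((chartAt E' (g.toMap y)).injOn h1.1 (mem_chart_source E' _) h1.2.symm)

end FibresOfSubmersions

section BundleOrbits

variable {ER E R X : Type*}
  [NormedAddCommGroup ER] [NormedSpace ℝ ER] [NormedAddCommGroup E] [NormedSpace ℝ E]
  [TopologicalSpace R] [ChartedSpace ER R] [TopologicalSpace X] [ChartedSpace E X]
  [MulAction Circle R]

theorem PrincipalCircleBundle.joinedIn_smul (P : PrincipalCircleBundle ER E R X) (r : R)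
    (z : Circle) {S : Set R} (hS : ∀ z : Circle, z • r ∈ S) : JoinedIn S r (z • r) := by
  refine JoinedIn.ofLine (f := fun τ : ℝ => Circle.exp (τ * Complex.arg z) • r) ?_ ?_ ?_ ?_
  · have h1 : Continuous (fun p : Circle × R => p.1 • p.2) :=
      P.smooth_smul.contMDiff_smul.continuous
    exact (h1.comp (by fun_prop : Continuous fun τ : ℝ =>
      (Circle.exp (τ * Complex.arg z), r))).continuousOn
  · simp
  · simp [Circle.exp_arg]
  · rintro _ ⟨τ, -, rfl⟩
    exact hS _

end BundleOrbits

section BundleFibres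

variable {ER E E' R X B : Type*}
  [NormedAddCommGroup ER] [NormedSpace ℝ ER] [FiniteDimensional ℝ ER]
  [NormedAddCommGroup E] [NormedSpace ℝ E]
  [NormedAddCommGroup E'] [NormedSpace ℝ E'] [FiniteDimensional ℝ E']
  [TopologicalSpace R] [ChartedSpace ER R] [IsManifold 𝓘(ℝ, ER) ∞ R]
  [TopologicalSpace X] [ChartedSpace E X]
  [TopologicalSpace B] [ChartedSpace E' B] [IsManifold 𝓘(ℝ, E') ∞ B]
  [MulAction Circle R]

/-- The preimage in a circle bundle of a connected fibre of a submersion is path connected. -/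
theorem PrincipalCircleBundle.joinedIn_fibre (P : PrincipalCircleBundle ER E R X)
    (g : SurjSubmersion E E' X B) {b : B} (hb : IsPreconnected (g.toMap ⁻¹' {b})) {r r' : R}
    (hr : g.toMap (P.proj.toMap r) = b) (hr' : g.toMap (P.proj.toMap r') = b) :
    JoinedIn ((g.comp P.proj).toMap ⁻¹' {b}) r r' := by
  have key : ∀ x ∈ g.toMap ⁻¹' {b}, ∀ y ∈ g.toMap ⁻¹' {b}, ∀ r r' : R, P.proj.toMap r = x →
      P.proj.toMap r' = y → JoinedIn ((g.comp P.proj).toMap ⁻¹' {b}) r r' := by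
    intro x hx y hy
    -- Being joined above is an equivalence relation on base points that holds between neighbours: a
    -- local section joins nearby fibres, and circle orbits join points within a fibre.
    -- Preconnectedness spreads it over the whole fibre.
    refine hb.induction₂ (fun x y => ∀ r r' : R, P.proj.toMap r = x →
      P.proj.toMap r' = y → JoinedIn ((g.comp P.proj).toMap ⁻¹' {b}) r r') ?_ ?_ ?_ hx hy
    · rintro x hx
      obtain ⟨r₀, rfl⟩ := P.proj.surjective x
      obtain ⟨U, ρ, hU, hrU, hρ, hρp, hρr⟩ := P.exists_local_section r₀
      have h1 := (g.comp P.proj).eventually_joinedIn r₀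
      have h2 : ∀ᶠ y in 𝓝 (P.proj.toMap r₀), (g.comp P.proj).toMap (ρ y) = (g.comp P.proj).toMap r₀ →
          JoinedIn ((g.comp P.proj).toMap ⁻¹' {(g.comp P.proj).toMap r₀}) r₀ (ρ y) := by
        have h3 : ContinuousAt ρ (P.proj.toMap r₀) :=
          (hρ.contMDiffAt (hU.mem_nhds hrU)).continuousAt
        rw [ContinuousAt, hρr] at h3
        exact h3.eventually h1
      have hb' : (g.comp P.proj).toMap r₀ = b := hx
      rw [hb'] at h2
      filter_upwards [nhdsWithin_le_nhds h2, nhdsWithin_le_nhds (hU.mem_nhds hrU),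
        self_mem_nhdsWithin] with y hy hyU hyF r r' hr hr'
      have hρy : (g.comp P.proj).toMap (ρ y) = b := by
        change g.toMap (P.proj.toMap (ρ y)) = b
        rw [hρp y hyU]; exact hyF
      have h4 := hy hρy
      obtain ⟨z, rfl⟩ := P.exists_smul_eq hr.symm
      obtain ⟨z', rfl⟩ := P.exists_smul_eq ((hρp y hyU).trans hr'.symm)
      refine ((P.joinedIn_smul r₀ z ?_).symm.trans h4).trans (P.joinedIn_smul (ρ y) z' ?_)
      · intro z
        change g.toMap (P.proj.toMap (z • r₀)) = b
        rw [P.proj_smul]; exact hx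
      · intro z
        change g.toMap (P.proj.toMap (z • ρ y)) = b
        rw [P.proj_smul]; exact hρy
    · intro x y z hx hy hz hxy hyz r r' hr hr'
      obtain ⟨q, hq⟩ := P.proj.surjective y
      exact (hxy r q hr hq).trans (hyz q r' hq hr')
    · intro x y hx hy hxy r r' hr hr'
      exact (hxy r' r hr' hr).symm
  exact key _ hr _ hr' r r' rfl rfl

end BundleFibres

/-! ### Product neighbourhoods in fibre products. -/

section Boxes

variable {EM EN EB M N B : Type*}
  [NormedAddCommGroup EM] [NormedSpace ℝ EM]
  [NormedAddCommGroup EN] [NormedSpace ℝ EN] [FiniteDimensional ℝ EN]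
  [NormedAddCommGroup EB] [NormedSpace ℝ EB] [FiniteDimensional ℝ EB]
  [TopologicalSpace M] [ChartedSpace EM M] [IsManifold 𝓘(ℝ, EM) ∞ M]
  [TopologicalSpace N] [ChartedSpace EN N] [IsManifold 𝓘(ℝ, EN) ∞ N]
  [TopologicalSpace B] [ChartedSpace EB B] [IsManifold 𝓘(ℝ, EB) ∞ B]
  {f : SmoothMap EM EB M B} {g : SurjSubmersion EN EB N B}

/-- Small product neighbourhoods in a fibre product: `T x y` has the first component of `x` and the
fibre coordinate of `y`. -/
theorem FibProd.exists_box (p : FibProd f g) {U : Set (FibProd f g)} (hU : U ∈ 𝓝 p) :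
    ∃ (V : Set (FibProd f g)) (T : FibProd f g → FibProd f g → FibProd f g),
      IsOpen V ∧ p ∈ V ∧ V ⊆ U ∧
      (∀ x ∈ V, ∀ y ∈ V, T x y ∈ V ∧ (T x y).left = x.left ∧ (x.left = y.left → T x y = y) ∧
        JoinedIn {q | q ∈ V ∧ q.left = x.left} x (T x y)) ∧
      ∀ y ∈ V, ContinuousOn (fun x => T x y) V := by
  obtain ⟨c, hp, ⟨κ, -, hsrc, hc⟩, -, -⟩ := FibProd.exists_chart p
  obtain ⟨U', hU'U, hU'o, hpU'⟩ := mem_nhds_iff.1 hU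
  have hO := c.isOpen_inter_preimage_symm hU'o
  obtain ⟨ε, hε, hb⟩ := Metric.isOpen_iff.1 hO (c p)
    ⟨c.map_source hp, by simpa only [mem_preimage, c.left_inv hp] using hpU'⟩
  -- A ball for the maximum distance is a product of balls, so components may be exchanged.
  have hbox : ∀ z z' : FibModel EM EN EB, z ∈ Metric.ball (c p) ε → z' ∈ Metric.ball (c p) ε →
      (z.1, z'.2) ∈ Metric.ball (c p) ε := by
    intro z z' hz hz'
    rw [Metric.mem_ball, Prod.dist_eq, max_lt_iff] at hz hz' ⊢
    exact ⟨hz.1, hz'.2⟩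
  set V : Set (FibProd f g) := c.source ∩ c ⁻¹' Metric.ball (c p) ε with hV
  have hmem : ∀ z ∈ Metric.ball (c p) ε, c.symm z ∈ V := fun z hz =>
    ⟨c.map_target (hb hz).1, by rw [mem_preimage, c.right_inv (hb hz).1]; exact hz⟩
  have hleft : ∀ z ∈ Metric.ball (c p) ε, ∀ x ∈ V, z.1 = (c x).1 → (c.symm z).left = x.left := by
    intro z hz x hx h
    have h1 := c.right_inv (hb hz).1
    rw [hc] at h1
    have h2 := congrArg Prod.fst h1
    simp only [h, hc x] at h2
    exact (chartAt EM p.left).injOn (hsrc _ (hmem z hz).1).1 (hsrc _ hx.1).1 h2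
  refine ⟨V, fun x y => c.symm ((c x).1, (c y).2), c.isOpen_inter_preimage Metric.isOpen_ball,
    ⟨hp, Metric.mem_ball_self hε⟩, ?_, ?_, ?_⟩
  · intro x hx
    have := (hb hx.2).2
    rw [mem_preimage, c.left_inv hx.1] at this
    exact hU'U this
  · intro x hx y hy
    have hz := hbox _ _ hx.2 hy.2
    refine ⟨hmem _ hz, hleft _ hz x hx rfl, fun h => ?_, ?_⟩
    · have h1 : ((c x).1, (c y).2) = c y := by
        refine Prod.ext ?_ rfl
        rw [hc x, hc y, h]
      exact (congrArg c.symm h1).trans (c.left_inv hy.1)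
    · have hseg : ∀ τ ∈ Icc (0 : ℝ) 1,
          c x + τ • (((c x).1, (c y).2) - c x) ∈ Metric.ball (c p) ε := fun τ hτ =>
        (convex_ball (c p) ε).add_smul_sub_mem hx.2 hz hτ
      refine JoinedIn.ofLine (f := fun τ => c.symm (c x + τ • (((c x).1, (c y).2) - c x))) ?_ ?_ ?_ ?_
      · exact c.continuousOn_symm.comp (by fun_prop) fun τ hτ => (hb (hseg τ hτ)).1
      · simp [c.left_inv hx.1]
      · simp
      · rintro _ ⟨τ, hτ, rfl⟩
        exact ⟨hmem _ (hseg τ hτ), hleft _ (hseg τ hτ) x hx (by simp)⟩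
  · intro y hy
    refine c.continuousOn_symm.comp ?_ fun x hx => (hb (hbox _ _ hx.2 hy.2)).1
    exact (continuous_fst.comp_continuousOn (c.continuousOn.mono inter_subset_left)).prodMk
      continuousOn_const

end Boxes

/-! ### The flat bundle over the manifold of pairs, and its lifts over unit pairs. -/

section PairForms

variable {E₀ E₁ ER X₀ X₁ R₁ : Type*}
  [NormedAddCommGroup E₀] [NormedSpace ℝ E₀] [FiniteDimensional ℝ E₀]
  [NormedAddCommGroup E₁] [NormedSpace ℝ E₁] [FiniteDimensional ℝ E₁]
  [NormedAddCommGroup ER] [NormedSpace ℝ ER] [FiniteDimensional ℝ ER]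
  [TopologicalSpace X₀] [ChartedSpace E₀ X₀] [IsManifold 𝓘(ℝ, E₀) ∞ X₀]
  [TopologicalSpace X₁] [ChartedSpace E₁ X₁] [IsManifold 𝓘(ℝ, E₁) ∞ X₁]
  [TopologicalSpace R₁] [ChartedSpace ER R₁] [IsManifold 𝓘(ℝ, ER) ∞ R₁] [MulAction Circle R₁]
  {s t : SurjSubmersion E₁ E₀ X₁ X₀}

/-- The manifold `R₂` of pairs in `R₁` that lie over composable pairs. -/
abbrev PairSpace (s t : SurjSubmersion E₁ E₀ X₁ X₀) (P : PrincipalCircleBundle ER E₁ R₁ X₁) :=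
  FibProd (t.comp P.proj).toMap (s.comp P.proj)

/-- The projection `R₂ → X₂`. -/
noncomputable def pairProj (s t : SurjSubmersion E₁ E₀ X₁ X₀)
    (P : PrincipalCircleBundle ER E₁ R₁ X₁) :
    SmoothMap (FibModel ER ER E₀) (FibModel E₁ E₁ E₀) (PairSpace s t P) (FibProd t.toMap s) :=
  FibProd.lift (P.proj.toMap.comp (FibProd.fst _ _)) (P.proj.toMap.comp (FibProd.snd _ _))
    (fun p => p.condition)

variable (G : LieGroupoid s t) (P : PrincipalCircleBundle ER E₁ R₁ X₁) (θ : DiffForm ER R₁ 1)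
  (η : DiffForm G.E₂ G.X₂ 1)

/-- The product of the projections, `R₂ → X₁`. -/
noncomputable def mulBase : SmoothMap (FibModel ER ER E₀) E₁ (PairSpace s t P) X₁ :=
  G.mul.comp (pairProj s t P)

/-- The one-form `pr₁^* θ + pr₂^* θ - π^* η` on `R₂`, which is the restriction of `θ` along the
multiplication of an extension with pseudo-curvature `η + w`. -/
noncomputable def mulForm : PreForm (FibModel ER ER E₀) (PairSpace s t P) 1 :=
  pullback (E := FibModel ER ER E₀) (E' := ER)
      (FibProd.fst (t.comp P.proj).toMap (s.comp P.proj)) θ.toFun +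
    pullback (E := FibModel ER ER E₀) (E' := ER)
      (FibProd.snd (t.comp P.proj).toMap (s.comp P.proj)) θ.toFun -
    pullback (E := FibModel ER ER E₀) (E' := FibModel E₁ E₁ E₀) (pairProj s t P) η.toFun

variable {G P θ η} {w : DiffForm E₁ X₁ 2}

/-- Replacing dη by -∂w, the two outer faces of ∂w cancel the curvatures of the two copies of `θ`;
only the product face remains. -/
theorem isFlatPair_mul (hηw : G.IsDeRhamCocycle η w)
    (hcurv : extD θ.toFun = - pullback (E := ER) (E' := E₁) P.proj.toMap w.toFun) :
    IsFlatPair w.toFun (mulBase G P) (mulForm G P θ η) := by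
  have h1 : extD η.toFun = - G.bdry₁ w.toFun := eq_neg_of_add_eq_zero_left hηw.2.1
  have h := ((HasExtD.pullback (FibProd.fst (t.comp P.proj).toMap (s.comp P.proj)) θ).add
    (HasExtD.pullback (FibProd.snd (t.comp P.proj).toMap (s.comp P.proj)) θ)).sub
    (HasExtD.pullback (pairProj s t P) η)
  rw [h1, hcurv] at h
  have e1 := pullback_smoothMap_comp P.proj.toMap
    (FibProd.fst (t.comp P.proj).toMap (s.comp P.proj)) w.toFun
  have e2 := pullback_smoothMap_comp P.proj.toMap
    (FibProd.snd (t.comp P.proj).toMap (s.comp P.proj)) w.toFun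
  have e3 := pullback_smoothMap_comp G.mul (pairProj s t P) w.toFun
  have e4 := pullback_smoothMap_comp G.pr₁ (pairProj s t P) w.toFun
  have e5 := pullback_smoothMap_comp G.pr₂ (pairProj s t P) w.toFun
  have hform : ∀ β, β = - pullback (E := FibModel ER ER E₀) (E' := E₁) (mulBase G P) w.toFun →
      HasExtD (mulForm G P θ η) β → IsFlatPair w.toFun (mulBase G P) (mulForm G P θ η) := by
    rintro _ rfl h
    exact h.isFlatPair
  refine hform _ ?_ h
  change - pullback (E := FibModel ER ER E₀) (E' := ER)
      (FibProd.fst (t.comp P.proj).toMap (s.comp P.proj))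
      (pullback (E := ER) (E' := E₁) P.proj.toMap w.toFun) +
    - pullback (E := FibModel ER ER E₀) (E' := ER)
      (FibProd.snd (t.comp P.proj).toMap (s.comp P.proj))
      (pullback (E := ER) (E' := E₁) P.proj.toMap w.toFun) -
    - (pullback (E := FibModel ER ER E₀) (E' := FibModel E₁ E₁ E₀) (pairProj s t P)
        (pullback (E := G.E₂) (E' := E₁) G.pr₂ w.toFun) -
      pullback (E := FibModel ER ER E₀) (E' := FibModel E₁ E₁ E₀) (pairProj s t P)
        (pullback (E := G.E₂) (E' := E₁) G.mul w.toFun) +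
      pullback (E := FibModel ER ER E₀) (E' := FibModel E₁ E₁ E₀) (pairProj s t P)
        (pullback (E := G.E₂) (E' := E₁) G.pr₁ w.toFun)) = _
  rw [← e1, ← e2, ← e3, ← e4, ← e5]
  have e6 : G.pr₁.comp (pairProj s t P) = P.proj.toMap.comp
    (FibProd.fst (t.comp P.proj).toMap (s.comp P.proj)) := rfl
  have e7 : G.pr₂.comp (pairProj s t P) = P.proj.toMap.comp
    (FibProd.snd (t.comp P.proj).toMap (s.comp P.proj)) := rfl
  rw [e6, e7, mulBase]
  abel

/-- The pull-back of `mulForm` along a map to `R₂`. -/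
theorem pullback_mulForm {F N : Type*} [NormedAddCommGroup F] [NormedSpace ℝ F]
    [TopologicalSpace N] [ChartedSpace F N]
    (c : SmoothMap F (FibModel ER ER E₀) N (PairSpace s t P)) :
    pullback (E := F) (E' := FibModel ER ER E₀) c (mulForm G P θ η) =
      pullback (E := F) (E' := ER) (fun n => (c n).left) θ.toFun +
      pullback (E := F) (E' := ER) (fun n => (c n).right) θ.toFun -
      pullback (E := F) (E' := G.E₂) ((pairProj s t P).comp c) η.toFun := by
  have h1 := pullback_smoothMap_comp (FibProd.fst (t.comp P.proj).toMap (s.comp P.proj)) c θ.toFun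
  have h2 := pullback_smoothMap_comp (FibProd.snd (t.comp P.proj).toMap (s.comp P.proj)) c θ.toFun
  have h3 := pullback_smoothMap_comp (pairProj s t P) c η.toFun
  exact (congrArg₂ (· - ·) (congrArg₂ (· + ·) h1 h2) h3).symm

variable {e : SmoothMap E₀ ER X₀ R₁}

/-- `r ↦ (r, 1)` for a unit section `e`. -/
noncomputable def pairRightUnit (he : ∀ u, P.proj.toMap (e u) = G.one u) :
    SmoothMap ER (FibModel ER ER E₀) R₁ (PairSpace s t P) :=
  FibProd.lift ContMDiffMap.id (e.comp (t.comp P.proj).toMap) (fun r => by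
    change t.toMap (P.proj.toMap r) = s.toMap (P.proj.toMap (e (t.toMap (P.proj.toMap r))))
    rw [he, G.s_one])

/-- `r ↦ (1, r)` for a unit section `e`. -/
noncomputable def pairLeftUnit (he : ∀ u, P.proj.toMap (e u) = G.one u) :
    SmoothMap ER (FibModel ER ER E₀) R₁ (PairSpace s t P) :=
  FibProd.lift (e.comp (s.comp P.proj).toMap) ContMDiffMap.id (fun r => by
    change t.toMap (P.proj.toMap (e (s.toMap (P.proj.toMap r)))) = s.toMap (P.proj.toMap r)
    rw [he, G.t_one])

variable (he : ∀ u, P.proj.toMap (e u) = G.one u)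

theorem mulBase_comp_pairRightUnit : (mulBase G P).comp (pairRightUnit he) = P.proj.toMap := by
  refine ContMDiffMap.ext fun r => ?_
  have h : pairProj s t P (pairRightUnit he r) =
      ⟨P.proj.toMap r, G.one (t.toMap (P.proj.toMap r)), (G.s_one _).symm⟩ :=
    FibProd.ext rfl (he _)
  exact (congrArg G.mul h).trans (G.mul_one _)

theorem mulBase_comp_pairLeftUnit : (mulBase G P).comp (pairLeftUnit he) = P.proj.toMap := by
  refine ContMDiffMap.ext fun r => ?_
  have h : pairProj s t P (pairLeftUnit he r) =
      ⟨G.one (s.toMap (P.proj.toMap r)), P.proj.toMap r, G.t_one _⟩ :=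
    FibProd.ext (he _) rfl
  exact (congrArg G.mul h).trans (G.one_mul _)

/-- The right component contributes t^*e^*θ, which by `hef` is exactly the restriction of `η` found
in `LieGroupoid.pullback_rightUnit`, so the two cancel. -/
theorem pullback_pairRightUnit (hη : G.bdry₂ η.toFun = 0)
    (hef : pullback (E := E₀) (E' := ER) e θ.toFun =
      pullback (E := E₀) (E' := G.E₂) G.one₂ η.toFun) :
    pullback (E := ER) (E' := FibModel ER ER E₀) (pairRightUnit he) (mulForm G P θ η) =
      θ.toFun := by
  rw [pullback_mulForm]
  have e1 : (pairProj s t P).comp (pairRightUnit he) = G.rightUnit.comp P.proj.toMap :=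
    ContMDiffMap.ext fun r => FibProd.ext rfl (he _)
  have e2 : pullback (E := ER) (E' := ER) (fun r => (pairRightUnit he r).left) θ.toFun = θ.toFun :=
    funext fun r => pullback_id _ r
  have e3 : pullback (E := ER) (E' := ER) (fun r => (pairRightUnit he r).right) θ.toFun =
      pullback (E := ER) (E' := ER) (e.comp (t.toMap.comp P.proj.toMap)) θ.toFun := rfl
  rw [e1, e2, e3, pullback_smoothMap_comp, pullback_smoothMap_comp, pullback_smoothMap_comp,
    LieGroupoid.pullback_rightUnit hη, hef, add_sub_cancel_right]

theorem pullback_pairLeftUnit (hη : G.bdry₂ η.toFun = 0)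
    (hef : pullback (E := E₀) (E' := ER) e θ.toFun =
      pullback (E := E₀) (E' := G.E₂) G.one₂ η.toFun) :
    pullback (E := ER) (E' := FibModel ER ER E₀) (pairLeftUnit he) (mulForm G P θ η) =
      θ.toFun := by
  rw [pullback_mulForm]
  have e1 : (pairProj s t P).comp (pairLeftUnit he) = G.leftUnit.comp P.proj.toMap :=
    ContMDiffMap.ext fun r => FibProd.ext (he _) rfl
  have e2 : pullback (E := ER) (E' := ER) (fun r => (pairLeftUnit he r).right) θ.toFun = θ.toFun :=
    funext fun r => pullback_id _ r
  have e3 : pullback (E := ER) (E' := ER) (fun r => (pairLeftUnit he r).left) θ.toFun =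
      pullback (E := ER) (E' := ER) (e.comp (s.toMap.comp P.proj.toMap)) θ.toFun := rfl
  rw [e1, e2, e3, pullback_smoothMap_comp, pullback_smoothMap_comp, pullback_smoothMap_comp,
    LieGroupoid.pullback_leftUnit hη, hef, add_sub_cancel_left]

/-- Shows that the rule r · 1 = r is compatible with the connection. It supplies the initial values
of the transport that defines products. -/
theorem isHorizontalLift_pairRightUnit (hη : G.bdry₂ η.toFun = 0)
    (hef : pullback (E := E₀) (E' := ER) e θ.toFun =
      pullback (E := E₀) (E' := G.E₂) G.one₂ η.toFun) :
    IsHorizontalLift P θ.toFun (mulBase G P ∘ pairRightUnit he)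
      (pullback (E := ER) (E' := FibModel ER ER E₀) (pairRightUnit he) (mulForm G P θ η)) id univ := by
  rw [pullback_pairRightUnit he hη hef]
  refine ⟨isOpen_univ, contMDiffOn_id, fun r _ => ?_, fun r _ => pullback_id _ r⟩
  exact (congrArg (fun c => c r) (mulBase_comp_pairRightUnit he)).symm

theorem isHorizontalLift_pairLeftUnit (hη : G.bdry₂ η.toFun = 0)
    (hef : pullback (E := E₀) (E' := ER) e θ.toFun =
      pullback (E := E₀) (E' := G.E₂) G.one₂ η.toFun) :
    IsHorizontalLift P θ.toFun (mulBase G P ∘ pairLeftUnit he)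
      (pullback (E := ER) (E' := FibModel ER ER E₀) (pairLeftUnit he) (mulForm G P θ η)) id univ := by
  rw [pullback_pairLeftUnit he hη hef]
  refine ⟨isOpen_univ, contMDiffOn_id, fun r _ => ?_, fun r _ => pullback_id _ r⟩
  exact (congrArg (fun c => c r) (mulBase_comp_pairLeftUnit he)).symm

end PairForms

/-! ### Inverses, and connectedness of the fibres of the target map. -/

section Groupoid

variable {E₀ E₁ X₀ X₁ : Type*}
  [NormedAddCommGroup E₀] [NormedSpace ℝ E₀] [FiniteDimensional ℝ E₀]
  [NormedAddCommGroup E₁] [NormedSpace ℝ E₁] [FiniteDimensional ℝ E₁]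
  [TopologicalSpace X₀] [ChartedSpace E₀ X₀] [IsManifold 𝓘(ℝ, E₀) ∞ X₀]
  [TopologicalSpace X₁] [ChartedSpace E₁ X₁] [IsManifold 𝓘(ℝ, E₁) ∞ X₁]
  {s t : SurjSubmersion E₁ E₀ X₁ X₀}

namespace LieGroupoid

theorem mul_congr (G : LieGroupoid s t) {x x' y y' : X₁} (hx : x = x') (hy : y = y')
    (h : t.toMap x = s.toMap y) (h' : t.toMap x' = s.toMap y') :
    G.mul ⟨x, y, h⟩ = G.mul ⟨x', y', h'⟩ := by
  subst hx hy; rfl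

/-- Inverses are unique. -/
theorem eq_inv_of_mul_eq_one (G : LieGroupoid s t) {x y : X₁} (h : t.toMap x = s.toMap y)
    (hxy : G.mul ⟨x, y, h⟩ = G.one (s.toMap x)) : y = G.inv x := by
  have h1 := G.mul_assoc (G.inv x) x y (G.t_inv x) h
  have h2 : G.mul ⟨G.inv x, G.mul ⟨x, y, h⟩, (G.t_inv x).trans (G.s_mul ⟨x, y, h⟩).symm⟩ =
      G.inv x :=
    (G.mul_congr rfl (hxy.trans (congrArg G.one (G.t_inv x).symm)) _ (G.s_one _).symm).trans
      (G.mul_one (G.inv x))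
  refine Eq.trans ?_ (h1.trans h2)
  refine (G.one_mul y).symm.trans (G.mul_congr ?_ rfl _ _)
  rw [G.inv_mul, h]

theorem inv_inv (G : LieGroupoid s t) (x : X₁) : G.inv (G.inv x) = x :=
  (G.eq_inv_of_mul_eq_one (G.t_inv x) (by rw [G.inv_mul, G.s_inv])).symm

/-- Inversion maps source fibres onto target fibres. -/
theorem IsSConnected.isPreconnected_target {G : LieGroupoid s t} (hG : G.IsSConnected) (u : X₀) :
    IsPreconnected (t.toMap ⁻¹' {u}) := by
  have h : t.toMap ⁻¹' {u} = G.inv '' (s.toMap ⁻¹' {u}) := by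
    ext x
    refine ⟨fun hx => ⟨G.inv x, (G.s_inv x).trans hx, G.inv_inv x⟩, ?_⟩
    rintro ⟨y, hy, rfl⟩
    exact (G.t_inv y).trans hy
  rw [h]
  exact (hG u).isPreconnected.image _ G.inv.contMDiff.continuous.continuousOn

end LieGroupoid

end Groupoid

/-- With the next statement, this makes the interval and its square admissible domains for
`IsFlatPair.exists_lift_along`. -/
theorem unitInterval.contractibleSpace : ContractibleSpace unitInterval :=
  (convex_Icc (0 : ℝ) 1).contractibleSpace ⟨0, by simp⟩

theorem unitInterval.locallyPathConnectedSpace : LocallyPathConnectedSpace unitInterval :=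
  (convex_Icc (0 : ℝ) 1).locallyPathConnectedSpace

attribute [local instance] unitInterval.contractibleSpace unitInterval.locallyPathConnectedSpace

section Along

variable {ER E R X : Type*}
  [NormedAddCommGroup ER] [NormedSpace ℝ ER] [NormedAddCommGroup E] [NormedSpace ℝ E]
  [TopologicalSpace R] [ChartedSpace ER R] [IsManifold 𝓘(ℝ, ER) ∞ R]
  [TopologicalSpace X] [ChartedSpace E X]
  [MulAction Circle R] {P : PrincipalCircleBundle ER E R X}
  {E' M : Type*} [NormedAddCommGroup E'] [NormedSpace ℝ E'] [TopologicalSpace M]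
  [ChartedSpace E' M] [IsManifold 𝓘(ℝ, E') ∞ M]
  {F N : Type*} [NormedAddCommGroup F] [NormedSpace ℝ F] [TopologicalSpace N]
  [ChartedSpace F N] [IsManifold 𝓘(ℝ, F) ∞ N]
  {θ : DiffForm ER R 1} {f : M → X} {α : PreForm E' M 1} {w : PreForm E X 2}

/-- A horizontal lift of the pull-back along `g` is horizontal along `g`. -/
theorem IsFlatPair.isHorizontalAlong_of_comp (hθ : IsConnectionForm θ.toFun)
    (hcurv : extD θ.toFun = - pullback (E := ER) (E' := E) P.proj.toMap w)
    (hf : ContMDiff 𝓘(ℝ, E') 𝓘(ℝ, E) ∞ f) (hα : IsFlatPair w f α) {g : N → M}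
    (hg : ContMDiff 𝓘(ℝ, F) 𝓘(ℝ, E') ∞ g) {ψ : N → R}
    (hψ : IsHorizontalLift P θ.toFun (f ∘ g) (pullback (E := F) (E' := E') g α) ψ univ) :
    IsHorizontalAlong P θ.toFun f α g ψ := by
  intro n
  obtain ⟨U, φ, hU, hφ, hφn⟩ := hα.exists_local_lift hθ hcurv hf (g n) (hψ.proj n (mem_univ _))
  refine ⟨U, φ, hU, hφ, ?_⟩
  have h1 := hφ.comp (hφ.isOpen.preimage hg.continuous) hg.contMDiffOn (fun x hx => hx)
  filter_upwards [hψ.eventually_div_eq hθ h1 (mem_univ n) hU] with x hx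
  rw [hx, Function.comp_apply, hφn, P.div_self, one_smul]
  rfl

end Along

/-! ### The multiplication by parallel transport: independence of the path and smoothness. -/

section Multiplication

variable {E₀ E₁ ER X₀ X₁ R₁ : Type*}
  [NormedAddCommGroup E₀] [NormedSpace ℝ E₀] [FiniteDimensional ℝ E₀]
  [NormedAddCommGroup E₁] [NormedSpace ℝ E₁] [FiniteDimensional ℝ E₁]
  [NormedAddCommGroup ER] [NormedSpace ℝ ER] [FiniteDimensional ℝ ER]
  [TopologicalSpace X₀] [ChartedSpace E₀ X₀] [IsManifold 𝓘(ℝ, E₀) ∞ X₀]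
  [TopologicalSpace X₁] [ChartedSpace E₁ X₁] [IsManifold 𝓘(ℝ, E₁) ∞ X₁]
  [TopologicalSpace R₁] [ChartedSpace ER R₁] [IsManifold 𝓘(ℝ, ER) ∞ R₁] [MulAction Circle R₁]
  {s t : SurjSubmersion E₁ E₀ X₁ X₀}

/-- The hypotheses on an `s`-connected groupoid `G`, a cocycle `η + w`, a circle bundle with
connection `θ` of curvature `-w`, and a horizontal section `e` over the units. -/
structure ExtensionData (G : LieGroupoid s t) (P : PrincipalCircleBundle ER E₁ R₁ X₁)
    (θ : DiffForm ER R₁ 1) (η : DiffForm G.E₂ G.X₂ 1) (w : DiffForm E₁ X₁ 2)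
    (e : SmoothMap E₀ ER X₀ R₁) : Prop where
  connected : G.IsSConnected
  cocycle : G.IsDeRhamCocycle η w
  connection : IsConnectionForm θ.toFun
  curv : extD θ.toFun = - pullback (E := ER) (E' := E₁) P.proj.toMap w.toFun
  proj : ∀ u, P.proj.toMap (e u) = G.one u
  form : pullback (E := E₀) (E' := ER) e θ.toFun =
    pullback (E := E₀) (E' := G.E₂) G.one₂ η.toFun

variable {G : LieGroupoid s t} {P : PrincipalCircleBundle ER E₁ R₁ X₁}
  {θ : DiffForm ER R₁ 1} {η : DiffForm G.E₂ G.X₂ 1} {w : DiffForm E₁ X₁ 2}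
  {e : SmoothMap E₀ ER X₀ R₁}

namespace ExtensionData

theorem flat (D : ExtensionData G P θ η w e) :
    IsFlatPair w.toFun (mulBase G P) (mulForm G P θ η) := isFlatPair_mul D.cocycle D.curv

theorem isHorizontalAlong_rightUnit (D : ExtensionData G P θ η w e) :
    IsHorizontalAlong P θ.toFun (mulBase G P) (mulForm G P θ η) (pairRightUnit D.proj) id :=
  D.flat.isHorizontalAlong_of_comp D.connection D.curv (mulBase G P).contMDiff
    (pairRightUnit D.proj).contMDiff (isHorizontalLift_pairRightUnit D.proj D.cocycle.1 D.form)

theorem isHorizontalAlong_leftUnit (D : ExtensionData G P θ η w e) :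
    IsHorizontalAlong P θ.toFun (mulBase G P) (mulForm G P θ η) (pairLeftUnit D.proj) id :=
  D.flat.isHorizontalAlong_of_comp D.connection D.curv (mulBase G P).contMDiff
    (pairLeftUnit D.proj).contMDiff (isHorizontalLift_pairLeftUnit D.proj D.cocycle.1 D.form)

/-- `r` is the end point of the horizontal lift, starting at `p.left`, of a path from
`(p.left, 1)` to `p` with constant left component. -/
def IsTransport (D : ExtensionData G P θ η w e) (p : PairSpace s t P) (r : R₁) : Prop :=
  ∃ (H : Path (pairRightUnit D.proj p.left) p) (Ψ : unitInterval → R₁), (∀ τ, (H τ).left = p.left) ∧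
    IsHorizontalAlong P θ.toFun (mulBase G P) (mulForm G P θ η) H Ψ ∧ Ψ 0 = p.left ∧ Ψ 1 = r

variable (D : ExtensionData G P θ η w e)

/-- The right component moves from a unit to `p.right` above a single source fibre; this is where
connectedness of these fibres enters. -/
theorem exists_path (p : PairSpace s t P) :
    ∃ H : Path (pairRightUnit D.proj p.left) p, ∀ τ, (H τ).left = p.left := by
  have hs : s.toMap (P.proj.toMap (e (t.toMap (P.proj.toMap p.left)))) =
      t.toMap (P.proj.toMap p.left) := by rw [D.proj, G.s_one]
  obtain ⟨γ, hγ⟩ := P.joinedIn_fibre s (D.connected (t.toMap (P.proj.toMap p.left))).isPreconnected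
    hs p.condition.symm
  refine ⟨⟨⟨fun τ => ⟨p.left, γ τ, (hγ τ).symm⟩, ?_⟩, ?_, ?_⟩, fun τ => rfl⟩
  · exact FibProd.isInducing_pair.continuous_iff.2 (continuous_const.prodMk γ.continuous)
  · exact FibProd.ext rfl γ.source
  · exact FibProd.ext rfl γ.target

theorem exists_isTransport (p : PairSpace s t P) : ∃ r, D.IsTransport p r := by
  obtain ⟨H, hH⟩ := D.exists_path p
  obtain ⟨Ψ, h0, hΨ⟩ := D.flat.exists_lift_along D.connection D.curv (mulBase G P).contMDiff
    H.continuous 0 (r₀ := p.left) (by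
      rw [H.source]
      exact (D.isHorizontalAlong_rightUnit).proj p.left)
  exact ⟨Ψ 1, H, Ψ, hH, hΨ, h0, rfl⟩

/-- The end point of the transport can be computed by moving the left component instead. -/
theorem transport_eq {p : PairSpace s t P} {r : R₁} (h : D.IsTransport p r)
    {α : unitInterval → R₁} (hαc : Continuous α) (hα : ∀ τ, t.toMap (P.proj.toMap (α τ)) =
      s.toMap (P.proj.toMap p.right)) (h0 : α 0 = e (t.toMap (P.proj.toMap p.left)))
    (h1 : α 1 = p.left) {Λ : unitInterval → R₁}
    (hΛ : IsHorizontalAlong P θ.toFun (mulBase G P) (mulForm G P θ η)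
      (fun τ => (⟨α τ, p.right, hα τ⟩ : PairSpace s t P)) Λ) (hΛ0 : Λ 0 = p.right) : Λ 1 = r := by
  obtain ⟨H, Ψ, hH, hΨ, hΨ0, rfl⟩ := h
  have hc : ∀ τ τ', (t.comp P.proj).toMap (α τ) = (s.comp P.proj).toMap (H τ').right := by
    intro τ τ'
    refine (hα τ).trans ?_
    have h2 : (t.comp P.proj).toMap (H τ').left = (s.comp P.proj).toMap (H τ').right :=
      (H τ').condition
    rw [hH] at h2
    exact p.condition.symm.trans h2
  -- On the edge with second parameter 0 the square consists of right unit pairs, on the edge with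
  -- first parameter 0 of left unit pairs, so the lift `Φ` is known there: it is `α` and the right
  -- component of `H`. The far corner lies over `p` and is reached along `H` on one side and along
  -- the path of `Λ` on the other.
  let S : unitInterval × unitInterval → PairSpace s t P := fun q => ⟨α q.1, (H q.2).right, hc q.1 q.2⟩
  have hSc : Continuous S := FibProd.isInducing_pair.continuous_iff.2
    ((hαc.comp continuous_fst).prodMk
      ((FibProd.continuous_right.comp H.continuous).comp continuous_snd))
  have hS0 : ∀ τ, S (τ, 0) = pairRightUnit D.proj (α τ) := by
    intro τ
    refine FibProd.ext rfl ?_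
    change (H 0).right = e (t.toMap (P.proj.toMap (α τ)))
    rw [H.source, hα τ]
    exact congrArg e p.condition
  have h0S : ∀ τ, S (0, τ) = pairLeftUnit D.proj (H τ).right := by
    intro τ
    refine FibProd.ext ?_ rfl
    change α 0 = e (s.toMap (P.proj.toMap (H τ).right))
    rw [h0]
    refine congrArg e ?_
    have h2 : (t.comp P.proj).toMap (H τ).left = (s.comp P.proj).toMap (H τ).right :=
      (H τ).condition
    rw [hH] at h2
    exact h2
  obtain ⟨Φ, hΦ0, hΦ⟩ := D.flat.exists_lift_along D.connection D.curv (mulBase G P).contMDiff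
    hSc (0, 0) (r₀ := α 0) (by
      rw [hS0]
      exact (D.isHorizontalAlong_rightUnit).proj (α 0))
  have e1 : (fun τ => Φ (τ, 0)) = α := by
    have hk : Continuous (fun τ : unitInterval => (τ, (0 : unitInterval))) := by fun_prop
    have a1 := hΦ.comp hk
    have a2 := D.isHorizontalAlong_rightUnit.comp hαc
    have a3 : S ∘ (fun τ : unitInterval => (τ, (0 : unitInterval))) = pairRightUnit D.proj ∘ α := funext hS0
    rw [a3] at a1
    exact a1.unique D.connection ((pairRightUnit D.proj).contMDiff.continuous.comp hαc) a2
      (a₀ := 0) hΦ0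
  have hγ : Continuous (fun τ => (H τ).right) := FibProd.continuous_right.comp H.continuous
  have e2 : (fun τ => Φ (0, τ)) = fun τ => (H τ).right := by
    have hk : Continuous (fun τ : unitInterval => ((0 : unitInterval), τ)) := by fun_prop
    have a1 := hΦ.comp hk
    have a2 := D.isHorizontalAlong_leftUnit.comp hγ
    have a3 : S ∘ (fun τ : unitInterval => ((0 : unitInterval), τ)) = pairLeftUnit D.proj ∘ fun τ => (H τ).right :=
      funext h0S
    rw [a3] at a1
    refine a1.unique D.connection ((pairLeftUnit D.proj).contMDiff.continuous.comp hγ) a2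
      (a₀ := 0) (hΦ0.trans ?_)
    rw [h0, H.source]
    rfl
  have e3 : (fun τ => Φ (1, τ)) = Ψ := by
    have hk : Continuous (fun τ : unitInterval => ((1 : unitInterval), τ)) := by fun_prop
    have a1 := hΦ.comp hk
    have a3 : S ∘ (fun τ : unitInterval => ((1 : unitInterval), τ)) = H :=
      funext fun τ => FibProd.ext (h1.trans (hH τ).symm) rfl
    rw [a3] at a1
    refine a1.unique D.connection H.continuous hΨ (a₀ := 0) ?_
    rw [hΨ0, ← h1]
    exact congrFun e1 1
  have e4 : (fun τ => Φ (τ, 1)) = Λ := by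
    have hk : Continuous (fun τ : unitInterval => (τ, (1 : unitInterval))) := by fun_prop
    have a1 := hΦ.comp hk
    have hH1 : ∀ _ : unitInterval, (H 1).right = p.right := fun _ => by rw [H.target]
    have a3 : S ∘ (fun τ : unitInterval => (τ, (1 : unitInterval))) = fun τ => (⟨α τ, p.right, hα τ⟩ : PairSpace s t P) :=
      funext fun τ => FibProd.ext rfl (hH1 τ)
    have a4 := hSc.comp hk
    rw [a3] at a1 a4
    refine a1.unique D.connection a4 hΛ (a₀ := 0) ?_
    rw [hΛ0]
    refine (congrFun e2 1).trans (congrArg FibProd.right H.target)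
  rw [← e3, ← e4]

/-- A single path `α` of left components with its lift `Λ` serves all paths of right components: by
`transport_eq` every end point equals `Λ 1`. -/
theorem IsTransport.unique {p : PairSpace s t P} {r r' : R₁} (h : D.IsTransport p r)
    (h' : D.IsTransport p r') : r = r' := by
  have ht : t.toMap (P.proj.toMap (e (t.toMap (P.proj.toMap p.left)))) =
      s.toMap (P.proj.toMap p.right) := by rw [D.proj, G.t_one]; exact p.condition
  obtain ⟨α, hα⟩ := P.joinedIn_fibre t
    (D.connected.isPreconnected_target (s.toMap (P.proj.toMap p.right))) ht p.condition
  have hc : Continuous (fun τ => (⟨α τ, p.right, hα τ⟩ : PairSpace s t P)) :=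
    FibProd.isInducing_pair.continuous_iff.2 (α.continuous.prodMk continuous_const)
  obtain ⟨Λ, h0, hΛ⟩ := D.flat.exists_lift_along D.connection D.curv (mulBase G P).contMDiff
    hc 0 (r₀ := p.right) (by
      have h1 : (⟨α 0, p.right, hα 0⟩ : PairSpace s t P) = pairLeftUnit D.proj p.right := by
        refine FibProd.ext ?_ rfl
        exact α.source.trans (congrArg e p.condition)
      rw [h1]
      exact (D.isHorizontalAlong_leftUnit).proj p.right)
  rw [← D.transport_eq h α.continuous hα α.source α.target hΛ h0,
    ← D.transport_eq h' α.continuous hα α.source α.target hΛ h0]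

/-- Transport along a concatenation. -/
theorem IsTransport.extend {p p' : PairSpace s t P} {r : R₁} (h : D.IsTransport p r)
    (K : Path p p') (hK : ∀ τ, (K τ).left = p.left) {Ψ' : unitInterval → R₁}
    (hΨ' : IsHorizontalAlong P θ.toFun (mulBase G P) (mulForm G P θ η) K Ψ')
    (h0 : Ψ' 0 = r) : D.IsTransport p' (Ψ' 1) := by
  obtain ⟨H, Ψ, hH, hΨ, hΨ0, rfl⟩ := h
  have hl : p.left = p'.left := by rw [← hK 1, K.target]
  have hu : pairRightUnit D.proj p'.left = pairRightUnit D.proj p.left := by rw [hl]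
  obtain ⟨Λ, hΛ0, hΛ⟩ := D.flat.exists_lift_along D.connection D.curv (mulBase G P).contMDiff
    (H.trans K).continuous 0 (r₀ := p.left) (by
      rw [Path.source]
      exact (D.isHorizontalAlong_rightUnit).proj p.left)
  -- Restricted to the two halves of the parameter interval, the lift of the concatenation is
  -- determined by its starting values.
  let k₁ : unitInterval → unitInterval := fun τ => ⟨τ / 2, by constructor <;> linarith [τ.2.1, τ.2.2]⟩
  let k₂ : unitInterval → unitInterval := fun τ => ⟨(1 + τ) / 2, by constructor <;> linarith [τ.2.1, τ.2.2]⟩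
  have hk₁ : Continuous k₁ := by fun_prop
  have hk₂ : Continuous k₂ := by fun_prop
  have g1 : (H.trans K) ∘ k₁ = H := by
    funext τ
    have : (τ : ℝ) / 2 ≤ 1 / 2 := by linarith [τ.2.2]
    simp only [Function.comp_apply, Path.trans_apply, k₁, dif_pos this]
    congr 1
    exact Subtype.ext (by simp; ring)
  have g2 : (H.trans K) ∘ k₂ = K := by
    funext τ
    simp only [Function.comp_apply, Path.trans_apply, k₂]
    split_ifs with hτ
    · have : (τ : ℝ) = 0 := by linarith [τ.2.1]
      have h3 : τ = 0 := Subtype.ext this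
      subst h3
      rw [K.source]
      refine Eq.trans (congrArg H ?_) H.target
      exact Subtype.ext (by simp)
    · congr 1
      exact Subtype.ext (by simp; ring)
  have e1 : Λ ∘ k₁ = Ψ := by
    have a := hΛ.comp hk₁
    rw [g1] at a
    refine a.unique D.connection H.continuous hΨ (a₀ := 0) ?_
    rw [hΨ0, ← hΛ0]
    exact congrArg Λ (Subtype.ext (by simp [k₁]))
  have e2 : Λ ∘ k₂ = Ψ' := by
    have a := hΛ.comp hk₂
    rw [g2] at a
    refine a.unique D.connection K.continuous hΨ' (a₀ := 0) ?_
    rw [h0, ← e1]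
    exact congrArg Λ (Subtype.ext (by simp [k₁, k₂]))
  refine ⟨(H.trans K).cast hu rfl, Λ, fun τ => ?_, hΛ, hΛ0.trans hl, ?_⟩
  · refine Eq.trans ?_ hl
    change ((H.trans K) τ).left = p.left
    rw [Path.trans_apply]
    split_ifs
    · exact hH _
    · exact hK _
  · rw [← e2]
    exact congrArg Λ (Subtype.ext (by simp [k₂]))

/-- The multiplication. -/
noncomputable def mulFun (p : PairSpace s t P) : R₁ := (D.exists_isTransport p).choose

theorem isTransport_mulFun (p : PairSpace s t P) : D.IsTransport p (D.mulFun p) :=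
  (D.exists_isTransport p).choose_spec

theorem IsTransport.eq_mulFun {p : PairSpace s t P} {r : R₁} (h : D.IsTransport p r) :
    D.mulFun p = r := (D.isTransport_mulFun p).unique D h

theorem proj_mulFun (p : PairSpace s t P) : P.proj.toMap (D.mulFun p) = mulBase G P p := by
  obtain ⟨H, Ψ, hH, hΨ, hΨ0, h1⟩ := D.isTransport_mulFun p
  rw [← h1, hΨ.proj, H.target]

theorem mulFun_rightUnit (r : R₁) : D.mulFun (pairRightUnit D.proj r) = r := by
  -- The constant path at a unit pair is an admissible transport.
  refine IsTransport.eq_mulFun D ⟨Path.refl _, fun _ => r, fun τ => rfl, ?_, rfl, rfl⟩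
  exact D.isHorizontalAlong_rightUnit.comp (continuous_const (y := r))

/-- Along a box, the multiplication is a constant multiple of a horizontal lift on every slice. -/
theorem mulFun_eq_of_joinedIn {φ : PairSpace s t P → R₁} {V : Set (PairSpace s t P)}
    (hφ : IsHorizontalLift P θ.toFun (mulBase G P) (mulForm G P θ η) φ V) {x y : PairSpace s t P}
    (hxy : JoinedIn {q | q ∈ V ∧ q.left = x.left} x y) :
    P.div (D.mulFun y) (φ y) = P.div (D.mulFun x) (φ x) := by
  obtain ⟨K, hK⟩ := hxy
  have h1 : IsHorizontalAlong P θ.toFun (mulBase G P) (mulForm G P θ η) K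
      (fun τ => P.div (D.mulFun x) (φ x) • φ (K τ)) := fun τ =>
    ⟨V, _, (hK τ).1, hφ.const_smul D.connection _, Filter.Eventually.of_forall fun _ => rfl⟩
  have hxV : x ∈ V := by have := (hK 0).1; rwa [K.source] at this
  have h2 := IsTransport.eq_mulFun D ((D.isTransport_mulFun x).extend D K (fun τ => (hK τ).2) h1 (by
    rw [K.source]
    exact P.div_smul ((D.proj_mulFun x).trans (hφ.proj x hxV).symm)))
  rw [K.target] at h2
  exact P.div_eq h2

/-- The multiplication agrees with a horizontal lift near `p`. -/
def IsGood (p : PairSpace s t P) : Prop := ∃ (U : Set (PairSpace s t P))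
  (φ : PairSpace s t P → R₁), p ∈ U ∧
    IsHorizontalLift P θ.toFun (mulBase G P) (mulForm G P θ η) φ U ∧
    ∀ᶠ q in 𝓝 p, D.mulFun q = φ q

theorem isGood_of_eventually {φ : PairSpace s t P → R₁} {V : Set (PairSpace s t P)}
    (hφ : IsHorizontalLift P θ.toFun (mulBase G P) (mulForm G P θ η) φ V) {p : PairSpace s t P}
    (hp : p ∈ V) {z : Circle} (hz : ∀ᶠ q in 𝓝 p, P.div (D.mulFun q) (φ q) = z) : D.IsGood p := by
  refine ⟨V, fun q => z • φ q, hp, hφ.const_smul D.connection z, ?_⟩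
  filter_upwards [hz, hφ.isOpen.mem_nhds hp] with q hq hqV
  rw [← hq, P.div_smul ((D.proj_mulFun q).trans (hφ.proj q hqV).symm)]

theorem exists_local_lift_mul (D : ExtensionData G P θ η w e) (p : PairSpace s t P) : ∃ (U : Set (PairSpace s t P))
    (φ : PairSpace s t P → R₁), p ∈ U ∧
      IsHorizontalLift P θ.toFun (mulBase G P) (mulForm G P θ η) φ U := by
  obtain ⟨U, φ, hp, hφ, -⟩ := D.flat.exists_local_lift D.connection D.curv
    (mulBase G P).contMDiff p (D.proj_mulFun p)
  exact ⟨U, φ, hp, hφ⟩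

/-- On unit pairs the multiplication is the left component, which is horizontal and hence a locally
constant multiple of `φ`. In a box each point is joined within its slice to a unit pair, and the
factor does not change along slices. -/
theorem isGood_rightUnit (r : R₁) : D.IsGood (pairRightUnit D.proj r) := by
  obtain ⟨U, φ, hp, hφ⟩ := D.exists_local_lift_mul (pairRightUnit D.proj r)
  obtain ⟨V, T, hV, hpV, hVU, hT, -⟩ := FibProd.exists_box _ (hφ.isOpen.mem_nhds hp)
  have hφV := hφ.mono hV hVU
  have hj := (pairRightUnit D.proj).contMDiff.continuous
  have h1 := hφV.comp (hV.preimage hj) (pairRightUnit D.proj).contMDiff.contMDiffOn (fun x hx => hx)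
  have h2 := (isHorizontalLift_pairRightUnit D.proj D.cocycle.1 D.form).eventually_div_eq
    D.connection h1 (mem_univ r) hpV
  have h3 : ContinuousAt (fun q : PairSpace s t P => q.left) (pairRightUnit D.proj r) :=
    FibProd.continuous_left.continuousAt
  refine D.isGood_of_eventually hφV hpV (z := P.div r (φ (pairRightUnit D.proj r))) ?_
  filter_upwards [h3.eventually h2, h3.eventually (hj.continuousAt.eventually (hV.mem_nhds hpV)),
    hV.mem_nhds hpV] with q hq hqj hqV
  obtain ⟨-, -, hT1, hT2⟩ := hT _ hqj q hqV
  rw [hT1 rfl] at hT2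
  rw [D.mulFun_eq_of_joinedIn hφV hT2, D.mulFun_rightUnit]
  exact P.div_eq hq

/-- Points of a small slice are simultaneously good. -/
theorem eventually_isGood_iff (p : PairSpace s t P) :
    ∀ᶠ q in 𝓝 p, q.left = p.left → (D.IsGood q ↔ D.IsGood p) := by
  obtain ⟨U, φ, hp, hφ⟩ := D.exists_local_lift_mul p
  obtain ⟨V, T, hV, hpV, hVU, hT, hTc⟩ := FibProd.exists_box _ (hφ.isOpen.mem_nhds hp)
  have hφV := hφ.mono hV hVU
  -- For `q` near `y` the point `T q x` lies near `x` and in the slice of `q`. The factor, constant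
  -- near `x`, is therefore the same constant near `y`.
  have key : ∀ x ∈ V, ∀ y ∈ V, y.left = x.left → D.IsGood x → D.IsGood y := by
    rintro x hx y hy hxy ⟨U', φ', hxU', hφ', hxφ'⟩
    have h1 := hφ'.eventually_div_eq D.connection hφV hxU' hx
    have h2 : ContinuousAt (fun q => T q x) y := (hTc x hx).continuousAt (hV.mem_nhds hy)
    have h3 : T y x = x := (hT y hy x hx).2.2.1 hxy
    rw [ContinuousAt, h3] at h2
    refine D.isGood_of_eventually hφV hy (z := P.div (φ' x) (φ x)) ?_
    filter_upwards [h2.eventually h1, h2.eventually hxφ', hV.mem_nhds hy] with q hq1 hq2 hqV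
    rw [← D.mulFun_eq_of_joinedIn hφV (hT q hqV x hx).2.2.2, hq2]
    exact P.div_eq hq1
  filter_upwards [hV.mem_nhds hpV] with q hq hqp
  exact ⟨key q hq p hpV hqp.symm, key p hpV q hq hqp⟩

/-- Along a path in the slice from a unit pair to `p` goodness is locally constant, and it holds at
the start. -/
theorem isGood (p : PairSpace s t P) : D.IsGood p := by
  obtain ⟨H, hH⟩ := D.exists_path p
  have hc : IsLocallyConstant (fun τ => D.IsGood (H τ)) := by
    rw [IsLocallyConstant.iff_eventually_eq]
    intro τ
    filter_upwards [H.continuous.continuousAt.eventually (D.eventually_isGood_iff (H τ))] with τ' h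
    exact propext (h ((hH τ').trans (hH τ).symm))
  have h1 := hc.apply_eq_of_preconnectedSpace 1 0
  simp only [H.source, H.target] at h1
  rw [h1]
  exact D.isGood_rightUnit p.left

theorem isHorizontalLift_mulFun :
    IsHorizontalLift P θ.toFun (mulBase G P) (mulForm G P θ η) D.mulFun univ :=
  IsHorizontalAlong.isHorizontalLift D.isGood

/-- Along a path of left unit pairs from (1, 1) to (1, r) both the multiplication and the right
component are horizontal. They agree at (1, 1), which is also a right unit pair. -/
theorem mulFun_leftUnit (r : R₁) : D.mulFun (pairLeftUnit D.proj r) = r := by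
  have hs : s.toMap (P.proj.toMap (e (s.toMap (P.proj.toMap r)))) = s.toMap (P.proj.toMap r) := by
    rw [D.proj, G.s_one]
  obtain ⟨γ, hγ⟩ := P.joinedIn_fibre s (D.connected (s.toMap (P.proj.toMap r))).isPreconnected hs rfl
  have h1 := D.isHorizontalAlong_leftUnit.comp γ.continuous
  have h2 := D.isHorizontalLift_mulFun.isHorizontalAlong (pairLeftUnit D.proj ∘ γ)
  have h3 := h2.unique D.connection ((pairLeftUnit D.proj).contMDiff.continuous.comp γ.continuous)
    h1 (a₀ := 0) (by
      simp only [Function.comp_apply, γ.source, id]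
      have h4 : pairLeftUnit D.proj (e (s.toMap (P.proj.toMap r))) =
          pairRightUnit D.proj (e (s.toMap (P.proj.toMap r))) := by
        refine FibProd.ext ?_ ?_
        · exact congrArg e hs
        · refine congrArg e ?_
          change _ = t.toMap (P.proj.toMap (e _))
          rw [D.proj, G.t_one]
      rw [h4, D.mulFun_rightUnit])
  have h5 := congrFun h3 1
  simpa only [Function.comp_apply, γ.target, id] using h5

end ExtensionData

end Multiplication

/-! ### Rigidity of horizontal lifts, and smooth maps into fibre products. -/

section Rigidity

variable {ER E R X : Type*}
  [NormedAddCommGroup ER] [NormedSpace ℝ ER] [NormedAddCommGroup E] [NormedSpace ℝ E]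
  [TopologicalSpace R] [ChartedSpace ER R]
  [TopologicalSpace X] [ChartedSpace E X]
  [MulAction Circle R] {P : PrincipalCircleBundle ER E R X}
  {E' M : Type*} [NormedAddCommGroup E'] [NormedSpace ℝ E'] [TopologicalSpace M]
  [ChartedSpace E' M] [IsManifold 𝓘(ℝ, E') ∞ M]
  {θ : DiffForm ER R 1} {f : M → X} {α : PreForm E' M 1}

/-- Horizontal lifts that agree at a point agree on its path component. -/
theorem IsHorizontalLift.eq_of_joined (hθ : IsConnectionForm θ.toFun) {φ ψ : M → R}
    (hφ : IsHorizontalLift P θ.toFun f α φ univ) (hψ : IsHorizontalLift P θ.toFun f α ψ univ)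
    {x y : M} (hxy : Joined x y) (hx : φ x = ψ x) : φ y = ψ y := by
  obtain ⟨H⟩ := hxy
  have h := (hφ.isHorizontalAlong H).unique hθ H.continuous (hψ.isHorizontalAlong H) (a₀ := 0)
    (by simpa only [Function.comp_apply, H.source] using hx)
  simpa only [Function.comp_apply, H.target] using congrFun h 1

end Rigidity

section SmoothIntoFibProd

variable {EM EN EB M N B : Type*}
  [NormedAddCommGroup EM] [NormedSpace ℝ EM]
  [NormedAddCommGroup EN] [NormedSpace ℝ EN] [FiniteDimensional ℝ EN]
  [NormedAddCommGroup EB] [NormedSpace ℝ EB] [FiniteDimensional ℝ EB]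
  [TopologicalSpace M] [ChartedSpace EM M] [IsManifold 𝓘(ℝ, EM) ∞ M]
  [TopologicalSpace N] [ChartedSpace EN N] [IsManifold 𝓘(ℝ, EN) ∞ N]
  [TopologicalSpace B] [ChartedSpace EB B] [IsManifold 𝓘(ℝ, EB) ∞ B]
  {f : SmoothMap EM EB M B} {g : SurjSubmersion EN EB N B}

theorem FibProd.contMDiffOn_of_components {E' M' : Type*} [NormedAddCommGroup E']
    [NormedSpace ℝ E'] [TopologicalSpace M'] [ChartedSpace E' M'] {h : M' → FibProd f g}
    {U : Set M'} (hU : IsOpen U)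
    (h1 : ContMDiffOn 𝓘(ℝ, E') 𝓘(ℝ, EM) ∞ (fun x => (h x).left) U)
    (h2 : ContMDiffOn 𝓘(ℝ, E') 𝓘(ℝ, EN) ∞ (fun x => (h x).right) U) :
    ContMDiffOn 𝓘(ℝ, E') 𝓘(ℝ, FibModel EM EN EB) ∞ h U := by
  have hcont : ContinuousOn h U :=
    isInducing_pair.continuousOn_iff.2 (h1.continuousOn.prodMk h2.continuousOn)
  intro x hx
  refine ContMDiffAt.contMDiffWithinAt ?_
  rw [contMDiffAt_iff_target]
  refine ⟨hcont.continuousAt (hU.mem_nhds hx), ?_⟩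
  have hS := hcont.isOpen_inter_preimage hU (exists_chart (h x)).choose.open_source
  have := contMDiffOn_chart_comp (h x) (h := h) (I' := 𝓘(ℝ, E'))
    (S := U ∩ h ⁻¹' (exists_chart (h x)).choose.source)
    (fun _ hx => hx.2) (h1.mono inter_subset_left) (h2.mono inter_subset_left)
  exact this.contMDiffAt (hS.mem_nhds ⟨hx, (exists_chart (h x)).choose_spec.1⟩)

end SmoothIntoFibProd

/-! ### The axioms of the central extension and its uniqueness. -/

section Extension

variable {E₀ E₁ ER X₀ X₁ R₁ : Type*}
  [NormedAddCommGroup E₀] [NormedSpace ℝ E₀] [FiniteDimensional ℝ E₀]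
  [NormedAddCommGroup E₁] [NormedSpace ℝ E₁] [FiniteDimensional ℝ E₁]
  [NormedAddCommGroup ER] [NormedSpace ℝ ER] [FiniteDimensional ℝ ER]
  [TopologicalSpace X₀] [ChartedSpace E₀ X₀] [IsManifold 𝓘(ℝ, E₀) ∞ X₀]
  [TopologicalSpace X₁] [ChartedSpace E₁ X₁] [IsManifold 𝓘(ℝ, E₁) ∞ X₁]
  [TopologicalSpace R₁] [ChartedSpace ER R₁] [IsManifold 𝓘(ℝ, ER) ∞ R₁] [MulAction Circle R₁]
  {s t : SurjSubmersion E₁ E₀ X₁ X₀}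
  {G : LieGroupoid s t} {P : PrincipalCircleBundle ER E₁ R₁ X₁}
  {θ : DiffForm ER R₁ 1} {η : DiffForm G.E₂ G.X₂ 1} {w : DiffForm E₁ X₁ 2}
  {e : SmoothMap E₀ ER X₀ R₁}

namespace ExtensionData

variable (D : ExtensionData G P θ η w e)

theorem joined_rightUnit (p : PairSpace s t P) : Joined (pairRightUnit D.proj p.left) p :=
  ⟨(D.exists_path p).choose⟩

theorem joined_leftUnit (p : PairSpace s t P) : Joined (pairLeftUnit D.proj p.right) p := by
  have ht : t.toMap (P.proj.toMap (e (s.toMap (P.proj.toMap p.right)))) =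
      s.toMap (P.proj.toMap p.right) := by rw [D.proj, G.t_one]
  obtain ⟨γ, hγ⟩ := P.joinedIn_fibre t
    (D.connected.isPreconnected_target (s.toMap (P.proj.toMap p.right))) ht p.condition
  refine ⟨⟨⟨fun τ => ⟨γ τ, p.right, hγ τ⟩, ?_⟩, ?_, ?_⟩⟩
  · exact FibProd.isInducing_pair.continuous_iff.2 (γ.continuous.prodMk continuous_const)
  · exact FibProd.ext γ.source rfl
  · exact FibProd.ext γ.target rfl

/-- The multiplication as a smooth map. -/
noncomputable def mul : SmoothMap (FibModel ER ER E₀) ER (PairSpace s t P) R₁ :=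
  ⟨D.mulFun, contMDiffOn_univ.1 D.isHorizontalLift_mulFun.smooth⟩

theorem isHorizontalLift_mul :
    IsHorizontalLift P θ.toFun (mulBase G P) (mulForm G P θ η) D.mul univ :=
  D.isHorizontalLift_mulFun

/-- The map `(x, y) ↦ (a x, b y)`. -/
noncomputable def pairSmul (P : PrincipalCircleBundle ER E₁ R₁ X₁) (a b : Circle) :
    SmoothMap (FibModel ER ER E₀) (FibModel ER ER E₀) (PairSpace s t P) (PairSpace s t P) :=
  FibProd.lift
    ⟨fun p => a • p.left, fun p => P.contMDiffAt_smul contMDiffAt_const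
      (FibProd.fst (t.comp P.proj).toMap (s.comp P.proj)).contMDiff.contMDiffAt⟩
    ⟨fun p => b • p.right, fun p => P.contMDiffAt_smul contMDiffAt_const
      (FibProd.snd (t.comp P.proj).toMap (s.comp P.proj)).contMDiff.contMDiffAt⟩
    (fun p => by
      change t.toMap (P.proj.toMap (a • p.left)) = s.toMap (P.proj.toMap (b • p.right))
      rw [P.proj_smul, P.proj_smul]; exact p.condition)

theorem pairProj_comp_pairSmul (a b : Circle) :
    (pairProj s t P).comp (pairSmul P a b) = pairProj s t P :=
  ContMDiffMap.ext fun p => FibProd.ext (P.proj_smul a p.left) (P.proj_smul b p.right)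

/-- Translating by circle elements does not move the base pair and, `θ` being invariant, does not
change `mulForm`. -/
theorem isHorizontalLift_mul_smul (a b c : Circle) :
    IsHorizontalLift P θ.toFun (mulBase G P) (mulForm G P θ η)
      (fun p => c • D.mul (pairSmul P a b p)) univ := by
  have h1 := (D.isHorizontalLift_mul.comp isOpen_univ (pairSmul P a b).contMDiff.contMDiffOn
    (mapsTo_univ _ _)).const_smul D.connection c
  have h2 : mulBase G P ∘ pairSmul P a b = mulBase G P := by
    change ⇑(G.mul.comp ((pairProj s t P).comp (pairSmul P a b))) = _
    rw [pairProj_comp_pairSmul]; rfl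
  have h3 : pullback (E := FibModel ER ER E₀) (E' := FibModel ER ER E₀) (pairSmul P a b)
      (mulForm G P θ η) = mulForm G P θ η := by
    rw [pullback_mulForm, pairProj_comp_pairSmul]
    have e1 : pullback (E := FibModel ER ER E₀) (E' := ER)
        (fun p : PairSpace s t P => (pairSmul P a b p).left) θ.toFun =
        pullback (E := FibModel ER ER E₀) (E' := ER)
          (FibProd.fst (t.comp P.proj).toMap (s.comp P.proj)) θ.toFun :=
      funext fun p => P.pullback_const_smul D.connection a
        ((FibProd.fst (t.comp P.proj).toMap (s.comp P.proj)).contMDiff.mdifferentiableAt (by simp))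
    have e2 : pullback (E := FibModel ER ER E₀) (E' := ER)
        (fun p : PairSpace s t P => (pairSmul P a b p).right) θ.toFun =
        pullback (E := FibModel ER ER E₀) (E' := ER)
          (FibProd.snd (t.comp P.proj).toMap (s.comp P.proj)) θ.toFun :=
      funext fun p => P.pullback_const_smul D.connection b
        ((FibProd.snd (t.comp P.proj).toMap (s.comp P.proj)).contMDiff.mdifferentiableAt (by simp))
    rw [e1, e2]
    rfl
  rw [h2, h3] at h1
  exact h1

/-- After division by `a` both sides are lifts of the same data, and they are compared at the pair
(x, 1). -/
theorem mul_smul_left (a : Circle) (p : PairSpace s t P) :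
    D.mul (pairSmul P a 1 p) = a • D.mul p := by
  have h := (D.isHorizontalLift_mul_smul a 1 a⁻¹).eq_of_joined D.connection D.isHorizontalLift_mul
    (D.joined_rightUnit p) (by
      have h1 : pairSmul P a 1 (pairRightUnit D.proj p.left) = pairRightUnit D.proj (a • p.left) := by
        refine FibProd.ext rfl ?_
        change (1 : Circle) • e (t.toMap (P.proj.toMap p.left)) =
          e (t.toMap (P.proj.toMap (a • p.left)))
        rw [one_smul, P.proj_smul]
      have h2 := D.mulFun_rightUnit (a • p.left)
      have h3 := D.mulFun_rightUnit p.left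
      change a⁻¹ • D.mulFun _ = D.mulFun _
      rw [h1, h2, h3, inv_smul_smul])
  rw [← h, smul_inv_smul]

/-- As before, but compared at (1, y), where the left unit law is available. -/
theorem mul_smul_right (b : Circle) (p : PairSpace s t P) :
    D.mul (pairSmul P 1 b p) = b • D.mul p := by
  have h := (D.isHorizontalLift_mul_smul 1 b b⁻¹).eq_of_joined D.connection D.isHorizontalLift_mul
    (D.joined_leftUnit p) (by
      have h1 : pairSmul P 1 b (pairLeftUnit D.proj p.right) = pairLeftUnit D.proj (b • p.right) := by
        refine FibProd.ext ?_ rfl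
        change (1 : Circle) • e (s.toMap (P.proj.toMap p.right)) =
          e (s.toMap (P.proj.toMap (b • p.right)))
        rw [one_smul, P.proj_smul]
      have h2 := D.mulFun_leftUnit (b • p.right)
      have h3 := D.mulFun_leftUnit p.right
      change b⁻¹ • D.mulFun _ = D.mulFun _
      rw [h1, h2, h3, inv_smul_smul])
  rw [← h, smul_inv_smul]

theorem mul_pairSmul (a b : Circle) (p : PairSpace s t P) :
    D.mul (pairSmul P a b p) = (a * b) • D.mul p := by
  have h : pairSmul P a b p = pairSmul P a 1 (pairSmul P 1 b p) := by
    refine FibProd.ext ?_ ?_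
    · exact (congrArg (a • ·) (one_smul Circle p.left)).symm
    · exact (one_smul Circle (b • p.right)).symm
  rw [h, mul_smul_left, mul_smul_right, mul_smul]

theorem s_mul (p : PairSpace s t P) :
    (s.comp P.proj).toMap (D.mul p) = (s.comp P.proj).toMap p.left := by
  change s.toMap (P.proj.toMap (D.mulFun p)) = _
  rw [D.proj_mulFun]
  exact G.s_mul _

theorem t_mul (p : PairSpace s t P) :
    (t.comp P.proj).toMap (D.mul p) = (t.comp P.proj).toMap p.right := by
  change t.toMap (P.proj.toMap (D.mulFun p)) = _
  rw [D.proj_mulFun]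
  exact G.t_mul _

/-- The manifold of triples in `R₁` over composable triples. -/
abbrev TripleSpace (s t : SurjSubmersion E₁ E₀ X₁ X₀) (P : PrincipalCircleBundle ER E₁ R₁ X₁) :=
  FibProd ((t.comp P.proj).toMap.comp (FibProd.snd (t.comp P.proj).toMap (s.comp P.proj)))
    (s.comp P.proj)

/-- `(x, y, z) ↦ (x, y)`. -/
noncomputable def triple₁₂ (s t : SurjSubmersion E₁ E₀ X₁ X₀)
    (P : PrincipalCircleBundle ER E₁ R₁ X₁) :
    SmoothMap (FibModel (FibModel ER ER E₀) ER E₀) (FibModel ER ER E₀) (TripleSpace s t P)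
      (PairSpace s t P) := FibProd.fst _ _

/-- `(x, y, z) ↦ z`. -/
noncomputable def triple₃ (s t : SurjSubmersion E₁ E₀ X₁ X₀)
    (P : PrincipalCircleBundle ER E₁ R₁ X₁) :
    SmoothMap (FibModel (FibModel ER ER E₀) ER E₀) ER (TripleSpace s t P) R₁ := FibProd.snd _ _

/-- `(x, y, z) ↦ (y, z)`. -/
noncomputable def triple₂₃ (s t : SurjSubmersion E₁ E₀ X₁ X₀)
    (P : PrincipalCircleBundle ER E₁ R₁ X₁) :
    SmoothMap (FibModel (FibModel ER ER E₀) ER E₀) (FibModel ER ER E₀) (TripleSpace s t P)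
      (PairSpace s t P) :=
  FibProd.lift ((FibProd.snd _ _).comp (triple₁₂ s t P)) (triple₃ s t P) (fun p => p.condition)

/-- `(x, y, z) ↦ (xy, z)`. -/
noncomputable def mulLeft :
    SmoothMap (FibModel (FibModel ER ER E₀) ER E₀) (FibModel ER ER E₀) (TripleSpace s t P)
      (PairSpace s t P) :=
  FibProd.lift (D.mul.comp (triple₁₂ s t P)) (triple₃ s t P)
    (fun p => (D.t_mul p.left).trans p.condition)

/-- `(x, y, z) ↦ (x, yz)`. -/
noncomputable def mulRight :
    SmoothMap (FibModel (FibModel ER ER E₀) ER E₀) (FibModel ER ER E₀) (TripleSpace s t P)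
      (PairSpace s t P) :=
  FibProd.lift ((FibProd.fst _ _).comp (triple₁₂ s t P)) (D.mul.comp (triple₂₃ s t P))
    (fun p => p.left.condition.trans (D.s_mul (triple₂₃ s t P p)).symm)

/-- The projection to composable triples. -/
noncomputable def tripleProj (G : LieGroupoid s t) (P : PrincipalCircleBundle ER E₁ R₁ X₁) :
    SmoothMap (FibModel (FibModel ER ER E₀) ER E₀) G.E₃ (TripleSpace s t P) G.X₃ :=
  FibProd.lift ((pairProj s t P).comp (triple₁₂ s t P)) (P.proj.toMap.comp (triple₃ s t P))
    (fun p => p.condition)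

theorem pullback_mul : pullback (E := FibModel ER ER E₀) (E' := ER) D.mul θ.toFun =
    mulForm G P θ η := funext fun p => D.isHorizontalLift_mul.form p (mem_univ _)

theorem pairProj_comp_mulLeft :
    (pairProj s t P).comp D.mulLeft = G.mul₁₂.comp (tripleProj G P) :=
  ContMDiffMap.ext fun p => FibProd.ext (D.proj_mulFun p.left) rfl

theorem pairProj_comp_mulRight :
    (pairProj s t P).comp D.mulRight = G.mul₂₃.comp (tripleProj G P) :=
  ContMDiffMap.ext fun p => FibProd.ext rfl (D.proj_mulFun (triple₂₃ s t P p))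

/-- Since multiplication pulls `θ` back to `mulForm`, both sides expand into the three copies of `θ`
and values of `η` on faces; their difference is the pull-back of ∂η. -/
theorem pullback_mulLeft_eq :
    pullback (E := FibModel (FibModel ER ER E₀) ER E₀) (E' := FibModel ER ER E₀) D.mulLeft
      (mulForm G P θ η) =
    pullback (E := FibModel (FibModel ER ER E₀) ER E₀) (E' := FibModel ER ER E₀) D.mulRight
      (mulForm G P θ η) := by
  have e1 : pullback (E := FibModel (FibModel ER ER E₀) ER E₀) (E' := ER)
      (fun p => (D.mulLeft p).left) θ.toFun =
      pullback (E := FibModel (FibModel ER ER E₀) ER E₀) (E' := FibModel ER ER E₀)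
        (triple₁₂ s t P) (mulForm G P θ η) := by
    rw [← D.pullback_mul, ← pullback_smoothMap_comp]; rfl
  have e2 : pullback (E := FibModel (FibModel ER ER E₀) ER E₀) (E' := ER)
      (fun p => (D.mulRight p).right) θ.toFun =
      pullback (E := FibModel (FibModel ER ER E₀) ER E₀) (E' := FibModel ER ER E₀)
        (triple₂₃ s t P) (mulForm G P θ η) := by
    rw [← D.pullback_mul, ← pullback_smoothMap_comp]; rfl
  have e3 : (pairProj s t P).comp (triple₁₂ s t P) = G.pr₁₂.comp (tripleProj G P) := rfl
  have e4 : (pairProj s t P).comp (triple₂₃ s t P) = G.pr₂₃.comp (tripleProj G P) := rfl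
  have h : pullback (E := FibModel (FibModel ER ER E₀) ER E₀) (E' := G.E₃) (tripleProj G P)
      (G.bdry₂ η.toFun) = 0 := by rw [D.cocycle.1]; rfl
  have h' : pullback (E := FibModel (FibModel ER ER E₀) ER E₀) (E' := G.E₃) (tripleProj G P)
      (G.bdry₂ η.toFun) =
      pullback (E := FibModel (FibModel ER ER E₀) ER E₀) (E' := G.E₂)
        (G.pr₂₃.comp (tripleProj G P)) η.toFun -
      pullback (E := FibModel (FibModel ER ER E₀) ER E₀) (E' := G.E₂)
        (G.mul₁₂.comp (tripleProj G P)) η.toFun +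
      pullback (E := FibModel (FibModel ER ER E₀) ER E₀) (E' := G.E₂)
        (G.mul₂₃.comp (tripleProj G P)) η.toFun -
      pullback (E := FibModel (FibModel ER ER E₀) ER E₀) (E' := G.E₂)
        (G.pr₁₂.comp (tripleProj G P)) η.toFun := by
    simp only [pullback_smoothMap_comp]
    rfl
  rw [h] at h'
  rw [pullback_mulForm, pullback_mulForm, e1, e2, pullback_mulForm, pullback_mulForm,
    pairProj_comp_mulLeft, pairProj_comp_mulRight, e3, e4]
  -- Here `a`, `b`, `c` stand for `θ` on the three factors and `x`, `y`, `z`, `u` for `η` on the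
  -- faces (y, z), (xy, z), (x, yz), (x, y).
  have hr : ∀ {A : Type _} [AddCommGroup A] (a b c x y z u : A), 0 = x - y + z - u →
      a + b - u + c - y = a + (b + c - x) - z := by
    intro A _ a b c x y z u h
    have h2 : x = y - z + u := by
      have := eq_add_of_sub_eq h.symm
      rw [zero_add] at this
      rw [← this]; abel
    rw [h2]; abel
  exact hr _ _ _ _ _ _ _ h'

/-- Both bracketings are horizontal lifts of the same data over triples. Moving the third factor
within its source fibre to a unit reduces the claim to the right unit law. -/
theorem mul_mulLeft (p : TripleSpace s t P) : D.mul (D.mulLeft p) = D.mul (D.mulRight p) := by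
  have h1 := D.isHorizontalLift_mul.comp isOpen_univ D.mulLeft.contMDiff.contMDiffOn
    (mapsTo_univ _ _)
  have h2 := D.isHorizontalLift_mul.comp isOpen_univ D.mulRight.contMDiff.contMDiffOn
    (mapsTo_univ _ _)
  have hb : mulBase G P ∘ D.mulLeft = mulBase G P ∘ D.mulRight := by
    change ⇑(G.mul.comp ((pairProj s t P).comp D.mulLeft)) =
      ⇑(G.mul.comp ((pairProj s t P).comp D.mulRight))
    rw [pairProj_comp_mulLeft, pairProj_comp_mulRight]
    funext p
    exact G.mul_assoc _ _ _ p.left.condition p.condition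
  rw [hb, D.pullback_mulLeft_eq] at h1
  have hs : s.toMap (P.proj.toMap (e (t.toMap (P.proj.toMap p.left.right)))) =
      t.toMap (P.proj.toMap p.left.right) := by rw [D.proj, G.s_one]
  let p₀ : TripleSpace s t P := ⟨p.left, e (t.toMap (P.proj.toMap p.left.right)), hs.symm⟩
  have hj : Joined p₀ p := by
    obtain ⟨γ, hγ⟩ := P.joinedIn_fibre s
      (D.connected (t.toMap (P.proj.toMap p.left.right))).isPreconnected hs p.condition.symm
    refine ⟨⟨⟨fun τ => ⟨p.left, γ τ, (hγ τ).symm⟩, ?_⟩, ?_, ?_⟩⟩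
    · exact FibProd.isInducing_pair.continuous_iff.2 (continuous_const.prodMk γ.continuous)
    · exact FibProd.ext rfl γ.source
    · exact FibProd.ext rfl γ.target
  refine h1.eq_of_joined D.connection h2 hj ?_
  have a1 : D.mulLeft p₀ = pairRightUnit D.proj (D.mul p.left) := by
    refine FibProd.ext rfl ?_
    exact congrArg e (D.t_mul p.left).symm
  have a2 : D.mulRight p₀ = p.left := by
    refine FibProd.ext rfl ?_
    exact D.mulFun_rightUnit p.left.right
  change D.mul (D.mulLeft p₀) = D.mul (D.mulRight p₀)
  rw [a1, a2]
  exact D.mulFun_rightUnit (D.mul p.left)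

theorem mul_assoc (x y z : R₁) (h : (t.comp P.proj).toMap x = (s.comp P.proj).toMap y)
    (h' : (t.comp P.proj).toMap y = (s.comp P.proj).toMap z) :
    D.mul ⟨D.mul ⟨x, y, h⟩, z, (D.t_mul ⟨x, y, h⟩).trans h'⟩ =
      D.mul ⟨x, D.mul ⟨y, z, h'⟩, h.trans (D.s_mul ⟨y, z, h'⟩).symm⟩ :=
  D.mul_mulLeft ⟨⟨x, y, h⟩, z, h'⟩

theorem mul_congr {x x' y y' : R₁} (hx : x = x') (hy : y = y')
    (h : (t.comp P.proj).toMap x = (s.comp P.proj).toMap y)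
    (h' : (t.comp P.proj).toMap x' = (s.comp P.proj).toMap y') :
    D.mul ⟨x, y, h⟩ = D.mul ⟨x', y', h'⟩ := by
  subst hx hy; rfl

theorem condition_inv {x x' : R₁} (h : P.proj.toMap x' = G.inv (P.proj.toMap x)) :
    (t.comp P.proj).toMap x = (s.comp P.proj).toMap x' := by
  change t.toMap (P.proj.toMap x) = s.toMap (P.proj.toMap x')
  rw [h, G.s_inv]

theorem proj_mul_inv {x x' : R₁} (h : P.proj.toMap x' = G.inv (P.proj.toMap x)) :
    P.proj.toMap (e (s.toMap (P.proj.toMap x))) =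
      P.proj.toMap (D.mul ⟨x, x', condition_inv h⟩) := by
  rw [D.proj]
  refine Eq.trans ?_ (D.proj_mulFun ⟨x, x', condition_inv h⟩).symm
  refine (G.mul_inv (P.proj.toMap x)).symm.trans ?_
  exact G.mul_congr rfl h.symm _ _

/-- An inverse computed from a point over the inverse of the projection. -/
theorem mul_inverse {x x' : R₁} (h : P.proj.toMap x' = G.inv (P.proj.toMap x))
    (h' : (t.comp P.proj).toMap x = (s.comp P.proj).toMap
      (P.div (e (s.toMap (P.proj.toMap x))) (D.mul ⟨x, x', condition_inv h⟩) • x')) :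
    D.mul ⟨x, P.div (e (s.toMap (P.proj.toMap x))) (D.mul ⟨x, x', condition_inv h⟩) • x', h'⟩ =
      e (s.toMap (P.proj.toMap x)) := by
  -- By equivariance the error of the trial inverse `x'` is a circle factor, which is absorbed into
  -- `x'`.
  have h1 := D.mul_pairSmul 1 (P.div (e (s.toMap (P.proj.toMap x)))
    (D.mul ⟨x, x', condition_inv h⟩)) ⟨x, x', condition_inv h⟩
  rw [one_mul, P.div_smul (D.proj_mul_inv h)] at h1
  refine Eq.trans ?_ h1
  exact congrArg D.mul (FibProd.ext (one_smul Circle x).symm rfl)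

theorem exists_inverse (x : R₁) : ∃ y, P.proj.toMap y = G.inv (P.proj.toMap x) ∧
    ∀ h, D.mul ⟨x, y, h⟩ = e (s.toMap (P.proj.toMap x)) := by
  obtain ⟨x', hx'⟩ := P.proj.surjective (G.inv (P.proj.toMap x))
  exact ⟨_, (P.proj_smul _ _).trans hx', fun h => D.mul_inverse hx' h⟩

/-- The inversion. -/
noncomputable def invFun (x : R₁) : R₁ := (D.exists_inverse x).choose

theorem proj_invFun (x : R₁) : P.proj.toMap (D.invFun x) = G.inv (P.proj.toMap x) :=
  (D.exists_inverse x).choose_spec.1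

theorem mul_invFun (x : R₁) (h) : D.mul ⟨x, D.invFun x, h⟩ = e (s.toMap (P.proj.toMap x)) :=
  (D.exists_inverse x).choose_spec.2 h

theorem one_mul_of_eq {u : X₀} {y : R₁} (hu : (s.comp P.proj).toMap y = u) (h) :
    D.mul ⟨e u, y, h⟩ = y := by
  subst hu
  exact D.mulFun_leftUnit y

theorem mul_one_of_eq {u : X₀} {y : R₁} (hu : (t.comp P.proj).toMap y = u) (h) :
    D.mul ⟨y, e u, h⟩ = y := by
  subst hu
  exact D.mulFun_rightUnit y

/-- Every element has a right inverse; bracketing x x' x'' in two ways shows that the right inverse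
of x' is x, so right inverses are two-sided. -/
theorem invFun_mul (x : R₁) (h) : D.mul ⟨D.invFun x, x, h⟩ = e (t.toMap (P.proj.toMap x)) := by
  have h1 : (t.comp P.proj).toMap x = (s.comp P.proj).toMap (D.invFun x) :=
    condition_inv (D.proj_invFun x)
  have h2 : (t.comp P.proj).toMap (D.invFun x) = (s.comp P.proj).toMap (D.invFun (D.invFun x)) :=
    condition_inv (D.proj_invFun (D.invFun x))
  have h3 := D.mul_assoc x (D.invFun x) (D.invFun (D.invFun x)) h1 h2
  have h4 : x = D.invFun (D.invFun x) := by
    have a1 : D.mul ⟨D.mul ⟨x, D.invFun x, h1⟩, D.invFun (D.invFun x),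
        (D.t_mul ⟨x, D.invFun x, h1⟩).trans h2⟩ = D.invFun (D.invFun x) := by
      refine (D.mul_congr (D.mul_invFun x h1) rfl _ ?_).trans (D.one_mul_of_eq ?_ ?_)
      · change t.toMap (P.proj.toMap (e _)) = _
        rw [D.proj, G.t_one, ← h2]
        exact h.symm
      · exact h2.symm.trans h
      · change t.toMap (P.proj.toMap (e _)) = _
        rw [D.proj, G.t_one, ← h2]
        exact h.symm
    have a2 : D.mul ⟨x, D.mul ⟨D.invFun x, D.invFun (D.invFun x), h2⟩,
        h1.trans (D.s_mul ⟨D.invFun x, D.invFun (D.invFun x), h2⟩).symm⟩ = x := by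
      refine (D.mul_congr rfl (D.mul_invFun (D.invFun x) h2) _ ?_).trans (D.mul_one_of_eq h1 ?_)
      · change _ = s.toMap (P.proj.toMap (e _))
        rw [D.proj, G.s_one]
        exact h1
      · change _ = s.toMap (P.proj.toMap (e _))
        rw [D.proj, G.s_one]
        exact h1
    exact a2.symm.trans (h3.symm.trans a1)
  refine (D.mul_congr rfl h4 h h2).trans ((D.mul_invFun _ h2).trans ?_)
  exact congrArg e h1.symm

/-- Near a point the inverse is a smooth local section over the inverted base point, corrected by a
circle quotient as in `mul_inverse`. -/
theorem contMDiff_invFun : ContMDiff 𝓘(ℝ, ER) 𝓘(ℝ, ER) ∞ D.invFun := by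
  classical
  intro r₀
  obtain ⟨W, ρ, hW, hrW, hρ, hρp, hρr⟩ := P.exists_local_section (D.invFun r₀)
  rw [D.proj_invFun] at hrW
  let i : SmoothMap ER E₁ R₁ X₁ := G.inv.comp P.proj.toMap
  let U : Set R₁ := i ⁻¹' W
  have hU : IsOpen U := hW.preimage i.contMDiff.continuous
  have hr₀ : r₀ ∈ U := hrW
  have hσ : ContMDiffOn 𝓘(ℝ, ER) 𝓘(ℝ, ER) ∞ (fun r => ρ (i r)) U :=
    hρ.comp i.contMDiff.contMDiffOn (fun r hr => hr)
  have hp : ∀ r ∈ U, P.proj.toMap (ρ (i r)) = G.inv (P.proj.toMap r) := fun r hr => hρp _ hr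
  -- The value outside `U` only makes `k` a total function.
  let k : R₁ → PairSpace s t P := fun r => if hr : r ∈ U then ⟨r, ρ (i r), condition_inv (hp r hr)⟩
    else pairRightUnit D.proj r₀
  have hk : ContMDiffOn 𝓘(ℝ, ER) 𝓘(ℝ, FibModel ER ER E₀) ∞ k U := by
    refine FibProd.contMDiffOn_of_components hU ?_ ?_
    · refine contMDiffOn_id.congr fun r hr => ?_
      simp only [k, dif_pos hr, id]
    · refine hσ.congr fun r hr => ?_
      simp only [k, dif_pos hr]
  have heq : ∀ r ∈ U, D.invFun r =
      P.div (e ((s.comp P.proj).toMap r)) (D.mul (k r)) • ρ (i r) := by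
    intro r hr
    have h1 : D.mul (k r) = D.mul ⟨r, ρ (i r), condition_inv (hp r hr)⟩ := by
      simp only [k, dif_pos hr]
    rw [h1]
    have h2 : P.proj.toMap (P.div (e ((s.comp P.proj).toMap r))
        (D.mul ⟨r, ρ (i r), condition_inv (hp r hr)⟩) • ρ (i r)) = G.inv (P.proj.toMap r) := by
      rw [P.proj_smul, hp r hr]
    have h3 := D.mul_inverse (hp r hr) (condition_inv h2)
    obtain ⟨z, hz⟩ := P.exists_smul_eq (h2.trans (D.proj_invFun r).symm)
    have h4 := D.mul_pairSmul 1 z ⟨r, _, condition_inv h2⟩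
    rw [one_mul] at h4
    have h5 : D.mul (pairSmul P 1 z ⟨r, _, condition_inv h2⟩) =
        D.mul ⟨r, D.invFun r, condition_inv (D.proj_invFun r)⟩ :=
      congrArg D.mul (FibProd.ext (one_smul Circle r) hz.symm)
    rw [h5, D.mul_invFun] at h4
    -- Both candidates are right inverses of `r`; they differ by `z`, and the action is free.
    have h6 : z = 1 := by
      refine P.smul_right_injective (e ((s.comp P.proj).toMap r)) ?_
      change z • _ = (1 : Circle) • _
      rw [one_smul]
      exact (congrArg (z • ·) h3).symm.trans h4.symm
    rw [hz, h6, one_smul]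
  have hd : ContMDiffAt 𝓘(ℝ, ER) 𝓘(ℝ, ER) ∞
      (fun r => P.div (e ((s.comp P.proj).toMap r)) (D.mul (k r)) • ρ (i r)) r₀ := by
    refine P.contMDiffAt_smul ?_ (hσ.contMDiffAt (hU.mem_nhds hr₀))
    refine P.contMDiffAt_div ?_ ?_ ?_
    · exact (e.comp (s.comp P.proj).toMap).contMDiff.contMDiffAt
    · exact D.mul.contMDiff.contMDiffAt.comp r₀ (hk.contMDiffAt (hU.mem_nhds hr₀))
    · filter_upwards [hU.mem_nhds hr₀] with r hr
      simp only [k, dif_pos hr]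
      exact D.proj_mul_inv (hp r hr)
  exact hd.congr_of_eventuallyEq (Filter.eventuallyEq_of_mem (hU.mem_nhds hr₀) heq)

/-- The central extension. -/
noncomputable def extension : CentralExtension G P where
  one := e
  mul := D.mul
  inv := ⟨D.invFun, D.contMDiff_invFun⟩
  s_one u := (congrArg s.toMap (D.proj u)).trans (G.s_one u)
  t_one u := (congrArg t.toMap (D.proj u)).trans (G.t_one u)
  s_mul := D.s_mul
  t_mul := D.t_mul
  s_inv x := (condition_inv (D.proj_invFun x)).symm
  t_inv x := (congrArg t.toMap (D.proj_invFun x)).trans (G.t_inv _)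
  one_mul := D.mulFun_leftUnit
  mul_one := D.mulFun_rightUnit
  mul_assoc := D.mul_assoc
  mul_inv x := D.mul_invFun x _
  inv_mul x := D.invFun_mul x _
  proj_one := D.proj
  proj_mul := D.proj_mulFun
  smul_mul_smul a b p _ := D.mul_pairSmul a b p

theorem hasPseudoCurvature_extension : D.extension.HasPseudoCurvature θ η w := by
  refine ⟨?_, D.curv⟩
  have h := D.pullback_mul
  change pullback (E := FibModel ER ER E₀) (E' := ER)
      (FibProd.snd (t.comp P.proj).toMap (s.comp P.proj)) θ.toFun -
    pullback (E := FibModel ER ER E₀) (E' := ER) D.mul θ.toFun +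
    pullback (E := FibModel ER ER E₀) (E' := ER)
      (FibProd.fst (t.comp P.proj).toMap (s.comp P.proj)) θ.toFun =
    pullback (E := FibModel ER ER E₀) (E' := FibModel E₁ E₁ E₀) (pairProj s t P) η.toFun
  rw [h, mulForm]
  abel

end ExtensionData

theorem CentralExtension.HasPseudoCurvature.pullback_mul {R : CentralExtension G P}
    (h : R.HasPseudoCurvature θ η w) :
    pullback (E := FibModel ER ER E₀) (E' := ER) R.mul θ.toFun = mulForm G P θ η := by
  have h1 : pullback (E := FibModel ER ER E₀) (E' := ER)
      (FibProd.snd (t.comp P.proj).toMap (s.comp P.proj)) θ.toFun -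
    pullback (E := FibModel ER ER E₀) (E' := ER) R.mul θ.toFun +
    pullback (E := FibModel ER ER E₀) (E' := ER)
      (FibProd.fst (t.comp P.proj).toMap (s.comp P.proj)) θ.toFun =
    pullback (E := FibModel ER ER E₀) (E' := FibModel E₁ E₁ E₀) (pairProj s t P) η.toFun := h.1
  rw [mulForm, ← h1]
  abel

/-- Any extension with this pseudo-curvature solves the lifting problem by which the multiplication
was constructed. -/
theorem CentralExtension.HasPseudoCurvature.isHorizontalLift_mul {R : CentralExtension G P}
    (h : R.HasPseudoCurvature θ η w) :
    IsHorizontalLift P θ.toFun (mulBase G P) (mulForm G P θ η) R.mul univ :=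
  ⟨isOpen_univ, R.mul.contMDiff.contMDiffOn, fun p _ => R.proj_mul p,
    fun p _ => congrFun h.pullback_mul p⟩

/-- A Lie groupoid structure is determined by units and multiplication. -/
theorem LieGroupoid.eq_of_mul_eq {G G' : LieGroupoid s t} (h1 : G.one = G'.one)
    (h2 : G.mul = G'.mul) : G = G' := by
  refine LieGroupoid.ext h1 h2 (ContMDiffMap.ext fun x => ?_)
  refine G'.eq_inv_of_mul_eq_one (G.s_inv x).symm ?_
  rw [← h1, ← h2]
  exact G.mul_inv x

/-- The two multiplications are lifts of the same data that agree on right unit pairs, and each pair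
is joined to one of these. -/
theorem ExtensionData.eq_extension (D : ExtensionData G P θ η w e) {R : CentralExtension G P}
    (h1 : ∀ u, R.one u = e u) (h : R.HasPseudoCurvature θ η w) : R = D.extension := by
  have ho : R.one = e := ContMDiffMap.ext h1
  have hm : R.mul = D.mul := by
    refine ContMDiffMap.ext fun p => ?_
    refine h.isHorizontalLift_mul.eq_of_joined D.connection D.isHorizontalLift_mul
      (D.joined_rightUnit p) ?_
    refine Eq.trans ?_ (D.mulFun_rightUnit p.left).symm
    refine Eq.trans (congrArg R.mul ?_) (R.mul_one p.left)
    exact FibProd.ext rfl (h1 _).symm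
  have hg : R.toLieGroupoid = D.extension.toLieGroupoid := LieGroupoid.eq_of_mul_eq ho hm
  exact CentralExtension.ext ho hm (congrArg LieGroupoid.inv hg)

end Extension

/-! ### Integrals with parameters, and integration over simplices. -/

section ParametricIntegrals

/-- Smooth dependence of integrals on parameters. -/
theorem contDiff_integral_of_contDiff {V : Type*} [NormedAddCommGroup V] [NormedSpace ℝ V]
    {g : V → ℝ → ℝ} (hg : ContDiff ℝ ∞ (fun q : V × ℝ => g q.1 q.2)) :
    ContDiff ℝ ∞ (fun v => ∫ x in (0 : ℝ)..1, g v x) := by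
  -- The cutoff gives compact support without changing the integrand on [0, 1]. The integral is then
  -- the value at 0 of a convolution with the indicator of [-1, 0], the sign coming from the
  -- reflection in the convolution.
  obtain ⟨χ, hχ, hχs, hχ1⟩ : ∃ χ : ℝ → ℝ, ContDiff ℝ ∞ χ ∧ (∀ x, x ∉ Icc (-1 : ℝ) 2 → χ x = 0) ∧
      ∀ x ∈ Icc (0 : ℝ) 1, χ x = 1 := by
    let B : ContDiffBump (1 / 2 : ℝ) := ⟨1 / 2, 1, by norm_num, by norm_num⟩
    refine ⟨B, B.contDiff, fun x hx => B.zero_of_le_dist ?_, fun x hx =>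
      B.one_of_mem_closedBall ?_⟩
    · rw [Real.dist_eq]
      by_contra! h
      have h' : |x - 1 / 2| < 1 := h
      rw [abs_lt] at h'
      exact hx ⟨by linarith, by linarith⟩
    · rw [Metric.mem_closedBall, Real.dist_eq]
      change |x - 1 / 2| ≤ 1 / 2
      rw [abs_le]
      constructor <;> linarith [hx.1, hx.2]
  have h := contDiffOn_convolution_right_with_param (μ := volume) (n := ⊤)
    (f := (Icc (-1 : ℝ) 0).indicator (fun _ => (1 : ℝ))) (ContinuousLinearMap.mul ℝ ℝ)
    (g := fun v x => χ x * g v x) (s := univ) (k := Icc (-1 : ℝ) 2) isOpen_univ isCompact_Icc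
    (fun v x _ hx => by simp [hχs x hx])
    ((integrable_indicator_iff measurableSet_Icc).2
      (by simp : IntegrableOn (fun _ => (1 : ℝ)) (Icc (-1 : ℝ) 0))).locallyIntegrable
    (by
      refine ContDiff.contDiffOn ?_
      exact (hχ.comp contDiff_snd).mul hg)
  rw [univ_prod_univ, contDiffOn_univ] at h
  have h2 := h.comp (contDiff_id.prodMk (contDiff_const (c := (0 : ℝ))) : ContDiff ℝ ∞
    (fun v : V => (v, (0 : ℝ))))
  convert h2 using 1
  funext v
  simp only [Function.comp_apply, convolution_def, ContinuousLinearMap.mul_apply', id]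
  have h3 : ∀ x : ℝ, (Icc (-1 : ℝ) 0).indicator (fun _ => (1 : ℝ)) x * (χ (0 - x) * g v (0 - x)) =
      (Icc (-1 : ℝ) 0).indicator (fun x => g v (-x)) x := by
    intro x
    by_cases hx : x ∈ Icc (-1 : ℝ) 0
    · rw [indicator_of_mem hx, indicator_of_mem hx, zero_sub,
        hχ1 (-x) ⟨by linarith [hx.2], by linarith [hx.1]⟩, one_mul, one_mul]
    · rw [indicator_of_notMem hx, indicator_of_notMem hx, zero_mul]
  simp only [h3]
  rw [integral_indicator measurableSet_Icc, integral_Icc_eq_integral_Ioc,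
    ← intervalIntegral.integral_of_le (by norm_num), intervalIntegral.integral_comp_neg]
  simp

end ParametricIntegrals

section Corners

namespace SmoothSimplex

theorem mem_corner {q : ℕ} {v : Fin q → ℝ} :
    v ∈ corner q ↔ (∀ i, 0 ≤ v i) ∧ ∑ i, v i ≤ 1 := by
  simp only [corner, bary, mem_ofPred_eq, stdSimplex, Fin.forall_fin_succ, Fin.cons_zero,
    Fin.cons_succ, Fin.sum_univ_succ, sub_add_cancel, and_true, sub_nonneg]
  exact and_comm

theorem convex_corner (q : ℕ) : Convex ℝ (corner q) := by
  have h : corner q = (⋂ i, {v | 0 ≤ v i}) ∩ {v | ∑ i, v i ≤ 1} := by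
    ext v; simp [mem_corner]
  rw [h]
  refine (convex_iInter fun i => ?_).inter ?_
  · exact convex_halfSpace_ge (LinearMap.proj i : (Fin q → ℝ) →ₗ[ℝ] ℝ).isLinear 0
  · have := convex_halfSpace_le (∑ i, LinearMap.proj i : (Fin q → ℝ) →ₗ[ℝ] ℝ).isLinear 1
    simpa using this

theorem isClosed_corner (q : ℕ) : IsClosed (corner q) := by
  have h : corner q = (⋂ i, {v | 0 ≤ v i}) ∩ {v | ∑ i, v i ≤ 1} := by
    ext v; simp [mem_corner]
  rw [h]
  refine (isClosed_iInter fun i => isClosed_le (by fun_prop) (by fun_prop)).inter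
    (isClosed_le (by fun_prop) (by fun_prop))

theorem isCompact_corner (q : ℕ) : IsCompact (corner q) := by
  refine (isCompact_univ_pi fun _ : Fin q => isCompact_Icc (a := (0 : ℝ)) (b := 1)).of_isClosed_subset
    (isClosed_corner q) fun v hv i _ => ?_
  rw [mem_corner] at hv
  exact ⟨hv.1 i, (Finset.single_le_sum (fun j _ => hv.1 j) (Finset.mem_univ i)).trans hv.2⟩

theorem interior_corner_nonempty (q : ℕ) : (interior (corner q)).Nonempty := by
  let O : Set (Fin q → ℝ) := (⋂ i, {v | 0 < v i}) ∩ {v | ∑ i, v i < 1}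
  have hO : IsOpen O := (isOpen_iInter_of_finite fun i => isOpen_lt (by fun_prop) (by fun_prop)).inter
    (isOpen_lt (by fun_prop) (by fun_prop))
  have hsub : O ⊆ corner q := fun v hv => mem_corner.2
    ⟨fun i => (mem_iInter.1 hv.1 i).le, hv.2.le⟩
  refine ⟨fun _ => 1 / ((q : ℝ) + 1), interior_maximal hsub hO ⟨mem_iInter.2 fun i => ?_, ?_⟩⟩
  · change 0 < 1 / ((q : ℝ) + 1); positivity
  · simp only [mem_ofPred_eq, Finset.sum_const, Finset.card_univ, Fintype.card_fin, nsmul_eq_mul]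
    rw [mul_one_div, div_lt_one (by positivity)]
    linarith

theorem uniqueDiffOn_corner (q : ℕ) : UniqueDiffOn ℝ (corner q) :=
  uniqueDiffOn_convex (convex_corner q) (interior_corner_nonempty q)

theorem zero_mem_corner (q : ℕ) : 0 ∈ corner q := mem_corner.2 ⟨fun _ => le_rfl, by simp⟩

variable {E M : Type*} [NormedAddCommGroup E] [NormedSpace ℝ E] [TopologicalSpace M]
  [ChartedSpace E M]

theorem param_of_mem {q : ℕ} (σ : SmoothSimplex E M q) {v : Fin q → ℝ} (hv : v ∈ corner q) :
    σ.param v = σ.toFun ⟨bary v, hv⟩ := dif_pos hv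

theorem contDiff_bary (q : ℕ) : ContDiff ℝ ∞ (bary : (Fin q → ℝ) → Fin (q + 1) → ℝ) := by
  rw [contDiff_pi]
  intro i
  refine Fin.cases ?_ (fun j => ?_) i
  · simp only [bary, Fin.cons_zero]; fun_prop
  · simp only [bary, Fin.cons_succ]; fun_prop

/-- The parametrization of a smooth simplex extends to a smooth map on `ℝ^q`. -/
theorem exists_smooth_param {q : ℕ} (σ : SmoothSimplex E M q) :
    ∃ F : SmoothMap (Fin q → ℝ) E (Fin q → ℝ) M, ∀ v ∈ corner q, F v = σ.param v := by
  obtain ⟨U, F, hU, hs, hF, h⟩ := σ.exists_extension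
  have hO : IsOpen (bary ⁻¹' U : Set (Fin q → ℝ)) := hU.preimage (contDiff_bary q).continuous
  obtain ⟨δ, hδ, hth⟩ := (isCompact_corner q).exists_thickening_subset_open hO (fun v hv => hs hv)
  obtain ⟨χ, hχ0, hχ1, hχ⟩ := exists_contMDiffMap_zero_one_of_isClosed (n := ⊤) 𝓘(ℝ, Fin q → ℝ)
    (s := (Metric.thickening δ (corner q))ᶜ) (t := corner q) Metric.isOpen_thickening.isClosed_compl
    (isClosed_corner q)
    (disjoint_compl_left_iff_subset.2 (Metric.self_subset_thickening hδ _))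
  -- The map v ↦ χ(v) v is the identity on the corner and sends all of `ℝ^q` into the thickening,
  -- which is convex and contains 0; composing with it extends the simplex to the whole space.
  have hκ : ∀ v, χ v • v ∈ Metric.thickening δ (corner q) := by
    intro v
    have h0 : (0 : Fin q → ℝ) ∈ Metric.thickening δ (corner q) :=
      Metric.self_subset_thickening hδ _ (zero_mem_corner q)
    by_cases hv : v ∈ Metric.thickening δ (corner q)
    · exact ((convex_corner q).thickening δ).smul_mem_of_zero_mem h0 hv (hχ v)
    · have h1 : χ v = 0 := hχ0 hv
      rw [h1, zero_smul]
      exact h0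
  have hsm : ContDiff ℝ ∞ (fun v => bary (χ v • v)) :=
    (contDiff_bary q).comp (χ.contMDiff.contDiff.smul contDiff_id)
  refine ⟨⟨fun v => F (bary (χ v • v)), ?_⟩, fun v hv => ?_⟩
  · exact hF.comp_contMDiff hsm.contMDiff (fun v => hth (hκ v))
  · have : χ v = 1 := hχ1 hv
    change F (bary (χ v • v)) = _
    rw [this, one_smul, param_of_mem σ hv]
    exact h ⟨bary v, hv⟩

/-- Derivatives within the corner are unique, so they may be taken from any smooth extension. -/
theorem integral_eq {q : ℕ} (α : PreForm E M q) (σ : SmoothSimplex E M q)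
    {F : SmoothMap (Fin q → ℝ) E (Fin q → ℝ) M} (hF : ∀ v ∈ corner q, F v = σ.param v) :
    integral α σ = ∫ v in corner q, pullback (E := Fin q → ℝ) (E' := E) F α v
      (fun i => Pi.single i 1) := by
  refine setIntegral_congr_fun (isClosed_corner q).measurableSet fun v hv => ?_
  have h1 : mfderivWithin 𝓘(ℝ, Fin q → ℝ) 𝓘(ℝ, E) σ.param (corner q) v =
      mfderiv 𝓘(ℝ, Fin q → ℝ) 𝓘(ℝ, E) F v := by
    have hu : UniqueMDiffWithinAt 𝓘(ℝ, Fin q → ℝ) (corner q) v :=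
      (uniqueDiffOn_corner q v hv).uniqueMDiffWithinAt
    rw [mfderivWithin_congr_of_mem (fun x hx => (hF x hx).symm) hv]
    exact mfderivWithin_eq_mfderiv hu (F.contMDiff.mdifferentiableAt (by simp))
  simp only [pullback, ContinuousAlternatingMap.compContinuousLinearMap_apply, hF v hv, h1]
  rfl

theorem integral_corner_one (f : (Fin 1 → ℝ) → ℝ) :
    ∫ v in corner 1, f v = ∫ x in (0 : ℝ)..1, f (fun _ => x) := by
  rw [intervalIntegral.integral_of_le zero_le_one, ← integral_Icc_eq_integral_Ioc]
  refine (((volume_preserving_funUnique (Fin 1) ℝ).symm _).setIntegral_preimage_emb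
      (MeasurableEquiv.measurableEmbedding _) f (corner 1)).symm.trans ?_
  have h : (MeasurableEquiv.funUnique (Fin 1) ℝ).symm ⁻¹' corner 1 = Icc (0 : ℝ) 1 := by
    ext x
    simp only [mem_preimage, mem_corner, Fin.forall_fin_one, Finset.univ_unique,
      Finset.sum_singleton, mem_Icc]
    rfl
  rw [h]
  rfl

/-- Fubini with the first coordinate as inner variable, to match `exists_primitive_fst`. -/
theorem integral_corner_two {f : (Fin 2 → ℝ) → ℝ} (hf : Continuous f) :
    ∫ v in corner 2, f v = ∫ y in (0 : ℝ)..1, ∫ x in (0 : ℝ)..(1 - y), f ![x, y] := by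
  let T : Set (ℝ × ℝ) := {z | 0 ≤ z.1 ∧ 0 ≤ z.2 ∧ z.1 + z.2 ≤ 1}
  have hT : (MeasurableEquiv.finTwoArrow (α := ℝ)).symm ⁻¹' corner 2 = T := by
    ext z
    simp only [mem_preimage, mem_corner, Fin.forall_fin_two, Fin.sum_univ_two, T, mem_ofPred_eq,
      and_assoc]
    rfl
  have hTc : IsClosed T := by
    refine (isClosed_le continuous_const continuous_fst).inter
      ((isClosed_le continuous_const continuous_snd).inter
      (isClosed_le (continuous_fst.add continuous_snd) continuous_const))
  have hTk : IsCompact T := by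
    refine (isCompact_Icc (a := ((0 : ℝ), (0 : ℝ))) (b := (1, 1))).of_isClosed_subset hTc ?_
    rintro z ⟨h1, h2, h3⟩
    exact ⟨⟨h1, h2⟩, ⟨by simp; linarith, by simp; linarith⟩⟩
  have hf2 : Continuous (fun z : ℝ × ℝ => f ![z.1, z.2]) := by
    refine hf.comp (continuous_pi fun i => ?_)
    fin_cases i
    · exact continuous_fst
    · exact continuous_snd
  have hint : Integrable (T.indicator fun z : ℝ × ℝ => f ![z.1, z.2]) (volume.prod volume) :=
    (integrable_indicator_iff hTc.measurableSet).2 (hf2.continuousOn.integrableOn_compact hTk)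
  rw [← ((volume_preserving_finTwoArrow ℝ).symm _).setIntegral_preimage_emb
      (MeasurableEquiv.measurableEmbedding _), hT]
  change ∫ z in T, f ![z.1, z.2] ∂(volume.prod volume) = _
  rw [← integral_indicator hTc.measurableSet, integral_prod_symm _ hint,
    intervalIntegral.integral_of_le zero_le_one, ← integral_Icc_eq_integral_Ioc,
    ← integral_indicator measurableSet_Icc]
  refine integral_congr_ae (Filter.Eventually.of_forall fun y => ?_)
  change ∫ x, T.indicator (fun z : ℝ × ℝ => f ![z.1, z.2]) (x, y) = _
  by_cases hy : y ∈ Icc (0 : ℝ) 1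
  · rw [indicator_of_mem hy, intervalIntegral.integral_of_le (by linarith [hy.2]),
      ← integral_Icc_eq_integral_Ioc, ← integral_indicator measurableSet_Icc]
    congr 1
    funext x
    simp only [indicator]
    refine if_congr ?_ rfl rfl
    exact ⟨fun h => ⟨h.1, by linarith [h.2.2]⟩, fun h => ⟨h.1, hy.1, by simp; linarith [h.2]⟩⟩
  · rw [indicator_of_notMem hy]
    refine integral_eq_zero_of_ae (Filter.Eventually.of_forall fun x => ?_)
    refine indicator_of_notMem (fun h => hy ⟨h.2.1, ?_⟩) _
    have h1 : 0 ≤ x := h.1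
    have h3 : x + y ≤ 1 := h.2.2
    linarith

end SmoothSimplex

end Corners

/-! ### Logarithms, fibre coordinates and parametrized edges. -/

section CircleLog

/-- A logarithm on `S¹ = ℝ/ℤ`. -/
noncomputable def circleLog (z : Circle) : ℝ := Complex.arg z / (2 * Real.pi)

theorem exp_circleLog (z : Circle) : Circle.exp (2 * Real.pi * circleLog z) = z := by
  rw [circleLog, mul_div_cancel₀ _ (by positivity), Circle.exp_arg]

theorem exists_int_of_exp_eq_one {x : ℝ} (h : Circle.exp (2 * Real.pi * x) = 1) :
    ∃ n : ℤ, x = n := by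
  obtain ⟨n, hn⟩ := Circle.exp_eq_one.1 h
  refine ⟨n, ?_⟩
  have h1 : (2 * Real.pi) * x = (2 * Real.pi) * n := by rw [hn]; ring
  exact mul_left_cancel₀ (by positivity) h1

end CircleLog

section Primitives

theorem contDiff_primitive {a : ℝ → ℝ} (ha : ContDiff ℝ ∞ a) :
    ContDiff ℝ ∞ (fun x => ∫ y in (0 : ℝ)..x, a y) ∧
      ∀ x, deriv (fun x => ∫ y in (0 : ℝ)..x, a y) x = a x := by
  have h : ∀ x, HasDerivAt (fun x => ∫ y in (0 : ℝ)..x, a y) (a x) x := fun x =>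
    intervalIntegral.integral_hasDerivAt_right (ha.continuous.intervalIntegrable 0 x)
      ha.continuous.stronglyMeasurable.stronglyMeasurableAtFilter ha.continuous.continuousAt
  refine ⟨contDiff_infty_iff_deriv.2 ⟨fun x => (h x).differentiableAt, ?_⟩, fun x => (h x).deriv⟩
  rw [funext fun x => (h x).deriv]
  exact ha

end Primitives

section OneForms

variable {E E' M M' : Type*}
  [NormedAddCommGroup E] [NormedSpace ℝ E] [NormedAddCommGroup E'] [NormedSpace ℝ E']
  [TopologicalSpace M] [ChartedSpace E M] [TopologicalSpace M'] [ChartedSpace E' M']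

theorem pullback_one_apply (f : M → M') (α : PreForm E' M' 1) (x : M) (v : E) :
    pullback (E := E) (E' := E') f α x ![v] = α (f x) ![tangentAt (E := E) (E' := E') f x v] := by
  simp only [pullback, ContinuousAlternatingMap.compContinuousLinearMap_apply]
  congr 1
  ext i
  fin_cases i
  rfl

end OneForms

section Coordinates

variable {ER E R X : Type*}
  [NormedAddCommGroup ER] [NormedSpace ℝ ER] [NormedAddCommGroup E] [NormedSpace ℝ E]
  [TopologicalSpace R] [ChartedSpace ER R] [TopologicalSpace X] [ChartedSpace E X]
  [MulAction Circle R] (P : PrincipalCircleBundle ER E R X)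

namespace PrincipalCircleBundle

/-- A point in the fibre over `x`. -/
noncomputable def point (x : X) : R := (P.proj.surjective x).choose

theorem proj_point (x : X) : P.proj.toMap (P.point x) = x := (P.proj.surjective x).choose_spec

/-- The coordinate in its fibre of a point of the bundle. -/
noncomputable def coord (r : R) : Circle := P.div r (P.point (P.proj.toMap r))

theorem coord_smul_point (r : R) : P.coord r • P.point (P.proj.toMap r) = r :=
  P.div_smul (P.proj_point _).symm

theorem coord_smul (z : Circle) (r : R) : P.coord (z • r) = z * P.coord r := by
  refine P.div_eq ?_
  rw [P.proj_smul, mul_smul, P.coord_smul_point]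

end PrincipalCircleBundle

end Coordinates

section PathSpaces

namespace SmoothSimplex

variable {E M E' M' : Type*} [NormedAddCommGroup E] [NormedSpace ℝ E] [TopologicalSpace M]
  [ChartedSpace E M] [NormedAddCommGroup E'] [NormedSpace ℝ E'] [TopologicalSpace M']
  [ChartedSpace E' M']

theorem param_map {q : ℕ} (f : SmoothMap E E' M M') (σ : SmoothSimplex E M q) (v : Fin q → ℝ) :
    (σ.map f).param v = f (σ.param v) := by
  simp only [param, map]
  split_ifs <;> rfl

theorem const_mem_corner {x : ℝ} (hx : x ∈ Icc (0 : ℝ) 1) : (fun _ => x) ∈ corner 1 :=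
  mem_corner.2 ⟨fun _ => hx.1, by simpa using hx.2⟩

/-- A one-simplex as a smooth path `ℝ → M` that is constant outside `[0, 1]`. -/
noncomputable def path (γ : SmoothSimplex E M 1) (x : ℝ) : M :=
  γ.param (fun _ => Real.smoothTransition x)

theorem smoothTransition_mem (x : ℝ) : Real.smoothTransition x ∈ Icc (0 : ℝ) 1 :=
  ⟨Real.smoothTransition.nonneg x, Real.smoothTransition.le_one x⟩

theorem contMDiff_diag : ContMDiff 𝓘(ℝ, ℝ) 𝓘(ℝ, Fin 1 → ℝ) ∞ (fun (x : ℝ) (_ : Fin 1) => x) := by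
  rw [contMDiff_iff_contDiff]; fun_prop

end SmoothSimplex

end PathSpaces

/-! ### Parallel transport as a one-cochain. -/

section HolonomyCochains

variable {ER E R X : Type*}
  [NormedAddCommGroup ER] [NormedSpace ℝ ER] [NormedAddCommGroup E] [NormedSpace ℝ E]
  [TopologicalSpace R] [ChartedSpace ER R] [TopologicalSpace X] [ChartedSpace E X]
  [MulAction Circle R] (P : PrincipalCircleBundle ER E R X)

open Classical in
/-- The logarithm of the parallel transport along one-simplices. -/
noncomputable def holonomyCochain (θ : PreForm ER R 1) : Cochain E X 1 := fun γ =>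
  if h : ∃ c : ℝ → R, IsHorizontalLift (E' := ℝ) P θ γ.path 0 c univ then
    circleLog (P.coord (h.choose 0) / P.coord (h.choose 1)) else 0

variable {P} {θ : DiffForm ER R 1} {w : PreForm E X 2}

/-- Two-forms on a line vanish, so over a curve every connection is flat and parallel transport is a
case of horizontal lifting. -/
theorem isFlatPair_curve (f : ℝ → X) : IsFlatPair (E' := ℝ) w f 0 := by
  have h0 : ∀ m : ℝ, chartForm (E := ℝ) (0 : PreForm ℝ ℝ 1) m = 0 := fun m => rfl
  refine fun m => ⟨by rw [h0]; exact contDiffOn_const, fun v _ => ?_⟩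
  refine ContinuousAlternatingMap.ext fun y => ?_
  have hy : ¬ LinearIndependent ℝ y := fun h => by
    simpa using h.fintype_card_le_finrank
  rw [ContinuousAlternatingMap.neg_apply]
  have h1 : ∀ B : ℝ [⋀^Fin 2]→L[ℝ] ℝ, B y = 0 := fun B =>
    B.toAlternatingMap.map_linearDependent y hy
  rw [h1, h1, neg_zero]

theorem exists_horizontalLift_curve [IsManifold 𝓘(ℝ, ER) ∞ R] (hθ : IsConnectionForm θ.toFun)
    (hcurv : extD θ.toFun = - pullback (E := ER) (E' := E) P.proj.toMap w)
    {f : ℝ → X} (hf : ContMDiff 𝓘(ℝ, ℝ) 𝓘(ℝ, E) ∞ f) :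
    ∃ c : ℝ → R, IsHorizontalLift (E' := ℝ) P θ.toFun f 0 c univ :=
  (isFlatPair_curve f).exists_lift hθ hcurv hf

/-- Lifts of one curve differ by a constant circle factor, which cancels in the quotient of the end
coordinates. -/
theorem exp_holonomyCochain (hθ : IsConnectionForm θ.toFun) {γ : SmoothSimplex E X 1} {c : ℝ → R}
    (hc : IsHorizontalLift (E' := ℝ) P θ.toFun γ.path 0 c univ) :
    Circle.exp (2 * Real.pi * holonomyCochain P θ.toFun γ) = P.coord (c 0) / P.coord (c 1) := by
  have h : ∃ c : ℝ → R, IsHorizontalLift (E' := ℝ) P θ.toFun γ.path 0 c univ := ⟨c, hc⟩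
  rw [holonomyCochain, dif_pos h, exp_circleLog]
  have h1 := h.choose_spec
  set c' := h.choose
  have h2 := (hc.const_smul hθ (P.div (c' 0) (c 0))).eq_of_joined hθ h1
    (PathConnectedSpace.joined 0 1)
    (P.div_smul ((h1.proj 0 (mem_univ _)).trans (hc.proj 0 (mem_univ _)).symm))
  have h3 := P.div_smul ((h1.proj 0 (mem_univ _)).trans (hc.proj 0 (mem_univ _)).symm)
  rw [← h3, ← h2, P.coord_smul, P.coord_smul, mul_div_mul_left_eq_div]

/-- The parallel transport computed from an arbitrary lift. -/
theorem exp_holonomyCochain_of_curve (hθ : IsConnectionForm θ.toFun) {γ : SmoothSimplex E X 1}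
    {c : ℝ → R} (hc : ContMDiff 𝓘(ℝ, ℝ) 𝓘(ℝ, ER) ∞ c)
    (hproj : ∀ x ∈ Icc (0 : ℝ) 1, P.proj.toMap (c x) = γ.param (fun _ => x)) {A : ℝ → ℝ}
    (hA : ContDiff ℝ ∞ A)
    (hform : ∀ x, pullback (E := ℝ) (E' := ER) c θ.toFun x ![(1 : ℝ)] = deriv A x) :
    Circle.exp (2 * Real.pi * holonomyCochain P θ.toFun γ) =
      P.coord (c 0) / P.coord (c 1) * Circle.exp (2 * Real.pi * (A 1 - A 0)) := by
  let S : ℝ → ℝ := Real.smoothTransition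
  have hS : ContDiff ℝ ∞ S := Real.smoothTransition.contDiff
  have hS0 : S 0 = 0 := Real.smoothTransition.zero
  have hS1 : S 1 = 1 := Real.smoothTransition.one
  -- The gauge factor removes the connection form A' of `c`; the composition with `S` passes to the
  -- path that rests outside [0, 1].
  let h : ℝ → ℝ := fun x => - A (S x)
  have hh : ContDiff ℝ ∞ h := (hA.comp hS).neg
  have hcS : ContMDiff 𝓘(ℝ, ℝ) 𝓘(ℝ, ER) ∞ (c ∘ S) := hc.comp hS.contMDiff
  have hlift : IsHorizontalLift (E' := ℝ) P θ.toFun γ.path 0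
      (fun x => Circle.exp (2 * Real.pi * h x) • (c ∘ S) x) univ := by
    refine ⟨isOpen_univ, fun x _ => (P.contMDiffAt_exp_smul hh.contMDiff.contMDiffAt
      hcS.contMDiffAt).contMDiffWithinAt, fun x _ => ?_, fun x _ => ?_⟩
    · rw [P.proj_smul]
      exact hproj _ (SmoothSimplex.smoothTransition_mem x)
    · apply (oneFormEquiv ℝ).injective
      refine ContinuousLinearMap.ext_ring ?_
      rw [oneFormEquiv_apply, oneFormEquiv_apply,
        P.pullback_exp_smul hθ (hh.contMDiff.mdifferentiableAt (by simp))
          (hcS.mdifferentiableAt (by simp)),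
        pullback_comp θ.toFun (hc.mdifferentiableAt (by simp))
          (hS.contMDiff.mdifferentiableAt (by simp)), tangentAt_eq_fderiv, ← oneFormEquiv_apply]
      have e1 : oneFormEquiv ℝ (pullback (E := ℝ) (E' := ℝ) S
          (pullback (E := ℝ) (E' := ER) c θ.toFun) x) 1 = deriv S x * deriv A (S x) := by
        rw [← hform, oneFormEquiv_apply, pullback_one_apply, tangentAt_eq_fderiv,
          fderiv_apply_one_eq_deriv, ← oneFormEquiv_apply, ← oneFormEquiv_apply, ← smul_eq_mul,
          ← map_smul, smul_eq_mul, mul_one]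
      rw [e1]
      have e2 : HasDerivAt h (- (deriv A (S x) * deriv S x)) x :=
        ((hA.differentiable (by simp) _).hasDerivAt.comp x
          (hS.differentiable (by simp) x).hasDerivAt).neg
      rw [fderiv_apply_one_eq_deriv, e2.deriv]
      change _ = (0 : ℝ)
      ring
  rw [exp_holonomyCochain hθ hlift, P.coord_smul, P.coord_smul]
  simp only [Function.comp_apply, hS0, hS1, h, mul_sub, mul_neg, Circle.exp_sub, Circle.exp_neg]
  rw [div_eq_mul_inv, div_eq_mul_inv, div_eq_mul_inv, mul_inv, inv_inv]
  ac_rfl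

end HolonomyCochains

/-! ### Two-forms on the plane and flat connections over it. -/

section TwoForms

variable {E E' M' : Type*}
  [NormedAddCommGroup E] [NormedSpace ℝ E] [NormedAddCommGroup E'] [NormedSpace ℝ E']
  [TopologicalSpace M'] [ChartedSpace E' M'] [IsManifold 𝓘(ℝ, E') ∞ M']

theorem twoForm_apply (B : E [⋀^Fin 2]→L[ℝ] ℝ) (x y : E) :
    B ![x, y] = oneFormEquiv E (B.curryLeft x) y := by
  rw [oneFormEquiv_apply]
  rfl

theorem contDiffAt_pullback_two_apply {g : E → M'} {v : E}
    (hg : ContMDiffAt 𝓘(ℝ, E) 𝓘(ℝ, E') ∞ g v) (β : DiffForm E' M' 2) (x y : E) :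
    ContDiffAt ℝ ∞ (fun v => pullback (E := E) (E' := E') g β.toFun v ![x, y]) v := by
  obtain ⟨h1, h2⟩ := pullback_eventuallyEq_chart hg β.toFun
  have hd : ContDiffAt ℝ ∞ (chartForm β.toFun (g v)) (chartAt E' (g v) (g v)) :=
    ((β.smooth (g v)).contDiffAt ((chartAt E' (g v)).open_target.mem_nhds
      ((chartAt E' (g v)).map_source (mem_chart_source E' (g v)))))
  have hD := h1.fderiv_right (m := ∞) (by simp)
  -- Currying turns the evaluation of a two-form into two applications of continuous linear maps.
  have h3 : ContDiffAt ℝ ∞ (fun a => oneFormEquiv E' ((ContinuousAlternatingMap.curryLeftLI (𝕜 := ℝ)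
      (E := E') (F := ℝ) (n := 1)) (chartForm β.toFun (g v) (chartAt E' (g v) (g a)))
      (fderiv ℝ (chartAt E' (g v) ∘ g) a x)) (fderiv ℝ (chartAt E' (g v) ∘ g) a y)) v := by
    refine ContDiffAt.clm_apply ?_ (hD.clm_apply contDiffAt_const)
    refine (oneFormEquiv E').contDiff.contDiffAt.comp v ?_
    refine ContDiffAt.clm_apply ?_ (hD.clm_apply contDiffAt_const)
    have hC : ContDiff ℝ ∞ (ContinuousAlternatingMap.curryLeftLI (𝕜 := ℝ) (E := E') (F := ℝ)
        (n := 1)) := LinearIsometry.contDiff (E := E' [⋀^Fin 2]→L[ℝ] ℝ)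
      (F := E' →L[ℝ] E' [⋀^Fin 1]→L[ℝ] ℝ) _
    exact hC.contDiffAt.comp v (hd.comp v h1)
  refine h3.congr_of_eventuallyEq ?_
  filter_upwards [h2] with a ha
  rw [ha, ContinuousAlternatingMap.compContinuousLinearMap_apply]
  refine Eq.trans ?_ (twoForm_apply _ _ _)
  congr 1
  ext i
  fin_cases i <;> rfl

end TwoForms

section Plane

/-- A two-form on the plane is a multiple of the determinant. -/
theorem twoForm_plane_apply (B : (Fin 2 → ℝ) [⋀^Fin 2]→L[ℝ] ℝ) (x y : Fin 2 → ℝ) :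
    B ![x, y] = (x 0 * y 1 - x 1 * y 0) * B ![![1, 0], ![0, 1]] := by
  have h := AlternatingMap.eq_smul_basis_det (Pi.basisFun ℝ (Fin 2)) B.toAlternatingMap
  have h1 := congrArg (fun f => f ![x, y]) h
  have h2 : (Pi.basisFun ℝ (Fin 2) : Fin 2 → Fin 2 → ℝ) = ![![1, 0], ![0, 1]] := by
    ext i j
    fin_cases i <;> fin_cases j <;> simp [Pi.basisFun_apply]
  simp only [AlternatingMap.smul_apply, h2, smul_eq_mul, Pi.basisFun_det_apply, Matrix.det_fin_two]
    at h1
  change B ![x, y] = B ![![1, 0], ![0, 1]] * _ at h1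
  rw [h1]
  simp [Matrix.of_apply]
  ring

/-- The form `dy` on the plane. -/
noncomputable def planeForm : (Fin 2 → ℝ) [⋀^Fin 1]→L[ℝ] ℝ :=
  (oneFormEquiv (Fin 2 → ℝ)).symm (ContinuousLinearMap.proj 1)

theorem planeForm_apply (x : Fin 2 → ℝ) : planeForm ![x] = x 1 := by
  rw [← oneFormEquiv_apply, planeForm, ContinuousLinearEquiv.apply_symm_apply]
  rfl

/-- A smooth function `g` on the plane has a smooth primitive in the first variable that vanishes
for `x = 0`. -/
theorem exists_primitive_fst {g : (Fin 2 → ℝ) → ℝ} (hg : ContDiff ℝ ∞ g) :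
    ∃ b : (Fin 2 → ℝ) → ℝ, ContDiff ℝ ∞ b ∧
      (∀ x y, b ![x, y] = ∫ z in (0 : ℝ)..x, g ![z, y]) ∧
      ∀ v, fderiv ℝ b v ![1, 0] = g v := by
  -- Rescaling the variable moves the integral to the fixed interval [0, 1], which gives smoothness
  -- in both variables.
  let b : (Fin 2 → ℝ) → ℝ := fun v => v 0 * ∫ z in (0 : ℝ)..1, g ![z * v 0, v 1]
  have hb : ContDiff ℝ ∞ b := by
    refine ContDiff.mul (by fun_prop) (contDiff_integral_of_contDiff ?_)
    refine hg.comp (contDiff_pi.2 fun i => ?_)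
    fin_cases i
    · change ContDiff ℝ ∞ fun q : (Fin 2 → ℝ) × ℝ => q.2 * q.1 0
      fun_prop
    · change ContDiff ℝ ∞ fun q : (Fin 2 → ℝ) × ℝ => q.1 1
      fun_prop
  have hbi : ∀ x y, b ![x, y] = ∫ z in (0 : ℝ)..x, g ![z, y] := by
    intro x y
    have h := intervalIntegral.mul_integral_comp_mul_right (a := 0) (b := 1)
      (f := fun z => g ![z, y]) x
    rw [zero_mul, one_mul] at h
    exact h
  refine ⟨b, hb, hbi, fun v => ?_⟩
  have hline : HasDerivAt (fun x : ℝ => (![x, v 1] : Fin 2 → ℝ)) ![1, 0] (v 0) := by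
    rw [hasDerivAt_pi]
    intro i
    fin_cases i
    · exact hasDerivAt_id _
    · exact hasDerivAt_const _ _
  have hv : (![v 0, v 1] : Fin 2 → ℝ) = v := by ext i; fin_cases i <;> rfl
  have h1 : HasDerivAt (fun x : ℝ => b ![x, v 1]) (fderiv ℝ b v ![1, 0]) (v 0) := by
    have h2 : HasFDerivAt b (fderiv ℝ b v) (![v 0, v 1] : Fin 2 → ℝ) := by
      rw [hv]; exact (hb.differentiable (by simp) v).hasFDerivAt
    exact h2.comp_hasDerivAt (v 0) hline
  have hgc : Continuous (fun x : ℝ => g ![x, v 1]) := by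
    refine hg.continuous.comp (continuous_pi fun i => ?_)
    fin_cases i
    · exact continuous_id
    · exact continuous_const
  have h3 : HasDerivAt (fun x : ℝ => b ![x, v 1]) (g ![v 0, v 1]) (v 0) := by
    simp only [hbi]
    exact intervalIntegral.integral_hasDerivAt_right (hgc.intervalIntegrable _ _)
      hgc.stronglyMeasurable.stronglyMeasurableAtFilter hgc.continuousAt
  rw [h1.unique h3, hv]

variable {E X : Type*} [NormedAddCommGroup E] [NormedSpace ℝ E] [TopologicalSpace X]
  [ChartedSpace E X]

/-- The exterior derivative of b dy is (∂b/∂x) dx ∧ dy. -/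
theorem isFlatPair_plane {w : PreForm E X 2} {F : (Fin 2 → ℝ) → X} {b : (Fin 2 → ℝ) → ℝ}
    (hb : ContDiff ℝ ∞ b) (h : ∀ v, fderiv ℝ b v ![1, 0] =
      - pullback (E := Fin 2 → ℝ) (E' := E) F w v ![![1, 0], ![0, 1]]) :
    IsFlatPair w F (fun v => b v • planeForm) := by
  intro m
  have h0 : chartForm (E := Fin 2 → ℝ) (fun v => b v • planeForm) m =
      fun v => b v • planeForm := funext fun v => pullback_id _ v
  have hd : ∀ v, HasFDerivAt (fun v => b v • planeForm)
      ((fderiv ℝ b v).smulRight planeForm) v := fun v =>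
    HasFDerivAt.smul_const (F := (Fin 2 → ℝ) [⋀^Fin 1]→L[ℝ] ℝ)
      (hb.differentiable (by simp) v).hasFDerivAt planeForm
  refine ⟨?_, fun v _ => ?_⟩
  · rw [h0]
    exact (hb.smul contDiff_const).contDiffOn
  · rw [h0]
    refine ContinuousAlternatingMap.ext fun y => ?_
    have hy : y = ![y 0, y 1] := by ext i; fin_cases i <;> rfl
    rw [hy, twoForm_plane_apply, twoForm_plane_apply (-_)]
    congr 1
    rw [extDeriv_one_apply, (hd v).fderiv]
    simp only [ContinuousLinearMap.smulRight_apply, ContinuousAlternatingMap.smul_apply,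
      planeForm_apply, h, ContinuousAlternatingMap.neg_apply]
    simp
    rfl

end Plane

/-! ### The holonomy around a triangle. -/

section Faces

namespace SmoothSimplex

variable {E M : Type*} [NormedAddCommGroup E] [NormedSpace ℝ E] [TopologicalSpace M]
  [ChartedSpace E M]

theorem param_face {q : ℕ} (σ : SmoothSimplex E M (q + 1)) (i : Fin (q + 2)) {v : Fin q → ℝ}
    {u : Fin (q + 1) → ℝ} (hv : v ∈ corner q) (hu : u ∈ corner (q + 1))
    (h : FunOnFinite.linearMap ℝ ℝ i.succAbove (bary v) = bary u) :
    (σ.face i).param v = σ.param u := by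
  rw [param_of_mem _ hv, param_of_mem _ hu]
  exact congrArg σ.toFun (Subtype.ext h)

theorem mem_corner_two {x y : ℝ} (hx : 0 ≤ x) (hy : 0 ≤ y) (hxy : x + y ≤ 1) :
    ![x, y] ∈ corner 2 := by
  rw [mem_corner, Fin.forall_fin_two, Fin.sum_univ_two]
  exact ⟨⟨hx, hy⟩, hxy⟩

theorem param_face_zero (σ : SmoothSimplex E M 2) {x : ℝ} (hx : x ∈ Icc (0 : ℝ) 1) :
    (σ.face 0).param (fun _ => x) = σ.param ![1 - x, x] := by
  refine σ.param_face 0 (const_mem_corner hx) (mem_corner_two (by linarith [hx.2]) hx.1 (by linarith)) ?_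
  ext i
  rw [FunOnFinite.linearMap_apply_apply]
  fin_cases i <;> simp [bary, Finset.sum_filter, Fin.sum_univ_two, Fin.succAbove, Fin.cons] <;> rfl

theorem param_face_one (σ : SmoothSimplex E M 2) {x : ℝ} (hx : x ∈ Icc (0 : ℝ) 1) :
    (σ.face 1).param (fun _ => x) = σ.param ![0, x] := by
  refine σ.param_face 1 (const_mem_corner hx) (mem_corner_two le_rfl hx.1 (by linarith [hx.2])) ?_
  ext i
  rw [FunOnFinite.linearMap_apply_apply]
  fin_cases i <;> simp [bary, Finset.sum_filter, Fin.sum_univ_two, Fin.succAbove, Fin.cons] <;> rfl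

theorem param_face_two (σ : SmoothSimplex E M 2) {x : ℝ} (hx : x ∈ Icc (0 : ℝ) 1) :
    (σ.face 2).param (fun _ => x) = σ.param ![x, 0] := by
  refine σ.param_face 2 (const_mem_corner hx) (mem_corner_two hx.1 le_rfl (by linarith [hx.2])) ?_
  ext i
  rw [FunOnFinite.linearMap_apply_apply]
  fin_cases i <;> simp [bary, Finset.sum_filter, Fin.sum_univ_two, Fin.succAbove, Fin.cons] <;> rfl

end SmoothSimplex

end Faces

section Triangles

variable {ER E R X : Type*}
  [NormedAddCommGroup ER] [NormedSpace ℝ ER] [NormedAddCommGroup E] [NormedSpace ℝ E]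
  [TopologicalSpace R] [ChartedSpace ER R] [TopologicalSpace X] [ChartedSpace E X]
  [IsManifold 𝓘(ℝ, ER) ∞ R] [IsManifold 𝓘(ℝ, E) ∞ X]
  [MulAction Circle R] {P : PrincipalCircleBundle ER E R X}
  {θ : DiffForm ER R 1} {w : DiffForm E X 2}

/-- The holonomy around a triangle is the integral of the curvature. -/
theorem exp_integral_add_coboundary (hθ : IsConnectionForm θ.toFun)
    (hcurv : extD θ.toFun = - pullback (E := ER) (E' := E) P.proj.toMap w.toFun)
    (σ : SmoothSimplex E X 2) :
    Circle.exp (2 * Real.pi * (SmoothSimplex.integral w.toFun σ +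
      (holonomyCochain P θ.toFun).coboundary σ)) = 1 := by
  obtain ⟨F, hF⟩ := σ.exists_smooth_param
  let g : (Fin 2 → ℝ) → ℝ := fun v =>
    pullback (E := Fin 2 → ℝ) (E' := E) F w.toFun v ![![1, 0], ![0, 1]]
  have hg : ContDiff ℝ ∞ g := contDiff_iff_contDiffAt.2 fun v =>
    contDiffAt_pullback_two_apply F.contMDiff.contMDiffAt w _ _
  obtain ⟨b', hb', hbi', hbd'⟩ := exists_primitive_fst hg
  -- With this sign d(b dy) = -F^*w, so there is a global lift `φ` over the plane whose connection
  -- form is b dy. That form vanishes on the edge x = 0 because b does, and on the edge y = 0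
  -- because dy does; only the hypotenuse contributes.
  let b : (Fin 2 → ℝ) → ℝ := fun v => - b' v
  have hb : ContDiff ℝ ∞ b := hb'.neg
  have hflat : IsFlatPair w.toFun F (fun v => b v • planeForm) := isFlatPair_plane hb fun v => by
    simp only [b, fderiv_fun_neg, neg_apply]
    rw [hbd' v]
  obtain ⟨φ, hφ⟩ := hflat.exists_lift hθ hcurv F.contMDiff
  have hφs : ContMDiff 𝓘(ℝ, Fin 2 → ℝ) 𝓘(ℝ, ER) ∞ φ := contMDiffOn_univ.1 hφ.smooth
  -- Transport along an affine edge `ε`, computed with the lift `φ ∘ ε`.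
  have key : ∀ (γ : SmoothSimplex E X 1) (ε : ℝ → Fin 2 → ℝ) (ε' : Fin 2 → ℝ) (A : ℝ → ℝ),
      (∀ x, HasDerivAt ε ε' x) → ContDiff ℝ ∞ ε →
      (∀ x ∈ Icc (0 : ℝ) 1, ε x ∈ SmoothSimplex.corner 2 ∧ γ.param (fun _ => x) = σ.param (ε x)) →
      ContDiff ℝ ∞ A → (∀ x, deriv A x = b (ε x) * ε' 1) →
      Circle.exp (2 * Real.pi * holonomyCochain P θ.toFun γ) =
        P.coord (φ (ε 0)) / P.coord (φ (ε 1)) * Circle.exp (2 * Real.pi * (A 1 - A 0)) := by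
    intro γ ε ε' A hε hεs hγ hA hAd
    refine exp_holonomyCochain_of_curve hθ (c := φ ∘ ε) (hφs.comp hεs.contMDiff)
      (fun x hx => ?_) hA (fun x => ?_)
    · rw [(hγ x hx).2, ← hF _ (hγ x hx).1]
      exact hφ.proj _ (mem_univ _)
    · rw [pullback_comp θ.toFun (hφs.mdifferentiableAt (by simp))
        (hεs.contMDiff.mdifferentiableAt (by simp)), pullback_one_apply, hφ.form _ (mem_univ _),
        tangentAt_eq_fderiv, fderiv_apply_one_eq_deriv, (hε x).deriv, hAd,
        ContinuousAlternatingMap.smul_apply, planeForm_apply, smul_eq_mul]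
  have hder : ∀ (p q p' q' : ℝ), (∀ x, HasDerivAt (fun x : ℝ => (![p * x + q, p' * x + q'] :
      Fin 2 → ℝ)) ![p, p'] x) ∧ ContDiff ℝ ∞ (fun x : ℝ => (![p * x + q, p' * x + q'] : Fin 2 → ℝ)) := by
    intro p q p' q'
    have h : ∀ (p q x : ℝ), HasDerivAt (fun x : ℝ => p * x + q) p x := fun p q x => by
      simpa using ((hasDerivAt_id x).const_mul p).add_const q
    refine ⟨fun x => hasDerivAt_pi.2 fun i => ?_, contDiff_pi.2 fun i => ?_⟩
    · fin_cases i
      · exact h p q x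
      · exact h p' q' x
    · fin_cases i
      · change ContDiff ℝ ∞ (fun x : ℝ => p * x + q); fun_prop
      · change ContDiff ℝ ∞ (fun x : ℝ => p' * x + q'); fun_prop
  have hb0 : ∀ y, b ![0, y] = 0 := fun y => by simp [b, hbi']
  have k1 := key (σ.face 1) _ _ (fun _ => 0) (hder 0 0 1 0).1 (hder 0 0 1 0).2 (fun x hx => by
    simp only [zero_mul, add_zero, one_mul]
    exact ⟨SmoothSimplex.mem_corner_two le_rfl hx.1 (by linarith [hx.2]), σ.param_face_one hx⟩)
    contDiff_const (fun x => by simp [hb0])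
  have k2 := key (σ.face 2) _ _ (fun _ => 0) (hder 1 0 0 0).1 (hder 1 0 0 0).2 (fun x hx => by
    simp only [zero_mul, add_zero, one_mul]
    exact ⟨SmoothSimplex.mem_corner_two hx.1 le_rfl (by linarith [hx.2]), σ.param_face_two hx⟩)
    contDiff_const (fun x => by simp)
  have hprim := contDiff_primitive (hb.comp (hder (-1) 1 1 0).2)
  have k0 := key (σ.face 0) _ _ _ (hder (-1) 1 1 0).1 (hder (-1) 1 1 0).2 (fun x hx => by
    have h1 : -1 * x + 1 = 1 - x := by ring
    simp only [h1, add_zero, one_mul]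
    exact ⟨SmoothSimplex.mem_corner_two (by linarith [hx.2]) hx.1 (by linarith),
      σ.param_face_zero hx⟩)
    hprim.1 (fun x => by rw [hprim.2]; simp)
  -- The inner integral over x ends at 1 - y, on the hypotenuse, and is there the primitive -b.
  have hI : SmoothSimplex.integral w.toFun σ = - ((∫ y in (0 : ℝ)..1,
      (b ∘ fun x : ℝ => (![-1 * x + 1, 1 * x + 0] : Fin 2 → ℝ)) y) -
      ∫ y in (0 : ℝ)..0, (b ∘ fun x : ℝ => (![-1 * x + 1, 1 * x + 0] : Fin 2 → ℝ)) y) := by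
    rw [SmoothSimplex.integral_eq _ _ hF, intervalIntegral.integral_same, sub_zero,
      ← intervalIntegral.integral_neg]
    have h1 : (fun i : Fin 2 => (Pi.single i 1 : Fin 2 → ℝ)) = ![![1, 0], ![0, 1]] := by
      ext i j; fin_cases i <;> fin_cases j <;> simp
    rw [h1]
    refine (SmoothSimplex.integral_corner_two hg.continuous).trans ?_
    refine intervalIntegral.integral_congr fun y _ => ?_
    simp only [Function.comp_apply, b, hbi', neg_neg, one_mul, add_zero]
    congr 1
    ring
  rw [hI]
  have hco : (holonomyCochain P θ.toFun).coboundary σ =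
      (-1) ^ ((0 : Fin 3) : ℕ) * holonomyCochain P θ.toFun (σ.face 0) +
      (-1) ^ ((1 : Fin 3) : ℕ) * holonomyCochain P θ.toFun (σ.face 1) +
      (-1) ^ ((2 : Fin 3) : ℕ) * holonomyCochain P θ.toFun (σ.face 2) := Fin.sum_univ_three _
  rw [hco]
  set I₀ := (∫ y in (0 : ℝ)..1,
      (b ∘ fun x : ℝ => (![-1 * x + 1, 1 * x + 0] : Fin 2 → ℝ)) y) -
      ∫ y in (0 : ℝ)..0, (b ∘ fun x : ℝ => (![-1 * x + 1, 1 * x + 0] : Fin 2 → ℝ)) y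
  have e : 2 * Real.pi * (-I₀ + ((-1) ^ ((0 : Fin 3) : ℕ) * holonomyCochain P θ.toFun (σ.face 0) +
      (-1) ^ ((1 : Fin 3) : ℕ) * holonomyCochain P θ.toFun (σ.face 1) +
      (-1) ^ ((2 : Fin 3) : ℕ) * holonomyCochain P θ.toFun (σ.face 2))) =
      2 * Real.pi * holonomyCochain P θ.toFun (σ.face 0) -
      2 * Real.pi * holonomyCochain P θ.toFun (σ.face 1) +
      2 * Real.pi * holonomyCochain P θ.toFun (σ.face 2) - 2 * Real.pi * I₀ := by
    simp
    ring
  rw [e, Circle.exp_sub, Circle.exp_add, Circle.exp_sub, k0, k1, k2]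
  simp only [mul_zero, zero_add, mul_one, add_zero, sub_self, Circle.exp_zero,
    neg_add_cancel]
  -- The coordinates at each vertex occur once with each exponent, and the hypotenuse term cancels
  -- the integral.
  generalize P.coord (φ ![1, 0]) = a
  generalize P.coord (φ ![0, 1]) = b
  generalize P.coord (φ ![0, 0]) = c
  generalize Circle.exp (2 * Real.pi * I₀) = d
  simp only [div_eq_mul_inv, mul_inv, inv_inv]
  rw [show a * b⁻¹ * d * (c⁻¹ * b) * (c * a⁻¹) * d⁻¹ = (a * a⁻¹) * (b * b⁻¹) * (c * c⁻¹) * (d * d⁻¹) by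
    ac_rfl]
  simp

end Triangles

/-! ### Integrality of the class of the cocycle. -/

section Edges

namespace SmoothSimplex

variable {E M : Type*} [NormedAddCommGroup E] [NormedSpace ℝ E] [TopologicalSpace M]
  [ChartedSpace E M]

theorem zero_mem_corner_zero : (0 : Fin 0 → ℝ) ∈ corner 0 :=
  mem_corner.2 ⟨fun i => i.elim0, by simp⟩

theorem param_face_zero_of_edge (σ : SmoothSimplex E M 1) :
    (σ.face 0).param 0 = σ.param (fun _ => 1) := by
  refine σ.param_face 0 zero_mem_corner_zero (const_mem_corner ⟨zero_le_one, le_rfl⟩) ?_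
  ext i
  rw [FunOnFinite.linearMap_apply_apply, Finset.sum_filter]
  refine (Fin.sum_univ_one _).trans ?_
  fin_cases i <;> simp [bary, Fin.cons]
  rfl

theorem param_face_one_of_edge (σ : SmoothSimplex E M 1) :
    (σ.face 1).param 0 = σ.param (fun _ => 0) := by
  refine σ.param_face 1 zero_mem_corner_zero (const_mem_corner ⟨le_rfl, zero_le_one⟩) ?_
  ext i
  rw [FunOnFinite.linearMap_apply_apply, Finset.sum_filter]
  refine (Fin.sum_univ_one _).trans ?_
  fin_cases i <;> simp [bary, Fin.cons]
  rfl

end SmoothSimplex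

end Edges

section IntegralClass

variable {E₀ E₁ ER X₀ X₁ R₁ : Type*}
  [NormedAddCommGroup E₀] [NormedSpace ℝ E₀] [FiniteDimensional ℝ E₀]
  [NormedAddCommGroup E₁] [NormedSpace ℝ E₁] [FiniteDimensional ℝ E₁]
  [NormedAddCommGroup ER] [NormedSpace ℝ ER] [FiniteDimensional ℝ ER]
  [TopologicalSpace X₀] [ChartedSpace E₀ X₀] [IsManifold 𝓘(ℝ, E₀) ∞ X₀]
  [TopologicalSpace X₁] [ChartedSpace E₁ X₁] [IsManifold 𝓘(ℝ, E₁) ∞ X₁]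
  [TopologicalSpace R₁] [ChartedSpace ER R₁] [IsManifold 𝓘(ℝ, ER) ∞ R₁] [MulAction Circle R₁]
  {s t : SurjSubmersion E₁ E₀ X₁ X₀}
  {G : LieGroupoid s t} {P : PrincipalCircleBundle ER E₁ R₁ X₁}
  {θ : DiffForm ER R₁ 1} {η : DiffForm G.E₂ G.X₂ 1} {w : DiffForm E₁ X₁ 2}
  {e : SmoothMap E₀ ER X₀ R₁}

namespace ExtensionData

/-- The pair of chosen points over a composable pair. -/
noncomputable def pointPair (P : PrincipalCircleBundle ER E₁ R₁ X₁) (p : FibProd t.toMap s) :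
    PairSpace s t P :=
  ⟨P.point p.left, P.point p.right, by
    change t.toMap (P.proj.toMap _) = s.toMap (P.proj.toMap _)
    rw [P.proj_point, P.proj_point]; exact p.condition⟩

variable (D : ExtensionData G P θ η w e)

/-- The circle-valued two-cocycle of the extension with respect to the chosen points. -/
noncomputable def mulCoord (p : FibProd t.toMap s) : Circle := P.coord (D.mul (pointPair P p))

/-- Each factor is its coordinate times the chosen point, and the multiplication is equivariant in
both arguments. -/
theorem coord_mul (p : PairSpace s t P) : P.coord (D.mul p) =
    P.coord p.left * P.coord p.right * D.mulCoord (pairProj s t P p) := by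
  have h : p = pairSmul P (P.coord p.left) (P.coord p.right) (pointPair P (pairProj s t P p)) :=
    FibProd.ext (P.coord_smul_point p.left).symm (P.coord_smul_point p.right).symm
  refine (congrArg (fun q => P.coord (D.mul q)) h).trans ?_
  rw [D.mul_pairSmul, P.coord_smul]
  rfl

/-- Associativity on chosen points, read in coordinates; the coordinates of the three factors
cancel. -/
theorem mulCoord_cocycle (p : G.X₃) : D.mulCoord (G.pr₂₃ p) * D.mulCoord (G.mul₂₃ p) =
    D.mulCoord (G.mul₁₂ p) * D.mulCoord (G.pr₁₂ p) := by
  let x := P.point p.left.left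
  let y := P.point p.left.right
  let z := P.point p.right
  have hx : P.proj.toMap x = p.left.left := P.proj_point _
  have hy : P.proj.toMap y = p.left.right := P.proj_point _
  have hz : P.proj.toMap z = p.right := P.proj_point _
  have hxy : (t.comp P.proj).toMap x = (s.comp P.proj).toMap y := by
    change t.toMap (P.proj.toMap x) = s.toMap (P.proj.toMap y)
    rw [hx, hy]; exact p.left.condition
  have hyz : (t.comp P.proj).toMap y = (s.comp P.proj).toMap z := by
    change t.toMap (P.proj.toMap y) = s.toMap (P.proj.toMap z)
    rw [hy, hz]; exact p.condition
  have h := congrArg P.coord (D.mul_assoc x y z hxy hyz)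
  rw [D.coord_mul, D.coord_mul ⟨x, D.mul ⟨y, z, hyz⟩, _⟩] at h
  have e1 : pairProj s t P ⟨x, y, hxy⟩ = G.pr₁₂ p := FibProd.ext hx hy
  have e2 : pairProj s t P ⟨y, z, hyz⟩ = G.pr₂₃ p := FibProd.ext hy hz
  have e3 : pairProj s t P ⟨D.mul ⟨x, y, hxy⟩, z, (D.t_mul ⟨x, y, hxy⟩).trans hyz⟩ =
      G.mul₁₂ p :=
    FibProd.ext ((D.proj_mulFun ⟨x, y, hxy⟩).trans (congrArg G.mul e1)) hz
  have e4 : pairProj s t P ⟨x, D.mul ⟨y, z, hyz⟩, hxy.trans (D.s_mul ⟨y, z, hyz⟩).symm⟩ =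
      G.mul₂₃ p :=
    FibProd.ext hx ((D.proj_mulFun ⟨y, z, hyz⟩).trans (congrArg G.mul e2))
  rw [e3, e4] at h
  change P.coord (D.mul ⟨x, y, hxy⟩) * P.coord z * _ = P.coord x * P.coord (D.mul ⟨y, z, hyz⟩) * _
    at h
  rw [D.coord_mul, D.coord_mul, e1, e2] at h
  change P.coord x * P.coord y * _ * P.coord z * _ = P.coord x * (P.coord y * P.coord z * _) * _
    at h
  refine mul_left_cancel (a := P.coord x * P.coord y * P.coord z) ?_
  calc _ = P.coord x * (P.coord y * P.coord z * D.mulCoord (G.pr₂₃ p)) *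
        D.mulCoord (G.mul₂₃ p) := by ac_rfl
    _ = _ := h.symm
    _ = _ := by ac_rfl

/-- The logarithm of the two-cocycle of the extension. -/
noncomputable def mulCochain : Cochain G.E₂ G.X₂ 0 := fun γ => - circleLog (D.mulCoord (γ.param 0))

theorem exp_mulCochain (γ : SmoothSimplex G.E₂ G.X₂ 0) :
    Circle.exp (2 * Real.pi * D.mulCochain γ) = (D.mulCoord (γ.param 0))⁻¹ := by
  rw [mulCochain, mul_neg, Circle.exp_neg, exp_circleLog]

/-- The product of horizontal lifts of the two components lies over the product edge and has
connection form -η. Comparing it with parallel transport there produces ∫η, and its end coordinates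
produce the two-cocycle at the ends. -/
theorem exp_integral_sub_coboundary (σ : SmoothSimplex G.E₂ G.X₂ 1) :
    Circle.exp (2 * Real.pi * (SmoothSimplex.integral η.toFun σ - (D.mulCochain.coboundary σ +
      ((holonomyCochain P θ.toFun).pullback G.pr₂ σ -
        (holonomyCochain P θ.toFun).pullback G.mul σ +
        (holonomyCochain P θ.toFun).pullback G.pr₁ σ)))) = 1 := by
  obtain ⟨F, hF⟩ := σ.exists_smooth_param
  let diag : SmoothMap ℝ (Fin 1 → ℝ) ℝ (Fin 1 → ℝ) :=
    ⟨fun x _ => x, SmoothSimplex.contMDiff_diag⟩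
  let l : SmoothMap ℝ G.E₂ ℝ G.X₂ := F.comp diag
  have hl : ∀ x ∈ Icc (0 : ℝ) 1, l x = σ.param (fun _ => x) := fun x hx =>
    hF _ (SmoothSimplex.const_mem_corner hx)
  obtain ⟨c₁, h₁⟩ := exists_horizontalLift_curve D.connection D.curv (G.pr₁.comp l).contMDiff
  obtain ⟨c₂, h₂⟩ := exists_horizontalLift_curve D.connection D.curv (G.pr₂.comp l).contMDiff
  let d₁ : SmoothMap ℝ ER ℝ R₁ := ⟨c₁, contMDiffOn_univ.1 h₁.smooth⟩
  let d₂ : SmoothMap ℝ ER ℝ R₁ := ⟨c₂, contMDiffOn_univ.1 h₂.smooth⟩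
  have hp₁ : ∀ x, P.proj.toMap (d₁ x) = (l x).left := fun x => h₁.proj x (mem_univ _)
  have hp₂ : ∀ x, P.proj.toMap (d₂ x) = (l x).right := fun x => h₂.proj x (mem_univ _)
  let k : SmoothMap ℝ (FibModel ER ER E₀) ℝ (PairSpace s t P) := FibProd.lift d₁ d₂ fun x => by
    change t.toMap (P.proj.toMap (d₁ x)) = s.toMap (P.proj.toMap (d₂ x))
    rw [hp₁, hp₂]; exact (l x).condition
  have hk : (pairProj s t P).comp k = l :=
    ContMDiffMap.ext fun x => FibProd.ext (hp₁ x) (hp₂ x)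
  have hkx : ∀ x, pairProj s t P (k x) = l x := fun x => congrArg (fun c => c x) hk
  let a : ℝ → ℝ := fun x => pullback (E := ℝ) (E' := G.E₂) l η.toFun x ![(1 : ℝ)]
  have ha : ContDiff ℝ ∞ a := contDiff_iff_contDiffAt.2 fun x => by
    have h1 := contDiffAt_pullback_one l.contMDiff.contMDiffAt η (v := x)
    have h2 := ((oneFormEquiv ℝ).contDiff.contDiffAt.comp x h1).clm_apply
      (contDiffAt_const (c := (1 : ℝ)))
    refine h2.congr_of_eventuallyEq (Filter.Eventually.of_forall fun y => ?_)
    exact (oneFormEquiv_apply _ _).symm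
  have hA := contDiff_primitive ha
  -- Both factors are horizontal, so of the three terms of `mulForm` only -η is left.
  have hform : ∀ x, pullback (E := ℝ) (E' := ER) (D.mul.comp k) θ.toFun x ![(1 : ℝ)] =
      deriv (fun x => - ∫ y in (0 : ℝ)..x, a y) x := by
    intro x
    rw [deriv.fun_neg, hA.2, pullback_smoothMap_comp, D.pullback_mul, pullback_mulForm, hk]
    have e1 : pullback (E := ℝ) (E' := ER) (fun x => (k x).left) θ.toFun x = 0 :=
      h₁.form x (mem_univ _)
    have e2 : pullback (E := ℝ) (E' := ER) (fun x => (k x).right) θ.toFun x = 0 :=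
      h₂.form x (mem_univ _)
    simp only [Pi.add_apply, Pi.sub_apply, e1, e2, add_zero, zero_sub,
      ContinuousAlternatingMap.neg_apply]
    rfl
  have hI : SmoothSimplex.integral η.toFun σ = ∫ y in (0 : ℝ)..1, a y := by
    rw [SmoothSimplex.integral_eq _ _ hF]
    have h1 : (fun i : Fin 1 => (Pi.single i 1 : Fin 1 → ℝ)) = ![fun _ => 1] := by
      ext i j; fin_cases i; fin_cases j; simp
    rw [h1]
    refine (SmoothSimplex.integral_corner_one _).trans ?_
    refine intervalIntegral.integral_congr fun y _ => ?_
    change pullback (E := Fin 1 → ℝ) (E' := G.E₂) F η.toFun (diag y) ![fun _ => 1] = a y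
    simp only [a, l]
    rw [pullback_smoothMap_comp, pullback_one_apply (E := ℝ) (E' := Fin 1 → ℝ)]
    have hd : HasDerivAt (fun (x : ℝ) (_ : Fin 1) => x) (fun _ => 1) y :=
      hasDerivAt_pi.2 fun _ => hasDerivAt_id y
    have h2 : tangentAt (E := ℝ) (E' := Fin 1 → ℝ) diag y 1 = fun _ => 1 := by
      rw [tangentAt_eq_fderiv, fderiv_apply_one_eq_deriv]
      exact hd.deriv
    rw [h2]
  have m₁ := exp_holonomyCochain_of_curve (P := P) D.connection (γ := σ.map G.pr₁) d₁.contMDiff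
    (fun x hx => by rw [SmoothSimplex.param_map, ← hl x hx]; exact hp₁ x) (A := fun _ => 0)
    contDiff_const (fun x => by
      have := h₁.form x (mem_univ _)
      rw [deriv_const]
      exact congrArg (fun B => B ![(1 : ℝ)]) this)
  have m₂ := exp_holonomyCochain_of_curve (P := P) D.connection (γ := σ.map G.pr₂) d₂.contMDiff
    (fun x hx => by rw [SmoothSimplex.param_map, ← hl x hx]; exact hp₂ x) (A := fun _ => 0)
    contDiff_const (fun x => by
      have := h₂.form x (mem_univ _)
      rw [deriv_const]
      exact congrArg (fun B => B ![(1 : ℝ)]) this)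
  have m₃ := exp_holonomyCochain_of_curve (P := P) D.connection (γ := σ.map G.mul)
    (D.mul.comp k).contMDiff
    (fun x hx => by
      rw [SmoothSimplex.param_map, ← hl x hx, ← hkx]
      exact D.proj_mulFun (k x)) hA.1.neg hform
  have hK : ∀ x, P.coord ((D.mul.comp k) x) =
      P.coord (d₁ x) * P.coord (d₂ x) * D.mulCoord (l x) := fun x => by
    rw [← hkx]; exact D.coord_mul (k x)
  have hco : D.mulCochain.coboundary σ = (-1) ^ ((0 : Fin 2) : ℕ) * D.mulCochain (σ.face 0) +
      (-1) ^ ((1 : Fin 2) : ℕ) * D.mulCochain (σ.face 1) := Fin.sum_univ_two _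
  have v₀ := D.exp_mulCochain (σ.face 0)
  have v₁ := D.exp_mulCochain (σ.face 1)
  rw [σ.param_face_zero_of_edge, ← hl 1 ⟨zero_le_one, le_rfl⟩] at v₀
  rw [σ.param_face_one_of_edge, ← hl 0 ⟨le_rfl, zero_le_one⟩] at v₁
  rw [hK, hK] at m₃
  simp only [intervalIntegral.integral_same, neg_zero, sub_zero, ← hI, mul_neg,
    Circle.exp_neg, sub_self, mul_zero, Circle.exp_zero, mul_one] at m₁ m₂ m₃
  have hsum : 2 * Real.pi * (SmoothSimplex.integral η.toFun σ - (D.mulCochain.coboundary σ +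
      ((holonomyCochain P θ.toFun).pullback G.pr₂ σ -
        (holonomyCochain P θ.toFun).pullback G.mul σ +
        (holonomyCochain P θ.toFun).pullback G.pr₁ σ))) =
      2 * Real.pi * SmoothSimplex.integral η.toFun σ - 2 * Real.pi * D.mulCochain (σ.face 0) +
      2 * Real.pi * D.mulCochain (σ.face 1) -
      2 * Real.pi * holonomyCochain P θ.toFun (σ.map G.pr₂) +
      2 * Real.pi * holonomyCochain P θ.toFun (σ.map G.mul) -
      2 * Real.pi * holonomyCochain P θ.toFun (σ.map G.pr₁) := by
    rw [hco]
    simp only [Cochain.pullback, Fin.val_zero, Fin.val_one, pow_zero, pow_one]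
    ring
  rw [hsum, Circle.exp_sub, Circle.exp_add, Circle.exp_sub, Circle.exp_add, Circle.exp_sub, m₁, m₂,
    m₃, v₀, v₁]
  generalize Circle.exp (2 * Real.pi * SmoothSimplex.integral η.toFun σ) = i
  generalize P.coord (d₁ 0) = a₀
  generalize P.coord (d₁ 1) = a₁
  generalize P.coord (d₂ 0) = b₀
  generalize P.coord (d₂ 1) = b₁
  generalize D.mulCoord (l 0) = k₀
  generalize D.mulCoord (l 1) = k₁
  simp only [div_eq_mul_inv, mul_inv, inv_inv]
  rw [show i * k₁ * k₀⁻¹ * (b₀⁻¹ * b₁) * (a₀ * b₀ * k₀ * (a₁⁻¹ * b₁⁻¹ * k₁⁻¹) * i⁻¹) *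
    (a₀⁻¹ * a₁) = (i * i⁻¹) * (k₁ * k₁⁻¹) * (k₀ * k₀⁻¹) * (b₀ * b₀⁻¹) * (b₁ * b₁⁻¹) * (a₀ * a₀⁻¹) *
    (a₁ * a₁⁻¹) by ac_rfl]
  simp

/-- The cochain on X₀ is 0. The remaining components are treated by the triangle formula, the edge
formula and the cocycle identity. -/
theorem isIntegralClass (D : ExtensionData G P θ η w e) : G.IsIntegralClass η w := by
  refine ⟨0, holonomyCochain P θ.toFun, D.mulCochain, fun σ => ⟨0, ?_⟩, fun σ => ?_, fun σ => ?_,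
    fun σ => ?_⟩
  · simp [Cochain.coboundary]
  · obtain ⟨n, hn⟩ := exists_int_of_exp_eq_one (exp_integral_add_coboundary D.connection D.curv σ)
    refine ⟨n, ?_⟩
    rw [← hn]
    simp [Cochain.pullback]
  · exact exists_int_of_exp_eq_one (D.exp_integral_sub_coboundary σ)
  · refine exists_int_of_exp_eq_one ?_
    have h := D.mulCoord_cocycle (σ.param 0)
    have hsum : 2 * Real.pi * (- (D.mulCochain.pullback G.pr₂₃ σ - D.mulCochain.pullback G.mul₁₂ σ +
        D.mulCochain.pullback G.mul₂₃ σ - D.mulCochain.pullback G.pr₁₂ σ)) =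
        2 * Real.pi * D.mulCochain (σ.map G.mul₁₂) - 2 * Real.pi * D.mulCochain (σ.map G.pr₂₃) -
        2 * Real.pi * D.mulCochain (σ.map G.mul₂₃) +
        2 * Real.pi * D.mulCochain (σ.map G.pr₁₂) := by
      simp only [Cochain.pullback]
      ring
    rw [hsum, Circle.exp_add, Circle.exp_sub, Circle.exp_sub, D.exp_mulCochain, D.exp_mulCochain,
      D.exp_mulCochain, D.exp_mulCochain, SmoothSimplex.param_map, SmoothSimplex.param_map,
      SmoothSimplex.param_map, SmoothSimplex.param_map]
    simp only [div_eq_mul_inv, inv_inv]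
    rw [mul_right_comm, mul_right_comm _ _ (D.mulCoord (G.pr₁₂ _))⁻¹, _root_.mul_assoc, h, ← mul_inv,
      inv_mul_cancel]

end ExtensionData

end IntegralClass

theorem mainTheorem3
    {E₀ E₁ ER X₀ X₁ R₁ : Type*}
    [NormedAddCommGroup E₀] [NormedSpace ℝ E₀] [FiniteDimensional ℝ E₀]
    [NormedAddCommGroup E₁] [NormedSpace ℝ E₁] [FiniteDimensional ℝ E₁]
    [NormedAddCommGroup ER] [NormedSpace ℝ ER] [FiniteDimensional ℝ ER]
    [TopologicalSpace X₀] [ChartedSpace E₀ X₀] [IsManifold 𝓘(ℝ, E₀) ∞ X₀]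
    [T2Space X₀] [SecondCountableTopology X₀]
    [TopologicalSpace X₁] [ChartedSpace E₁ X₁] [IsManifold 𝓘(ℝ, E₁) ∞ X₁]
    [T2Space X₁] [SecondCountableTopology X₁]
    [TopologicalSpace R₁] [ChartedSpace ER R₁] [IsManifold 𝓘(ℝ, ER) ∞ R₁] [MulAction Circle R₁]
    {s t : SurjSubmersion E₁ E₀ X₁ X₀} (G : LieGroupoid s t) (hG : G.IsSConnected)
    (η : DiffForm G.E₂ G.X₂ 1) (w : DiffForm E₁ X₁ 2) (hηw : G.IsDeRhamCocycle η w)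
    (hw : IsIntegralForm w.toFun)
    (P : PrincipalCircleBundle ER E₁ R₁ X₁) (θ : DiffForm ER R₁ 1)
    (hθ : IsConnectionForm θ.toFun)
    (hcurv : extD θ.toFun = - pullback (E := ER) (E' := E₁) P.proj.toMap w.toFun)
    (hhol : HolonomyFree (FibProd.fst G.one P.proj) (unitConnection G P θ η)) :
    (∃ σ, IsHorizontalUnitSection G P θ η σ) ∧
    (∀ σ, IsHorizontalUnitSection G P θ η σ →
      ∃! R : CentralExtension G P,
        (∀ u, R.one u = (σ u).right) ∧ R.HasPseudoCurvature θ η w) ∧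
    G.IsIntegralClass η w := by
  -- Only the component of the section in `R₁` is kept; horizontality becomes the equality of the
  -- pull-back of `θ` with that of `η` along `G.one₂`.
  have hdata : ∀ σ, IsHorizontalUnitSection G P θ η σ →
      ExtensionData G P θ η w ((FibProd.snd G.one P.proj).comp σ) := fun σ hσ =>
    ⟨hG, hηw, hθ, hcurv, fun u => hσ.isHorizontalLift.proj u (mem_univ _),
      funext fun u => hσ.isHorizontalLift.form u (mem_univ _)⟩
  obtain ⟨σ₀, hσ₀⟩ := exists_isHorizontalUnitSection hηw hθ hcurv hhol
  refine ⟨⟨σ₀, hσ₀⟩, fun σ hσ => ?_, ?_⟩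
  · exact ⟨(hdata σ hσ).extension, ⟨fun u => rfl, (hdata σ hσ).hasPseudoCurvature_extension⟩,
      fun R hR => (hdata σ hσ).eq_extension hR.1 hR.2⟩
  · exact (hdata σ₀ hσ₀).isIntegralClass
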